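/- **Setting.** Let $\mathcal P = P(\tfrac{d}{dz}) + \tfrac1z Q(\tfrac{d}{dz}) + \tfrac1{z^2}R(z^{-1})$, where $P$ is a monic complex polynomial of degree $d$ all of whose roots are simple, $Q$ is a complex polynomial of degree $d-1$ that is non-zero at every root of $P$, and $R(z^{-1})$ is holomorphic on the disk $|z|>A$ around $z=\infty$ (including $\infty$), with $A>0$. Let $-\alpha$ be a root of $P$, put $\tau = Q(-\alpha)/P'(-\alpha)$, and assume $\operatorname{Re}\tau>0$. Let $\mu\in\mathbb R$ and $0<\delta\le \pi/2$, and let $\Omega=\{\alpha+te^{i\theta} : t>0,\ |\theta-\mu|<\delta\}$ be the open sector with tip $\alpha$, bisecting direction $\mu$ and opening angle $2\delta\le\pi$; assume that no root of $P(-\zeta)$ other than $\alpha$ lies in the closure of $\Omega$. For $\Lambda\in\mathbb R$ let $\widehat\Omega^\Lambda$ be the union of the half-planes $\operatorname{Re}(e^{i\theta}z)>\Lambda$ over $|\theta-\mu|<\delta$, and let $\Delta_\Lambda$ be the distance to the boundary of $\widehat\Omega^\Lambda$. On $\widehat\Omega^\Lambda$ with $\Lambda\ge A$, powers of $z$ are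 defined with $|\arg z+\mu|<\delta+\pi/2$, and on rays they are defined with the given angle as argument. Call $\Psi$ a distinguished solution on $\widehat\Omega^\Lambda$ if $\mathcal P\Psi=0$ there and $\Psi=e^{-\alpha z}\,(z^{-\tau}+h)$ with $h$ holomorphic on $\widehat\Omega^\Lambda$ and $|h|\le C\,\Delta_\Lambda^{-\operatorname{Re}\tau-1}$ for some constant $C$. **Terms.** * A function $\Psi$ is *asymptotic* to the trans-monomial $\tilde\Psi=e^{-\alpha z}z^{-\tau}\sum_{k\ge0}a_kz^{-k}$ along the ray $z\in e^{i\varphi}(0,\infty)$ if, for every $n\ge0$, $\Psi-e^{-\alpha z}z^{-\tau}\sum_{k=0}^n a_kz^{-k}=o\big(e^{-\alpha z}z^{-\tau-n}\big)$ as $z\to\infty$ along the ray. * The *Borel sum* of $\tilde\Psi$ at $\alpha$ in direction $\theta$ is defined when the power series $\sum_n \frac{a_n}{\Gamma(\tau+n)}w^n$ has positive radius of convergence and the sum $(\zeta-\alpha)^{\tau-1}\sum_n \frac{a_n}{\Gamma(\tau+n)}(\zeta-\alpha)^n$ of the Borel transform of $\tilde\Psi$ continues analytically from near $\alpha$ along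 the ray $\alpha+e^{i\theta}(0,\infty)$ to a function $\psi$ that is locally integrable on the ray up to $\alpha$ and satisfies $|\psi|\le Ce^{\Lambda|\zeta-\alpha|}$ on the part of the ray with $|\zeta-\alpha|\ge1$, for some constants $C$ and $\Lambda$. It is then the Laplace transform $\int_{\alpha}^{\alpha+e^{i\theta}\infty}e^{-z\zeta}\psi(\zeta)\,d\zeta$ on the half-plane $\operatorname{Re}(e^{i\theta}z)>\Lambda$. * $\Psi$ is *Borel regular* (at $\alpha$, in direction $\theta$, with respect to the space $e^{-\alpha z}z^{-\tau}\mathbb C[[z^{-1}]]$) if it is holomorphic on a truncated open sector around infinity that contains the end of the ray $e^{-i\theta}(0,\infty)$, is asymptotic along every ray of this sector to one trans-monomial in $e^{-\alpha z}z^{-\tau}\mathbb C[[z^{-1}]]$, and the Borel sum of this trans-monomial at $\alpha$ in direction $\theta$ exists and equals $\Psi$ on some half-plane $\operatorname{Re}(e^{i\theta}z)>\Lambda$. **Statement.** For some $\Lambda\ge A$ there is a distinguished solution $\Psi_\alpha$ on $\widehat\Omega^{\Lambda}$. It is unique: for every $M\ge A$, any distinguished solution on $\widehat\Omega^{M}$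 agrees with $\Psi_\alpha$ on $\widehat\Omega^{\max(\Lambda,M)}$. For every $\theta$ with $|\theta-\mu|<\delta$, the solution $\Psi_\alpha$ is Borel regular at $\alpha$ in direction $\theta$. More precisely, there is a formal solution $\tilde\Psi_\alpha\in e^{-\alpha z}z^{-\tau}\,\mathbb C[[z^{-1}]]$ of $\mathcal P\tilde\Psi_\alpha=0$ such that $\Psi_\alpha$ is asymptotic to $\tilde\Psi_\alpha$ along every ray $e^{i\varphi}(0,\infty)$ with $|\varphi+\mu|<\delta+\pi/2$, and such that, for every $\theta$ with $|\theta-\mu|<\delta$, the Borel sum of $\tilde\Psi_\alpha$ at $\alpha$ in direction $\theta$ exists and equals $\Psi_\alpha$ on the half-plane $\operatorname{Re}(e^{i\theta}z)>\Lambda$. -/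

import Mathlib

noncomputable section

namespace BorelReg

/-- The power `z ^ s = exp (s * log z)`, where `log z` is the branch of the logarithm whose
imaginary part lies in `(ν - π, ν + π]`. The angle `ν` is an extended angle (a real number, not
taken modulo `2π`). On the ray `z = t * exp (I ν)`, `t > 0`, it is `exp (s * (Real.log t + I ν))`. -/
def branchPow (ν : ℝ) (z s : ℂ) : ℂ :=
  Complex.exp (s * (Complex.log (z * Complex.exp (-(ν * Complex.I))) + ν * Complex.I))

/-- The point at distance `t` from `b` in direction `θ`. -/
def rayPoint (b : ℂ) (θ t : ℝ) : ℂ :=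
  b + t * Complex.exp (θ * Complex.I)

/-- The open sector with tip `α`, bisected by the direction `μ`, of opening angle `2 * δ`. -/
def sector (α : ℂ) (μ δ : ℝ) : Set ℂ :=
  {ζ | ∃ θ t : ℝ, |θ - μ| < δ ∧ 0 < t ∧ ζ = rayPoint α θ t}

/-- The frequency domain dual to a sector with bisector `μ` and opening angle `2 * δ`: the union
of the half-planes `Re (exp (I θ) * z) > Λ` over all angles `θ` in the opening of the sector. -/
def dualDomain (μ δ Λ : ℝ) : Set ℂ :=
  {z | ∃ θ : ℝ, |θ - μ| < δ ∧ Λ < (Complex.exp (θ * Complex.I) * z).re}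

/-- Membership in the space of holomorphic functions on the dual domain that are bounded by a
constant multiple of `Δ ^ σ`, where `Δ` is the distance to the boundary of the domain. -/
structure MemDualSpace (μ δ Λ σ : ℝ) (f : ℂ → ℂ) : Prop where
  holo : DifferentiableOn ℂ f (dualDomain μ δ Λ)
  bound : ∃ C : ℝ, ∀ z ∈ dualDomain μ δ Λ,
    ‖f z‖ ≤ C * (Metric.infDist z (frontier (dualDomain μ δ Λ))) ^ σ

/-- The differential operator `P (d/dz) + z⁻¹ * Q (d/dz) + z⁻² * R (z⁻¹)`, applied to `Φ` and
evaluated at `z`. -/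
def levelOneOp (P Q : Polynomial ℂ) (R : ℂ → ℂ) (Φ : ℂ → ℂ) (z : ℂ) : ℂ :=
  P.sum (fun k c => c * iteratedDeriv k Φ z)
    + z⁻¹ * Q.sum (fun k c => c * iteratedDeriv k Φ z)
    + z⁻¹ ^ 2 * R z⁻¹ * Φ z

/-- The exponent `τ_α = Q(-α) / P'(-α)`. -/
def exponent (P Q : Polynomial ℂ) (α : ℂ) : ℂ :=
  Q.eval (-α) / P.derivative.eval (-α)

/-- `Ψ` solves the equation on the dual domain, and lies there in the affine space consisting of
the functions `exp (-α z) * (z ^ (-τ) + h)`, where `h` is holomorphic and bounded by a constant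
multiple of `Δ ^ (-Re τ - 1)`. The dual domain of a sector around the direction `μ` lies around
the direction `-μ`, so that is where the branch of `z ^ (-τ)` is centered. -/
structure IsDistinguishedSolution (P Q : Polynomial ℂ) (R : ℂ → ℂ) (α : ℂ) (μ δ Λ : ℝ)
    (Ψ : ℂ → ℂ) : Prop where
  solves : ∀ z ∈ dualDomain μ δ Λ, levelOneOp P Q R Ψ z = 0
  affine : ∃ h : ℂ → ℂ, MemDualSpace μ δ Λ (-(exponent P Q α).re - 1) h ∧
    ∀ z ∈ dualDomain μ δ Λ,
      Ψ z = Complex.exp (-α * z) * (branchPow (-μ) z (-exponent P Q α) + h z)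

/-- A formal trans-monomial `exp (-α z) * z ^ (-τ) * F (z⁻¹)` is represented by the formal power
series `F`. This is the action of `d/dz` on `F`: with `w = z⁻¹`, it sends `F` to
`-α F - τ w F - w ^ 2 F'(w)`. -/
def formalDeriv (α τ : ℂ) : Module.End ℂ (PowerSeries ℂ) :=
  -(α • LinearMap.id) - τ • LinearMap.mulLeft ℂ PowerSeries.X
    - LinearMap.mulLeft ℂ (PowerSeries.X ^ 2) ∘ₗ (PowerSeries.derivative ℂ).toLinearMap

/-- The Taylor series of `R` at `0`. -/
def taylorSeries (R : ℂ → ℂ) : PowerSeries ℂ :=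
  PowerSeries.mk fun n => iteratedDeriv n R 0 / (n.factorial : ℂ)

/-- The trans-monomial `exp (-α z) * z ^ (-τ) * F (z⁻¹)` is a formal solution of the equation
`[P (d/dz) + z⁻¹ * Q (d/dz) + z⁻² * R (z⁻¹)] Φ = 0`. -/
def IsFormalSolution (P Q : Polynomial ℂ) (R : ℂ → ℂ) (α τ : ℂ) (F : PowerSeries ℂ) : Prop :=
  Polynomial.aeval (formalDeriv α τ) P F
    + PowerSeries.X * Polynomial.aeval (formalDeriv α τ) Q F
    + PowerSeries.X ^ 2 * taylorSeries R * F = 0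

/-- Along the ray toward infinity with extended angle `φ`, the function `Φ` is asymptotic to the
trans-monomial `exp (-α z) * z ^ (-τ) * F (z⁻¹)`, to all orders. -/
def IsAsymptoticAlong (α τ : ℂ) (F : PowerSeries ℂ) (Φ : ℂ → ℂ) (φ : ℝ) : Prop :=
  ∀ n : ℕ,
    (fun r : ℝ =>
      Φ (rayPoint 0 φ r)
        - Complex.exp (-α * rayPoint 0 φ r) * branchPow φ (rayPoint 0 φ r) (-τ)
          * ∑ k ∈ Finset.range (n + 1), PowerSeries.coeff k F * (rayPoint 0 φ r)⁻¹ ^ k)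
    =o[Filter.atTop]
    (fun r : ℝ =>
      Complex.exp (-α * rayPoint 0 φ r) * branchPow φ (rayPoint 0 φ r) (-τ)
        * (rayPoint 0 φ r)⁻¹ ^ n)

/-- `Φ` has the trans-monomial given by `F` as its asymptotic expansion on a (possibly truncated)
open sector around infinity that contains the end of the ray with extended angle `ν`. -/
def IsAsymptoticExpansionAt (α τ : ℂ) (F : PowerSeries ℂ) (Φ : ℂ → ℂ) (ν : ℝ) : Prop :=
  ∃ η r₀ : ℝ, 0 < η ∧ 0 ≤ r₀ ∧
    DifferentiableOn ℂ Φ {z | ∃ φ r : ℝ, |φ - ν| < η ∧ r₀ < r ∧ z = rayPoint 0 φ r} ∧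
    ∀ φ : ℝ, |φ - ν| < η → IsAsymptoticAlong α τ F Φ φ

/-- The Borel transform sends `exp (-α z) * z ^ (-τ - n)` to
`(ζ - α) ^ (τ + n - 1) / Γ (τ + n)`, so it sends the trans-monomial given by `F` to
`(ζ - α) ^ (τ - 1) * ∑ bₙ (ζ - α) ^ n`, where the power series `∑ bₙ X ^ n` is the following. -/
def borelTransform (τ : ℂ) (F : PowerSeries ℂ) : PowerSeries ℂ :=
  PowerSeries.mk fun n => PowerSeries.coeff n F / Complex.Gamma (τ + n)

/-- The Laplace transform of `ψ` along the ray from `α` in direction `θ`. -/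
def laplace (α : ℂ) (θ : ℝ) (ψ : ℂ → ℂ) (z : ℂ) : ℂ :=
  ∫ t in Set.Ioi (0 : ℝ),
    Complex.exp (-z * rayPoint α θ t) * ψ (rayPoint α θ t) * Complex.exp (θ * Complex.I)

/-- Along the ray from `α` in direction `θ`, the function `ψ` is locally integrable (including at
the starting point) and uniformly of exponential type `Λ` away from the starting point. This makes
the Laplace integral converge absolutely on the half-plane `Re (exp (I θ) * z) > Λ`. -/
structure IsLaplaceTransformable (α : ℂ) (θ Λ : ℝ) (ψ : ℂ → ℂ) : Prop where
  locInt : ∀ T : ℝ, MeasureTheory.IntegrableOn (fun t : ℝ => ψ (rayPoint α θ t)) (Set.Ioc 0 T)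
  expType : ∃ C : ℝ, ∀ t : ℝ, 1 ≤ t → ‖ψ (rayPoint α θ t)‖ ≤ C * Real.exp (Λ * t)

/-- `Φ` is, on the half-plane `Re (exp (I θ) * z) > Λ`, the Borel sum at `α` in direction `θ` of
the trans-monomial `exp (-α z) * z ^ (-τ) * F (z⁻¹)`: the Borel transform converges near `α`, its
sum continues to a function `ψ` that is holomorphic around the ray from `α` in direction `θ` and is
of exponential type `Λ` along this ray, and `Φ` is the Laplace transform of `ψ`. -/
def IsBorelSum (α τ : ℂ) (F : PowerSeries ℂ) (θ Λ : ℝ) (Φ : ℂ → ℂ) : Prop :=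
  ∃ (ε : ℝ) (U : Set ℂ) (ψ : ℂ → ℂ),
    0 < ε ∧
    (∀ w : ℂ, ‖w‖ < ε → Summable fun n : ℕ => PowerSeries.coeff n (borelTransform τ F) * w ^ n) ∧
    IsOpen U ∧ (∀ t : ℝ, 0 < t → rayPoint α θ t ∈ U) ∧
    DifferentiableOn ℂ ψ U ∧
    (∀ t : ℝ, 0 < t → t < ε →
      ψ (rayPoint α θ t) = branchPow θ (rayPoint 0 θ t) (τ - 1)
        * ∑' n : ℕ, PowerSeries.coeff n (borelTransform τ F) * rayPoint 0 θ t ^ n) ∧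
    IsLaplaceTransformable α θ Λ ψ ∧
    ∀ z : ℂ, Λ < (Complex.exp (θ * Complex.I) * z).re → Φ z = laplace α θ ψ z

/-- `Φ` is Borel regular at `α` in direction `θ`, with respect to the trans-monomial space
`exp (-α z) * z ^ (-τ) * ℂ⟦z⁻¹⟧`: it has an asymptotic expansion in this space around the direction
`-θ`, this expansion is Borel summable at `α` in direction `θ`, and its Borel sum is `Φ`. -/
def IsBorelRegular (α τ : ℂ) (θ : ℝ) (Φ : ℂ → ℂ) : Prop :=
  ∃ F : PowerSeries ℂ, IsAsymptoticExpansionAt α τ F Φ (-θ) ∧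
    ∃ Λ : ℝ, IsBorelSum α τ F θ Λ Φ

end BorelReg

end

/-! Existence. Shift ζ = α + u and write the Borel transform of the sought solution as u^(τ-1) g(u).
Then d/dz becomes multiplication by -ζ, and multiplication by z⁻¹ becomes integration from α. With P
= (X + α) p, the differential equation turns into a Volterra equation g + V g = 0, where (V g)(u) =
∫₀¹ x^(τ-1) K(u, x) g(xu) dx and K(0, x) = -Q(-α)/p(-α) = -τ. At the origin V sends the constant 1
to -τ/τ = -1, so the value g(0) is free. On u^n times a function, V acts with τ replaced by τ + n:
there 1 + V has the value n/(τ+n) ≠ 0 on constants at the origin, so Taylor corrections can be made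
one order at a time, and the size of V is O(1/Re(τ+n)), so after finitely many corrections a Neumann
series converges (`exists_regularSingular_solution`). The kernel is bounded up to an exponential
factor because Q and p have equal degree and the zeros of p(-α-u) stay away from a disk joined to
the sector (`exists_isKernel_borelKernel`).

The Laplace transform of u^(τ-1) g(u) along a ray solves the equation by the convolution theorem
(`levelOneOp_expLaplace`). As a function of the logarithm of the direction it is holomorphic and, by
rescaling, invariant under real translations; hence it is constant and the rays of the sector give
one function on the dual domain (`rayLaplace_eq_of_le`). Splitting g(u) = g(0) + u g₁(u) and
applying Watson's estimate `norm_rayLaplace_le` yields z^(-τ) plus a remainder of order Re τ + 1;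
iterating yields the whole asymptotic expansion. Its coefficients are Γ(τ+n) times the Taylor
coefficients of g, so its Borel transform is the Taylor series of g, and g itself provides the
continuation (`isBorelSum_of_expBdd`). The formal Borel transform is injective and carries the
formal equation to the Volterra equation near the origin, so the expansion is a formal solution
(`isFormalSolution_of_volterra`).

Uniqueness. The difference of two distinguished solutions is e^(-αz) y with y = O(X^(-Re τ-1)) on a
half-plane, where X = Re(e^(iθ) z). Polynomials in D = d/dz act on functions holomorphic on the
half-plane, and y satisfies p₁(D) D y + z⁻¹ q₁(D) y + z⁻² R(z⁻¹) y = 0 with q₁(0) = τ p₁(0). Its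
leading part is p₁(0) (y' + τ y/z); integrating this from infinity improves a decay of order N > Re
τ by one order, so y decays to all orders. For large N the equation is then a contraction: p₁(D) can
be inverted with a constant independent of N (`exists_const_of_prod`), and integrating D y divides
by N. Thus y = 0 far out (`exists_eq_zero_of_decay`), and everywhere by analytic continuation. -/

open MeasureTheory Set Filter Topology Metric

namespace BorelReg

/-! ### Holomorphic parameter integrals and intertwining maps -/

/-- An integral of functions depending holomorphically on a parameter, dominated uniformly in the
parameter on a ball, may be differentiated under the integral sign. -/
theorem hasDerivAt_integral_of_dominated_holomorphic {X : Type*} [MeasurableSpace X]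
    {m : Measure X} {F : ℂ → X → ℂ} {z₀ : ℂ} {ρ : ℝ} {bound : X → ℝ} (hρ : 0 < ρ)
    (hmeas : ∀ z ∈ ball z₀ ρ, AEStronglyMeasurable (F z) m)
    (hdiff : ∀ᵐ x ∂m, DifferentiableOn ℂ (fun z => F z x) (ball z₀ ρ))
    (hb : ∀ᵐ x ∂m, ∀ z ∈ ball z₀ ρ, ‖F z x‖ ≤ bound x) (hint : Integrable bound m) :
    Integrable (fun x => deriv (fun z => F z x) z₀) m ∧
    HasDerivAt (fun z => ∫ x, F z x ∂m) (∫ x, deriv (fun z => F z x) z₀ ∂m) z₀ := by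
  have hz₀ : z₀ ∈ ball z₀ ρ := mem_ball_self hρ
  have hder : ∀ᵐ x ∂m, HasDerivAt (fun z => F z x) (deriv (fun z => F z x) z₀) z₀ := by
    filter_upwards [hdiff] with x hx
    exact (hx.differentiableAt (isOpen_ball.mem_nhds hz₀)).hasDerivAt
  -- Cauchy's estimate on disks of radius ρ/4, which stay in the ball when centred in its concentric
  -- half. It turns the bound on the functions into one on their derivatives, hence into a Lipschitz
  -- constant.
  have hderb : ∀ᵐ x ∂m, ∀ z ∈ ball z₀ (ρ / 2),
      ‖deriv (fun z => F z x) z‖ ≤ bound x / (ρ / 4) := by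
    filter_upwards [hdiff, hb] with x hx hbx z hz
    have hsub : closedBall z (ρ / 4) ⊆ ball z₀ ρ := by
      intro y hy
      have h1 := dist_triangle y z z₀
      rw [mem_closedBall] at hy
      rw [mem_ball] at hz ⊢
      linarith
    refine Complex.norm_deriv_le_of_forall_mem_sphere_norm_le (by positivity) ?_ ?_
    · exact (hx.mono hsub).diffContOnCl_ball subset_rfl
    · intro y hy
      exact hbx y (hsub (sphere_subset_closedBall hy))
  refine hasDerivAt_integral_of_dominated_loc_of_lip (bound := fun x => bound x / (ρ / 4))
    (ball_mem_nhds z₀ (half_pos hρ)) ?_ ?_ ?_ ?_ (hint.div_const _) hder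
  · filter_upwards [isOpen_ball.mem_nhds hz₀] with z hz using hmeas z hz
  · exact hint.mono' (hmeas z₀ hz₀) (hb.mono fun x hx => hx z₀ hz₀)
  -- The derivative is measurable in x as a limit of difference quotients; the shift by 2 in the
  -- steps ρ/(n+2) keeps every point strictly inside the ball.
  · let u : ℕ → ℂ := fun n => ((ρ / (n + 2 : ℝ) : ℝ) : ℂ)
    have hu : Tendsto u atTop (𝓝[≠] 0) := by
      refine tendsto_nhdsWithin_iff.2 ⟨?_, ?_⟩
      · have : Tendsto (fun n : ℕ => ρ / (n + 2 : ℝ)) atTop (𝓝 0) :=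
          tendsto_const_nhds.div_atTop
            (tendsto_atTop_add_const_right _ _ tendsto_natCast_atTop_atTop)
        have h2 := (Complex.continuous_ofReal.tendsto 0).comp this
        simpa [u, Function.comp_def] using h2
      · refine Eventually.of_forall fun n => ?_
        have : (ρ / (n + 2 : ℝ) : ℝ) ≠ 0 := by positivity
        simpa only [u, mem_compl_iff, mem_singleton_iff, Complex.ofReal_eq_zero] using this
    refine aestronglyMeasurable_of_tendsto_ae atTop
      (f := fun n x => (u n)⁻¹ • (F (z₀ + u n) x - F z₀ x)) (fun n => ?_) ?_
    · refine ((hmeas _ ?_).sub (hmeas _ hz₀)).const_smul ((u n)⁻¹)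
      simp only [u, mem_ball, dist_self_add_left, Complex.norm_real]
      rw [Real.norm_of_nonneg (by positivity)]
      rw [div_lt_iff₀ (by positivity)]
      nlinarith [(n.cast_nonneg : (0:ℝ) ≤ n)]
    · filter_upwards [hder] with x hx
      exact (hasDerivAt_iff_tendsto_slope_zero.1 hx).comp hu
  · filter_upwards [hdiff, hderb] with x hx hbx
    have hnn : 0 ≤ bound x / (ρ / 4) :=
      (norm_nonneg _).trans (hbx z₀ (mem_ball_self (half_pos hρ)))
    refine Convex.lipschitzOnWith_of_nnnorm_deriv_le (𝕜 := ℂ) (fun z hz => ?_) (fun z hz => ?_)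
      (convex_ball z₀ (ρ / 2))
    · exact hx.differentiableAt (isOpen_ball.mem_nhds (ball_subset_ball (by linarith) hz))
    · rw [← NNReal.coe_le_coe]
      rw [Real.coe_nnabs]
      exact (hbx z hz).trans (le_abs_self _)

/-- If `B` intertwines two endomorphisms, it intertwines the polynomials in them. -/
theorem aeval_intertwine {V W : Type*} [AddCommGroup V] [Module ℂ V] [AddCommGroup W] [Module ℂ W]
    {B : V →ₗ[ℂ] W} {S : Module.End ℂ V} {T : Module.End ℂ W} (h : ∀ v, B (S v) = T (B v))
    (p : Polynomial ℂ) (v : V) :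
    B (Polynomial.aeval S p v) = Polynomial.aeval T p (B v) := by
  induction p using Polynomial.induction_on' generalizing v with
  | add p q hp hq => simp [hp, hq]
  | monomial n a =>
    have : ∀ n v, B ((S ^ n) v) = (T ^ n) (B v) := by
      intro n
      induction n with
      | zero => simp
      | succ n ih => intro v; simp [pow_succ, ih, h]
    simp [Polynomial.aeval_monomial, this]

/-! ### Volterra equations in functions of exponential type -/

/-- Holomorphic functions on `D` that are uniformly of exponential type `Λ`. -/
structure ExpBdd (D : Set ℂ) (Λ : ℝ) (f : ℂ → ℂ) : Prop where
  holo : DifferentiableOn ℂ f D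
  bound : ∃ C : ℝ, ∀ ζ ∈ D, ‖f ζ‖ ≤ C * Real.exp (Λ * ‖ζ‖)

/-- Admissible kernels for Volterra operators on a star-shaped domain, in terms of the ratio `x` of
the integration variable and the argument. -/
structure IsKernel (D : Set ℂ) (Λ C : ℝ) (K : ℂ → ℝ → ℂ) : Prop where
  holo : ∀ x ∈ Icc (0 : ℝ) 1, DifferentiableOn ℂ (fun ζ => K ζ x) D
  cont : ∀ ζ ∈ D, ContinuousOn (K ζ) (Icc 0 1)
  bound : ∀ ζ ∈ D, ∀ x ∈ Icc (0 : ℝ) 1, ‖K ζ x‖ ≤ C * Real.exp (Λ * (‖ζ‖ * (1 - x)))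

/-- The Volterra operator with the weight `x ^ (σ - 1)`. -/
noncomputable def volterra (K : ℂ → ℝ → ℂ) (σ : ℂ) (h : ℂ → ℂ) (ζ : ℂ) : ℂ :=
  ∫ x in Ioc (0 : ℝ) 1, (x : ℂ) ^ (σ - 1) * (K ζ x * h (x * ζ))

/-- `D` is star-shaped about the origin. -/
def IsStar (D : Set ℂ) : Prop := ∀ ζ ∈ D, ∀ x ∈ Icc (0 : ℝ) 1, (x : ℂ) * ζ ∈ D

theorem integrableOn_rpow_Ioc {s : ℝ} (hs : 0 < s) :
    IntegrableOn (fun x : ℝ => x ^ (s - 1)) (Ioc 0 1) :=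
  (intervalIntegrable_iff_integrableOn_Ioc_of_le zero_le_one).1
    (intervalIntegral.intervalIntegrable_rpow' (by linarith))

theorem integral_rpow_Ioc {s : ℝ} (hs : 0 < s) :
    ∫ x in Ioc (0 : ℝ) 1, x ^ (s - 1) = 1 / s := by
  rw [← intervalIntegral.integral_of_le zero_le_one, integral_rpow (Or.inl (by linarith))]
  simp [hs.ne']

namespace ExpBdd

variable {D : Set ℂ} {Λ : ℝ} {f g : ℂ → ℂ}

theorem add (hf : ExpBdd D Λ f) (hg : ExpBdd D Λ g) : ExpBdd D Λ (fun ζ => f ζ + g ζ) := by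
  obtain ⟨C, hC⟩ := hf.bound
  obtain ⟨C', hC'⟩ := hg.bound
  refine ⟨hf.holo.add hg.holo, C + C', fun ζ hζ => ?_⟩
  rw [add_mul]
  exact (norm_add_le _ _).trans (add_le_add (hC ζ hζ) (hC' ζ hζ))

theorem const_mul (c : ℂ) (hf : ExpBdd D Λ f) : ExpBdd D Λ (fun ζ => c * f ζ) := by
  obtain ⟨C, hC⟩ := hf.bound
  refine ⟨hf.holo.const_mul c, ‖c‖ * C, fun ζ hζ => ?_⟩
  rw [norm_mul, mul_assoc]
  exact mul_le_mul_of_nonneg_left (hC ζ hζ) (norm_nonneg c)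

theorem const (hΛ : 0 ≤ Λ) (c : ℂ) : ExpBdd D Λ (fun _ => c) := by
  refine ⟨differentiableOn_const c, ‖c‖, fun ζ _ => ?_⟩
  exact le_mul_of_one_le_right (norm_nonneg c)
    (Real.one_le_exp (mul_nonneg hΛ (norm_nonneg ζ)))

theorem mono_type {Λ' : ℝ} (h : Λ ≤ Λ') (hf : ExpBdd D Λ f) : ExpBdd D Λ' f := by
  obtain ⟨C, hC⟩ := hf.bound
  refine ⟨hf.holo, |C|, fun ζ hζ => (hC ζ hζ).trans ?_⟩
  exact mul_le_mul (le_abs_self C)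
    (Real.exp_le_exp.2 (mul_le_mul_of_nonneg_right h (norm_nonneg ζ))) (Real.exp_nonneg _)
    (abs_nonneg C)

/-- Multiplication by a power of `ζ` increases the exponential type by an arbitrarily small
amount. -/
theorem pow_mul {Λ' : ℝ} (h : Λ < Λ') (hf : ExpBdd D Λ f) (n : ℕ) :
    ExpBdd D Λ' (fun ζ => ζ ^ n * f ζ) := by
  obtain ⟨C, hC⟩ := hf.bound
  have hε : 0 < Λ' - Λ := sub_pos.2 h
  refine ⟨(differentiableOn_pow n).mul hf.holo, n.factorial / (Λ' - Λ) ^ n * |C|,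
    fun ζ hζ => ?_⟩
  have h1 : ‖ζ‖ ^ n ≤ n.factorial / (Λ' - Λ) ^ n * Real.exp ((Λ' - Λ) * ‖ζ‖) := by
    have := Real.pow_div_factorial_le_exp ((Λ' - Λ) * ‖ζ‖) (by positivity) n
    rw [mul_pow, div_le_iff₀ (by positivity)] at this
    rw [div_mul_eq_mul_div, le_div_iff₀ (by positivity)]
    linarith
  have h2 : ‖f ζ‖ ≤ |C| * Real.exp (Λ * ‖ζ‖) :=
    (hC ζ hζ).trans (mul_le_mul_of_nonneg_right (le_abs_self C) (Real.exp_nonneg _))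
  calc ‖ζ ^ n * f ζ‖ = ‖ζ‖ ^ n * ‖f ζ‖ := by rw [norm_mul, norm_pow]
    _ ≤ (n.factorial / (Λ' - Λ) ^ n * Real.exp ((Λ' - Λ) * ‖ζ‖)) *
        (|C| * Real.exp (Λ * ‖ζ‖)) := mul_le_mul h1 h2 (norm_nonneg _) (by positivity)
    _ = n.factorial / (Λ' - Λ) ^ n * |C| *
        (Real.exp ((Λ' - Λ) * ‖ζ‖) * Real.exp (Λ * ‖ζ‖)) := by ring
    _ = _ := by rw [← Real.exp_add]; congr 2; ring

/-- A function of exponential type that vanishes at the origin is divisible by `ζ`. -/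
theorem exists_eq_mul (hD : IsOpen D) (h0 : (0 : ℂ) ∈ D) (hΛ : 0 ≤ Λ) (hf : ExpBdd D Λ f) :
    ExpBdd D Λ (dslope f 0) := by
  obtain ⟨C, hC⟩ := hf.bound
  have hholo : DifferentiableOn ℂ (dslope f 0) D :=
    (Complex.differentiableOn_dslope (hD.mem_nhds h0)).2 hf.holo
  obtain ⟨r, hr, hrD⟩ := Metric.nhds_basis_closedBall.mem_iff.1 (hD.mem_nhds h0)
  obtain ⟨B, hB⟩ := (isCompact_closedBall (0 : ℂ) r).exists_bound_of_continuousOn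
    (hholo.continuousOn.mono hrD)
  refine ⟨hholo, max B ((|C| + ‖f 0‖) / r), fun ζ hζ => ?_⟩
  have he : 1 ≤ Real.exp (Λ * ‖ζ‖) := Real.one_le_exp (by positivity)
  by_cases hζr : ζ ∈ closedBall (0 : ℂ) r
  · have hB0 : 0 ≤ B := (norm_nonneg _).trans (hB ζ hζr)
    exact (hB ζ hζr).trans ((le_max_left _ _).trans
      (le_mul_of_one_le_right (hB0.trans (le_max_left _ _)) he))
  · have hrζ : r < ‖ζ‖ := by simpa using hζr
    have hζ0 : ζ ≠ 0 := norm_pos_iff.1 (hr.trans hrζ)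
    have h1 : ‖f ζ - f 0‖ ≤ (|C| + ‖f 0‖) * Real.exp (Λ * ‖ζ‖) := by
      have h2 : ‖f ζ‖ ≤ |C| * Real.exp (Λ * ‖ζ‖) :=
        (hC ζ hζ).trans (mul_le_mul_of_nonneg_right (le_abs_self C) (Real.exp_nonneg _))
      have h3 := norm_sub_le (f ζ) (f 0)
      nlinarith [norm_nonneg (f 0)]
    have h4 : ‖dslope f 0 ζ‖ = ‖f ζ - f 0‖ / ‖ζ‖ := by
      rw [dslope_of_ne f hζ0, slope_def_field, norm_div, sub_zero]
    have h5 : ‖dslope f 0 ζ‖ ≤ (|C| + ‖f 0‖) / r * Real.exp (Λ * ‖ζ‖) := by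
      rw [h4, div_mul_eq_mul_div]
      exact div_le_div₀ (by positivity) h1 hr hrζ.le
    exact h5.trans (mul_le_mul_of_nonneg_right (le_max_right _ _) (Real.exp_nonneg _))

end ExpBdd

theorem eq_add_mul_dslope (f : ℂ → ℂ) (ζ : ℂ) : f ζ = f 0 + ζ * dslope f 0 ζ := by
  have := sub_smul_dslope f 0 ζ
  simp only [sub_zero, smul_eq_mul] at this
  rw [this]; ring

theorem IsKernel.mono_type {D : Set ℂ} {Λ Λ' C : ℝ} {K : ℂ → ℝ → ℂ} (hK : IsKernel D Λ C K)
    (hC : 0 ≤ C) (h : Λ ≤ Λ') : IsKernel D Λ' C K := by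
  refine ⟨hK.holo, hK.cont, fun ζ hζ x hx => (hK.bound ζ hζ x hx).trans ?_⟩
  have : 0 ≤ ‖ζ‖ * (1 - x) := mul_nonneg (norm_nonneg _) (sub_nonneg.2 hx.2)
  exact mul_le_mul_of_nonneg_left (Real.exp_le_exp.2 (mul_le_mul_of_nonneg_right h this)) hC

section Volterra

variable {D : Set ℂ} {Λ C : ℝ} {K : ℂ → ℝ → ℂ} {σ : ℂ} {h : ℂ → ℂ}

theorem volterra_aestronglyMeasurable (hs : IsStar D) (hK : IsKernel D Λ C K)
    (hh : ContinuousOn h D) {ζ : ℂ} (hζ : ζ ∈ D) :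
    AEStronglyMeasurable (fun x : ℝ => (x : ℂ) ^ (σ - 1) * (K ζ x * h (x * ζ)))
      (volume.restrict (Ioc 0 1)) := by
  refine ContinuousOn.aestronglyMeasurable ?_ measurableSet_Ioc
  refine ContinuousOn.mul ?_ (((hK.cont ζ hζ).mono Ioc_subset_Icc_self).mul ?_)
  · exact fun x hx => (Complex.continuousAt_ofReal_cpow_const x (σ - 1)
      (Or.inr hx.1.ne')).continuousWithinAt
  · exact hh.comp (by fun_prop) fun x hx => hs ζ hζ x (Ioc_subset_Icc_self hx)

/-- The two exponential weights, in |ζ|(1-x) from the kernel and in |ζ|x from the function, multiply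
to exp(Λ|ζ|) exactly. So the operator preserves the type Λ, and its norm is governed by ∫ x^(Re σ-1)
dx = 1/Re σ. -/
theorem volterra_integrand_bound (hs : IsStar D) (hK : IsKernel D Λ C K) {B : ℝ}
    (hB : ∀ ζ ∈ D, ‖h ζ‖ ≤ B * Real.exp (Λ * ‖ζ‖)) {ζ : ℂ} (hζ : ζ ∈ D) {x : ℝ}
    (hx : x ∈ Ioc (0 : ℝ) 1) :
    ‖(x : ℂ) ^ (σ - 1) * (K ζ x * h (x * ζ))‖
      ≤ x ^ (σ.re - 1) * (C * B * Real.exp (Λ * ‖ζ‖)) := by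
  have hx' := Ioc_subset_Icc_self hx
  rw [norm_mul, Complex.norm_cpow_eq_rpow_re_of_pos hx.1, Complex.sub_re, Complex.one_re]
  refine mul_le_mul_of_nonneg_left ?_ (Real.rpow_nonneg hx.1.le _)
  rw [norm_mul]
  have h1 := hK.bound ζ hζ x hx'
  have h2 := hB _ (hs ζ hζ x hx')
  calc ‖K ζ x‖ * ‖h (x * ζ)‖
      ≤ (C * Real.exp (Λ * (‖ζ‖ * (1 - x)))) * (B * Real.exp (Λ * ‖(x : ℂ) * ζ‖)) :=
        mul_le_mul h1 h2 (norm_nonneg _) ((norm_nonneg _).trans h1)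
    _ = C * B * (Real.exp (Λ * (‖ζ‖ * (1 - x))) * Real.exp (Λ * ‖(x : ℂ) * ζ‖)) := by ring
    _ = _ := by
      rw [← Real.exp_add, norm_mul, Complex.norm_real, Real.norm_of_nonneg hx.1.le]
      congr 2; ring

theorem volterra_integrable (hs : IsStar D) (hK : IsKernel D Λ C K) (hσ : 0 < σ.re)
    (hh : ExpBdd D Λ h) {ζ : ℂ} (hζ : ζ ∈ D) :
    IntegrableOn (fun x : ℝ => (x : ℂ) ^ (σ - 1) * (K ζ x * h (x * ζ))) (Ioc 0 1) := by
  obtain ⟨B, hB⟩ := hh.bound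
  refine Integrable.mono' ((integrableOn_rpow_Ioc hσ).mul_const (C * B * Real.exp (Λ * ‖ζ‖)))
    (volterra_aestronglyMeasurable hs hK hh.holo.continuousOn hζ) ?_
  exact (ae_restrict_iff' measurableSet_Ioc).2
    (Eventually.of_forall fun x hx => volterra_integrand_bound hs hK hB hζ hx)

theorem volterra_bound (hs : IsStar D) (hK : IsKernel D Λ C K) (hσ : 0 < σ.re) {B : ℝ}
    (hB : ∀ ζ ∈ D, ‖h ζ‖ ≤ B * Real.exp (Λ * ‖ζ‖)) {ζ : ℂ} (hζ : ζ ∈ D) :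
    ‖volterra K σ h ζ‖ ≤ C / σ.re * B * Real.exp (Λ * ‖ζ‖) := by
  have h1 : ‖volterra K σ h ζ‖
      ≤ ∫ x in Ioc (0 : ℝ) 1, x ^ (σ.re - 1) * (C * B * Real.exp (Λ * ‖ζ‖)) :=
    norm_integral_le_of_norm_le ((integrableOn_rpow_Ioc hσ).mul_const _)
      ((ae_restrict_iff' measurableSet_Ioc).2
        (Eventually.of_forall fun x hx => volterra_integrand_bound hs hK hB hζ hx))
  rw [integral_mul_const, integral_rpow_Ioc hσ] at h1
  refine h1.trans (le_of_eq ?_)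
  ring

theorem volterra_holo (hD : IsOpen D) (hs : IsStar D) (hK : IsKernel D Λ C K) (hσ : 0 < σ.re)
    (hh : ExpBdd D Λ h) : DifferentiableOn ℂ (volterra K σ h) D := by
  intro ζ₀ hζ₀
  obtain ⟨B, hB⟩ := hh.bound
  obtain ⟨ρ, hρ, hρD⟩ := Metric.isOpen_iff.1 hD ζ₀ hζ₀
  have key := hasDerivAt_integral_of_dominated_holomorphic
    (m := volume.restrict (Ioc (0 : ℝ) 1)) (z₀ := ζ₀)
    (F := fun ζ x => (x : ℂ) ^ (σ - 1) * (K ζ x * h (x * ζ)))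
    (bound := fun x => x ^ (σ.re - 1) * (|C * B| * Real.exp (|Λ| * (‖ζ₀‖ + ρ)))) hρ
    (fun ζ hζ => volterra_aestronglyMeasurable hs hK hh.holo.continuousOn (hρD hζ)) ?_ ?_
    ((integrableOn_rpow_Ioc hσ).mul_const _)
  · exact key.2.differentiableAt.differentiableWithinAt
  · refine (ae_restrict_iff' measurableSet_Ioc).2 (Eventually.of_forall fun x hx => ?_)
    have hx' := Ioc_subset_Icc_self hx
    refine DifferentiableOn.const_mul (((hK.holo x hx').mono hρD).mul ?_) _
    exact hh.holo.comp (by fun_prop) fun ζ hζ => hs ζ (hρD hζ) x hx'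
  · refine (ae_restrict_iff' measurableSet_Ioc).2 (Eventually.of_forall fun x hx ζ hζ => ?_)
    refine (volterra_integrand_bound hs hK hB (hρD hζ) hx).trans ?_
    refine mul_le_mul_of_nonneg_left ?_ (Real.rpow_nonneg hx.1.le _)
    refine mul_le_mul (le_abs_self _) (Real.exp_le_exp.2 ?_) (Real.exp_nonneg _) (abs_nonneg _)
    have hζn : ‖ζ‖ ≤ ‖ζ₀‖ + ρ := by
      have h1 : ‖ζ - ζ₀‖ < ρ := by simpa [dist_eq_norm] using hζ
      have h2 := norm_add_le ζ₀ (ζ - ζ₀)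
      rw [add_sub_cancel] at h2
      linarith
    exact mul_le_mul (le_abs_self Λ) hζn (norm_nonneg _) (abs_nonneg _)

theorem volterra_expBdd (hD : IsOpen D) (hs : IsStar D) (hK : IsKernel D Λ C K) (hσ : 0 < σ.re)
    (hh : ExpBdd D Λ h) : ExpBdd D Λ (volterra K σ h) := by
  obtain ⟨B, hB⟩ := hh.bound
  exact ⟨volterra_holo hD hs hK hσ hh, _, fun ζ hζ => volterra_bound hs hK hσ hB hζ⟩

theorem volterra_add (hs : IsStar D) (hK : IsKernel D Λ C K) (hσ : 0 < σ.re) {f g : ℂ → ℂ}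
    (hf : ExpBdd D Λ f) (hg : ExpBdd D Λ g) {ζ : ℂ} (hζ : ζ ∈ D) :
    volterra K σ (fun ζ => f ζ + g ζ) ζ = volterra K σ f ζ + volterra K σ g ζ := by
  unfold volterra
  rw [← integral_add (volterra_integrable hs hK hσ hf hζ) (volterra_integrable hs hK hσ hg hζ)]
  congr 1; ext x; ring

theorem volterra_const_mul (c : ℂ) (f : ℂ → ℂ) (ζ : ℂ) :
    volterra K σ (fun ζ => c * f ζ) ζ = c * volterra K σ f ζ := by
  unfold volterra
  rw [← integral_const_mul]
  congr 1; ext x; ring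

/-- Passing to functions divisible by ζ^n raises the exponent of the weight by n. This is how the
operator is made small. -/
theorem volterra_pow_mul (n : ℕ) (f : ℂ → ℂ) (ζ : ℂ) :
    volterra K σ (fun ζ => ζ ^ n * f ζ) ζ = ζ ^ n * volterra K (σ + n) f ζ := by
  unfold volterra
  rw [← integral_const_mul]
  refine setIntegral_congr_fun measurableSet_Ioc fun x hx => ?_
  have hx0 : (x : ℂ) ≠ 0 := Complex.ofReal_ne_zero.2 hx.1.ne'
  have : (x : ℂ) ^ (σ + n - 1) = (x : ℂ) ^ (σ - 1) * (x : ℂ) ^ n := by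
    rw [← Complex.cpow_natCast, ← Complex.cpow_add _ _ hx0]; congr 1; ring
  simp only [this, mul_pow]
  ring

/-- A Volterra equation with sufficiently large exponent is solved by its Neumann series. -/
theorem exists_add_volterra_eq (hD : IsOpen D) (hs : IsStar D)
    (hK : IsKernel D Λ C K) (hσ : 0 < σ.re) (hσC : 2 * C ≤ σ.re) {f : ℂ → ℂ}
    (hf : ExpBdd D Λ f) :
    ∃ h, ExpBdd D Λ h ∧ ∀ ζ ∈ D, h ζ + volterra K σ h ζ = f ζ := by
  obtain ⟨B, hB⟩ := hf.bound
  -- The terms (-V)^n f. In the norm sup |f(ζ)| exp(-Λ|ζ|) the operator V has size at most C/Re σ ≤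
  -- 1/2, whence the geometric bound below.
  let u : ℕ → ℂ → ℂ := fun n => (fun v ζ => -1 * volterra K σ v ζ)^[n] f
  have hu : ∀ n, u (n + 1) = fun ζ => -1 * volterra K σ (u n) ζ := fun n =>
    Function.iterate_succ_apply' _ n f
  have hue : ∀ n, ExpBdd D Λ (u n) := by
    intro n
    induction n with
    | zero => exact hf
    | succ n ih => rw [hu]; exact (volterra_expBdd hD hs hK hσ ih).const_mul (-1)
  have hub : ∀ n, ∀ ζ ∈ D, ‖u n ζ‖ ≤ (1 / 2) ^ n * |B| * Real.exp (Λ * ‖ζ‖) := by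
    intro n
    induction n with
    | zero =>
      intro ζ hζ
      refine (hB ζ hζ).trans ?_
      simpa using mul_le_mul_of_nonneg_right (le_abs_self B) (Real.exp_nonneg _)
    | succ n ih =>
      intro ζ hζ
      simp only [hu, neg_one_mul, norm_neg]
      refine (volterra_bound hs hK hσ ih hζ).trans ?_
      refine mul_le_mul_of_nonneg_right ?_ (Real.exp_nonneg _)
      rw [pow_succ', mul_assoc (1 / 2 : ℝ)]
      refine mul_le_mul_of_nonneg_right ?_ (by positivity)
      rw [div_le_iff₀ hσ]; linarith
  have hgeo : Summable fun n : ℕ => (1 / 2 : ℝ) ^ n := summable_geometric_two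
  have hsum : ∀ ζ ∈ D, Summable fun n => u n ζ := fun ζ hζ =>
    Summable.of_norm_bounded ((hgeo.mul_right |B|).mul_right _) fun n => hub n ζ hζ
  let h : ℂ → ℂ := fun ζ => ∑' n, u n ζ
  have hhb : ∀ ζ ∈ D, ‖h ζ‖ ≤ 2 * |B| * Real.exp (Λ * ‖ζ‖) := by
    intro ζ hζ
    have := tsum_of_norm_bounded ((hasSum_geometric_two.mul_right |B|).mul_right
      (Real.exp (Λ * ‖ζ‖))) fun n => hub n ζ hζ
    exact this
  have hhd : DifferentiableOn ℂ h D := by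
    intro ζ₀ hζ₀
    -- The weight exp(Λ|ζ|) need not be bounded on D, so uniform convergence is only available on
    -- bounded pieces of D.
    have hd : DifferentiableOn ℂ h (D ∩ ball 0 (‖ζ₀‖ + 1)) := by
      refine Complex.differentiableOn_tsum_of_summable_norm
        (u := fun n => (1 / 2) ^ n * |B| * Real.exp (|Λ| * (‖ζ₀‖ + 1)))
        ((hgeo.mul_right |B|).mul_right _) (fun n => (hue n).holo.mono inter_subset_left)
        (hD.inter isOpen_ball) fun n ζ hζ => (hub n ζ hζ.1).trans ?_
      refine mul_le_mul_of_nonneg_left (Real.exp_le_exp.2 ?_) (by positivity)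
      exact mul_le_mul (le_abs_self Λ) (mem_ball_zero_iff.1 hζ.2).le (norm_nonneg _) (abs_nonneg _)
    refine (hd.differentiableAt ((hD.inter isOpen_ball).mem_nhds ⟨hζ₀, ?_⟩)).differentiableWithinAt
    simp
  refine ⟨h, ⟨hhd, _, hhb⟩, fun ζ hζ => ?_⟩
  have hV : HasSum (fun n => volterra K σ (u n) ζ) (volterra K σ h ζ) := by
    unfold volterra
    refine hasSum_integral_of_dominated_convergence
      (fun n x => x ^ (σ.re - 1) * (C * ((1 / 2) ^ n * |B|) * Real.exp (Λ * ‖ζ‖)))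
      (fun n => volterra_aestronglyMeasurable hs hK (hue n).holo.continuousOn hζ) ?_ ?_ ?_ ?_
    · exact fun n => (ae_restrict_iff' measurableSet_Ioc).2
        (Eventually.of_forall fun x hx => volterra_integrand_bound hs hK (hub n) hζ hx)
    · exact Eventually.of_forall fun x =>
        (((hgeo.mul_right |B|).mul_left C).mul_right _).mul_left _
    · simp_rw [tsum_mul_left]
      exact (integrableOn_rpow_Ioc hσ).mul_const _
    · refine (ae_restrict_iff' measurableSet_Ioc).2 (Eventually.of_forall fun x hx => ?_)
      exact ((hsum _ (hs ζ hζ x (Ioc_subset_Icc_self hx))).hasSum.mul_left _).mul_left _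
  have h1 : h ζ = u 0 ζ + ∑' n, u (n + 1) ζ := (hsum ζ hζ).tsum_eq_zero_add
  have h2 : ∑' n, u (n + 1) ζ = -1 * volterra K σ h ζ := by
    simp_rw [hu]
    exact (hV.mul_left (-1)).tsum_eq
  rw [h1, h2]
  simp [u]

/-- A Volterra equation with a regular singularity at the origin has a solution of exponential
type, normalised to `1` at the origin. -/
theorem exists_regularSingular_solution (hD : IsOpen D) (h0 : (0 : ℂ) ∈ D) (hs : IsStar D)
    (hΛ : 0 ≤ Λ) (hK : IsKernel D Λ C K) {τ : ℂ} (hτ : 0 < τ.re)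
    (hK0 : ∀ x, K 0 x = -τ) {Λ' : ℝ} (hΛ' : Λ < Λ') :
    ∃ g, ExpBdd D Λ' g ∧ g 0 = 1 ∧ ∀ ζ ∈ D, g ζ + volterra K τ g ζ = 0 := by
  have hC : 0 ≤ C := by
    have := hK.bound 0 h0 1 (by simp)
    simpa using (norm_nonneg _).trans this
  have hre : ∀ n : ℕ, 0 < (τ + n).re := fun n => by
    simp only [Complex.add_re, Complex.natCast_re]; positivity
  have hne : ∀ n : ℕ, τ + n ≠ 0 := fun n h => by simpa [h] using hre n
  -- At the origin the kernel is the constant -τ, so only the integral of the weight x^(τ+n-1)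
  -- remains.
  have hV0 : ∀ (n : ℕ) (f : ℂ → ℂ), volterra K (τ + n) f 0 = -τ / (τ + n) * f 0 := by
    intro n f
    have : ∫ x in Ioc (0 : ℝ) 1, (x : ℂ) ^ (τ + n - 1) = 1 / (τ + n) := by
      rw [← intervalIntegral.integral_of_le zero_le_one, integral_cpow]
      · simp [hne n]
      · left
        have := hre n
        simp only [Complex.sub_re, Complex.one_re]
        linarith
    simp only [volterra, hK0, mul_zero]
    rw [integral_mul_const, this]
    ring
  have hK' : IsKernel D Λ' C K := hK.mono_type hC hΛ'.le
  -- Approximate solutions with residual divisible by ζ^(N+1). Multiplication by powers raises the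
  -- type of g once, from Λ to Λ'; the residual factors f arise by division, which keeps the type Λ,
  -- so no loss accumulates in the induction.
  have hstage : ∀ N : ℕ, ∃ g f, ExpBdd D Λ' g ∧ ExpBdd D Λ f ∧ g 0 = 1 ∧
      (∀ ζ ∈ D, g ζ + volterra K τ g ζ = ζ ^ (N + 1) * f ζ) := by
    have hone : ExpBdd D Λ (fun _ : ℂ => (1 : ℂ)) := ExpBdd.const hΛ 1
    have hone' : ExpBdd D Λ' (fun _ : ℂ => (1 : ℂ)) := ExpBdd.const (hΛ.trans hΛ'.le) 1
    have hbr : ∀ n : ℕ, ExpBdd D Λ (fun ζ => 1 + volterra K (τ + n) (fun _ => 1) ζ) :=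
      fun n => hone.add (volterra_expBdd hD hs hK (hre n) hone)
    intro N
    induction N with
    | zero =>
      -- The indicial equation: 1 + V applied to the constant 1 has the value 1 - τ/τ = 0 at the
      -- origin.
      refine ⟨fun _ => 1, _, hone', (hbr 0).exists_eq_mul hD h0 hΛ, rfl, fun ζ hζ => ?_⟩
      have h1 := eq_add_mul_dslope (fun ζ => 1 + volterra K (τ + (0 : ℕ)) (fun _ => 1) ζ) ζ
      have h2 := hV0 0 (fun _ => 1)
      simp only [Nat.cast_zero, add_zero] at h1 h2
      rw [h2, neg_div, div_self (by simpa using hne 0)] at h1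
      simpa using h1
    | succ N ih =>
      obtain ⟨g, f, hg, hf, hg0, hgf⟩ := ih
      let br : ℂ → ℂ := fun ζ => 1 + volterra K (τ + (N + 1 : ℕ)) (fun _ => 1) ζ
      -- The value is n/(τ+n) with n = N + 1 ≥ 1: there is no resonance, so the residual can be
      -- cancelled at the origin by a multiple of ζ^(N+1).
      have hbr0 : br 0 ≠ 0 := by
        have : br 0 = (N + 1 : ℕ) / (τ + (N + 1 : ℕ)) := by
          simp only [br, hV0]
          have := hne (N + 1)
          rw [eq_div_iff this, add_mul, one_mul, mul_one, div_mul_cancel₀ _ this]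
          ring
        rw [this]
        exact div_ne_zero (Nat.cast_ne_zero.2 N.succ_ne_zero) (hne (N + 1))
      let c : ℂ := -f 0 / br 0
      have hf' : ExpBdd D Λ (fun ζ => f ζ + c * br ζ) := hf.add ((hbr (N + 1)).const_mul c)
      have hpow := (hone.pow_mul hΛ' (N + 1)).const_mul c
      refine ⟨fun ζ => g ζ + c * (ζ ^ (N + 1) * 1), _, hg.add hpow,
        hf'.exists_eq_mul hD h0 hΛ, by simp [hg0], fun ζ hζ => ?_⟩
      have h1 := eq_add_mul_dslope (fun ζ => f ζ + c * br ζ) ζ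
      have h2 : f 0 + c * br 0 = 0 := by simp only [c]; field_simp; ring
      simp only [h2, zero_add] at h1
      rw [volterra_add hs hK' hτ hg hpow hζ, volterra_const_mul, volterra_pow_mul,
        pow_succ ζ (N + 1), mul_assoc, ← h1]
      linear_combination hgf ζ hζ
  -- The remaining correction is sought as ζ^(N+1) h; the equation for h has exponent τ + N + 1,
  -- large enough for the Neumann series.
  obtain ⟨N, hN⟩ := exists_nat_ge (2 * C)
  obtain ⟨g, f, hg, hf, hg0, hgf⟩ := hstage N
  have hσ : 2 * C ≤ (τ + (N + 1 : ℕ)).re := by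
    simp only [Complex.add_re, Complex.natCast_re]; push_cast; linarith
  obtain ⟨h, hh, hhf⟩ := exists_add_volterra_eq hD hs hK (hre (N + 1)) hσ hf
  have hp := (hh.pow_mul hΛ' (N + 1)).const_mul (-1)
  refine ⟨fun ζ => g ζ + -1 * (ζ ^ (N + 1) * h ζ), hg.add hp, by simp [hg0], fun ζ hζ => ?_⟩
  rw [volterra_add hs hK' hτ hg hp hζ, volterra_const_mul, volterra_pow_mul]
  linear_combination hgf ζ hζ - ζ ^ (N + 1) * hhf ζ hζ

end Volterra

/-! ### The convolution kernel and the Taylor coefficients of R -/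

/-- The Borel transform of `∑ ρₙ z ^ (-n - 2)`. -/
noncomputable def borelTail (ρ : ℕ → ℂ) (u : ℂ) : ℂ :=
  ∑' n : ℕ, ρ n * (u ^ (n + 1) / ((n + 1).factorial : ℂ))

section BorelTail

variable {ρ : ℕ → ℂ} {C B : ℝ}

/-- Dividing by the factorial turns geometric growth of ratio B into an exponential series. This
makes the Borel transform entire of exponential type B. -/
theorem norm_borelTail_term_le (hB : 0 < B) (hρ : ∀ n, ‖ρ n‖ ≤ C * B ^ n) (n : ℕ) (u : ℂ) :
    ‖ρ n * (u ^ (n + 1) / ((n + 1).factorial : ℂ))‖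
      ≤ C / B * ((B * ‖u‖) ^ (n + 1) / ((n + 1).factorial : ℝ)) := by
  rw [norm_mul, norm_div, norm_pow, Complex.norm_natCast]
  refine (mul_le_mul_of_nonneg_right (hρ n) (by positivity)).trans (le_of_eq ?_)
  rw [mul_pow, pow_succ B]
  field_simp

theorem hasSum_exp_tail (x : ℝ) :
    HasSum (fun n : ℕ => x ^ (n + 1) / ((n + 1).factorial : ℝ)) (Real.exp x - 1) := by
  have := NormedSpace.expSeries_div_hasSum_exp x
  rw [← Real.exp_eq_exp_ℝ] at this
  have h2 := (hasSum_nat_add_iff' 1).2 this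
  simpa using h2

theorem summable_norm_borelTail (hB : 0 < B) (hρ : ∀ n, ‖ρ n‖ ≤ C * B ^ n) (u : ℂ) :
    Summable fun n : ℕ => ‖ρ n * (u ^ (n + 1) / ((n + 1).factorial : ℂ))‖ :=
  Summable.of_nonneg_of_le (fun _ => norm_nonneg _) (fun n => norm_borelTail_term_le hB hρ n u)
    ((hasSum_exp_tail _).summable.mul_left _)

theorem norm_borelTail_le (hB : 0 < B) (hρ : ∀ n, ‖ρ n‖ ≤ C * B ^ n) (u : ℂ) :
    ‖borelTail ρ u‖ ≤ C / B * Real.exp (B * ‖u‖) := by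
  have hC : 0 ≤ C := by simpa using (norm_nonneg _).trans (hρ 0)
  refine (tsum_of_norm_bounded ((hasSum_exp_tail (B * ‖u‖)).mul_left (C / B))
    fun n => norm_borelTail_term_le hB hρ n u).trans ?_
  exact mul_le_mul_of_nonneg_left (by linarith) (by positivity)

theorem differentiable_borelTail (hB : 0 < B) (hρ : ∀ n, ‖ρ n‖ ≤ C * B ^ n) :
    Differentiable ℂ (borelTail ρ) := by
  have hC : 0 ≤ C := by simpa using (norm_nonneg _).trans (hρ 0)
  intro u₀
  have : DifferentiableOn ℂ (borelTail ρ) (ball 0 (‖u₀‖ + 1)) := by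
    refine Complex.differentiableOn_tsum_of_summable_norm
      ((hasSum_exp_tail (B * (‖u₀‖ + 1))).summable.mul_left (C / B)) (fun n => by fun_prop)
      isOpen_ball fun n u hu => (norm_borelTail_term_le hB hρ n u).trans ?_
    have : ‖u‖ ≤ ‖u₀‖ + 1 := (mem_ball_zero_iff.1 hu).le
    gcongr
  exact this.differentiableAt (isOpen_ball.mem_nhds (by simp))

theorem borelTail_zero (ρ : ℕ → ℂ) : borelTail ρ 0 = 0 := by simp [borelTail]

end BorelTail

/-- Cauchy's estimate for the Taylor coefficients of a function holomorphic on a disk. -/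
theorem exists_taylor_bound {R : ℂ → ℂ} {A B : ℝ} (hA : 0 < A) (hAB : A < B)
    (hR : DifferentiableOn ℂ R (ball 0 A⁻¹)) :
    ∃ C, ∀ n, ‖PowerSeries.coeff n (taylorSeries R)‖ ≤ C * B ^ n := by
  have hB : 0 < B := hA.trans hAB
  have hz : ((B⁻¹ : ℝ) : ℂ) ∈ ball (0 : ℂ) A⁻¹ := by
    rw [mem_ball_zero_iff, Complex.norm_real, Real.norm_of_nonneg (by positivity)]
    exact (inv_lt_inv₀ hB hA).2 hAB
  -- The terms of the Taylor series at the point B⁻¹ inside the disk tend to zero, hence are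
  -- bounded; no contour integral is needed.
  have hs := (Complex.hasSum_taylorSeries_on_ball hR hz).summable.tendsto_atTop_zero.norm
  obtain ⟨C, hC⟩ := hs.bddAbove_range
  refine ⟨C, fun n => ?_⟩
  have h1 := hC ⟨n, rfl⟩
  simp only [sub_zero, smul_eq_mul, norm_mul, norm_inv, norm_pow, Complex.norm_real,
    Complex.norm_natCast, Real.norm_of_nonneg hB.le] at h1
  rw [taylorSeries, PowerSeries.coeff_mk, norm_div, Complex.norm_natCast]
  have h2 : ‖iteratedDeriv n R 0‖ / (n.factorial : ℝ)
      = ((n.factorial : ℝ)⁻¹ * (B⁻¹ ^ n * ‖iteratedDeriv n R 0‖)) * B ^ n := by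
    rw [inv_pow]
    field_simp
  rw [h2]
  exact mul_le_mul_of_nonneg_right h1 (by positivity)

/-! ### Geometry of the sector and bounds on the symbol -/

theorem sector_zero_eq (μ δ : ℝ) :
    sector 0 μ δ = Complex.exp '' {w : ℂ | |w.im - μ| < δ} := by
  ext ζ
  constructor
  · rintro ⟨θ, t, hθ, ht, rfl⟩
    refine ⟨Real.log t + θ * Complex.I, by simpa using hθ, ?_⟩
    rw [Complex.exp_add, ← Complex.ofReal_exp, Real.exp_log ht, rayPoint, zero_add]
  · rintro ⟨w, hw, rfl⟩
    refine ⟨w.im, Real.exp w.re, hw, Real.exp_pos _, ?_⟩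
    rw [rayPoint, zero_add, Complex.ofReal_exp, ← Complex.exp_add, Complex.re_add_im]

theorem isOpen_sector_zero (μ δ : ℝ) : IsOpen (sector 0 μ δ) := by
  rw [sector_zero_eq]
  refine Complex.isOpenMap_exp _ ?_
  exact isOpen_lt (by fun_prop) continuous_const

theorem isStar_ball_union_sector {ε μ δ : ℝ} (hε : 0 < ε) :
    IsStar (ball 0 ε ∪ sector 0 μ δ) := by
  rintro ζ hζ x ⟨hx0, hx1⟩
  rcases hζ with hζ | ⟨θ, t, hθ, ht, rfl⟩
  · left
    rw [mem_ball_zero_iff] at hζ ⊢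
    rw [norm_mul, Complex.norm_real, Real.norm_of_nonneg hx0]
    nlinarith [norm_nonneg ζ]
  · rcases hx0.eq_or_lt with rfl | hx
    · left; simpa using hε
    · right
      refine ⟨θ, x * t, hθ, mul_pos hx ht, ?_⟩
      simp [rayPoint, mul_assoc]

theorem sub_notMem_closure_sector {α β : ℂ} {μ δ : ℝ} (h : β ∉ closure (sector α μ δ)) :
    β - α ∉ closure (sector 0 μ δ) := by
  intro hc
  apply h
  have := map_mem_closure (f := fun ζ => α + ζ) (t := sector α μ δ) (by fun_prop) hc ?_
  · simpa using this
  · rintro _ ⟨θ, t, hθ, ht, rfl⟩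
    exact ⟨θ, t, hθ, ht, by simp [rayPoint]⟩

/-- Near γ the distance is bounded below because γ is neither the origin nor in the closure of S;
far away |ζ-γ| is comparable to |ζ|. One factor 1 + |ζ| per root is what lets p dominate a
polynomial of the same degree. -/
theorem exists_lower_bound_sub {S : Set ℂ} {γ : ℂ} (h0 : γ ≠ 0) (hS : γ ∉ closure S) :
    ∃ ε > 0, ∃ c > 0, ∀ ζ ∈ ball 0 ε ∪ S, c * (1 + ‖ζ‖) ≤ ‖ζ - γ‖ := by
  obtain ⟨ρ, hρ, hρS⟩ : ∃ ρ > 0, ∀ ζ ∈ S, ρ ≤ ‖ζ - γ‖ := by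
    obtain ⟨ρ, hρ, h⟩ := Metric.isOpen_iff.1 isClosed_closure.isOpen_compl γ hS
    refine ⟨ρ, hρ, fun ζ hζ => ?_⟩
    by_contra! hlt
    exact h (by rwa [mem_ball, dist_eq_norm]) (subset_closure hζ)
  have hγ : 0 < ‖γ‖ := norm_pos_iff.2 h0
  let m := min ρ (‖γ‖ / 2)
  have hm : 0 < m := lt_min hρ (by positivity)
  have hlow : ∀ ζ ∈ ball 0 (‖γ‖ / 2) ∪ S, m ≤ ‖ζ - γ‖ := by
    rintro ζ (hζ | hζ)
    · refine (min_le_right _ _).trans ?_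
      rw [mem_ball_zero_iff] at hζ
      have := norm_sub_norm_le γ ζ
      rw [norm_sub_rev] at this
      linarith
    · exact (min_le_left _ _).trans (hρS ζ hζ)
  refine ⟨‖γ‖ / 2, by positivity, m / (1 + ‖γ‖ + m), by positivity, fun ζ hζ => ?_⟩
  have h1 := hlow ζ hζ
  have h2 : ‖ζ‖ ≤ ‖ζ - γ‖ + ‖γ‖ := by simpa using norm_add_le (ζ - γ) γ
  rw [div_mul_eq_mul_div, div_le_iff₀ (by positivity)]
  nlinarith [norm_nonneg γ]

theorem exists_lower_bound_prod {S : Set ℂ} (s : Multiset ℂ)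
    (hs : ∀ γ ∈ s, γ ≠ 0 ∧ γ ∉ closure S) :
    ∃ ε > 0, ∃ c > 0, ∀ ζ ∈ ball 0 ε ∪ S,
      c * (1 + ‖ζ‖) ^ s.card ≤ ‖(s.map fun γ => ζ - γ).prod‖ := by
  induction s using Multiset.induction_on with
  | empty => exact ⟨1, one_pos, 1, one_pos, fun ζ _ => by simp⟩
  | cons γ s ih =>
    obtain ⟨ε, hε, c, hc, h⟩ := ih fun γ' h' => hs γ' (Multiset.mem_cons_of_mem h')
    obtain ⟨hγ0, hγS⟩ := hs γ (Multiset.mem_cons_self γ s)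
    obtain ⟨ε', hε', c', hc', h'⟩ := exists_lower_bound_sub hγ0 hγS
    refine ⟨min ε ε', lt_min hε hε', c' * c, mul_pos hc' hc, fun ζ hζ => ?_⟩
    have h1 := h ζ (hζ.imp_left fun hb => ball_subset_ball (min_le_left _ _) hb)
    have h2 := h' ζ (hζ.imp_left fun hb => ball_subset_ball (min_le_right _ _) hb)
    rw [Multiset.map_cons, Multiset.prod_cons, norm_mul, Multiset.card_cons, pow_succ']
    calc c' * c * ((1 + ‖ζ‖) * (1 + ‖ζ‖) ^ s.card)
        = (c' * (1 + ‖ζ‖)) * (c * (1 + ‖ζ‖) ^ s.card) := by ring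
      _ ≤ _ := mul_le_mul h2 h1 (by positivity) (norm_nonneg _)

theorem exists_lower_bound_eval {S : Set ℂ} {p : Polynomial ℂ} (hp : p.Monic) (α : ℂ)
    (hroots : ∀ γ, p.IsRoot (-α - γ) → γ ≠ 0 ∧ γ ∉ closure S) :
    ∃ ε > 0, ∃ c > 0, ∀ ζ ∈ ball 0 ε ∪ S, c * (1 + ‖ζ‖) ^ p.natDegree ≤ ‖p.eval (-α - ζ)‖ := by
  have hsplit : p.Splits := IsAlgClosed.splits p
  obtain ⟨ε, hε, c, hc, h⟩ := exists_lower_bound_prod (S := S) (p.roots.map fun r => -α - r) (by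
    intro γ hγ
    obtain ⟨r, hr, rfl⟩ := Multiset.mem_map.1 hγ
    refine hroots _ ?_
    simpa using Polynomial.isRoot_of_mem_roots hr)
  refine ⟨ε, hε, c, hc, fun ζ hζ => ?_⟩
  have h1 := h ζ hζ
  rw [Multiset.card_map, ← hsplit.natDegree_eq_card_roots, Multiset.map_map] at h1
  refine h1.trans (le_of_eq ?_)
  rw [hsplit.eval_eq_prod_roots_of_monic hp]
  have hn : ∀ t : Multiset ℂ, ‖t.prod‖ = (t.map fun x => ‖x‖).prod := fun t =>
    map_multiset_prod (normHom : ℂ →*₀ ℝ) t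
  rw [hn, hn, Multiset.map_map, Multiset.map_map]
  congr 1
  refine Multiset.map_congr rfl fun r _ => ?_
  simp only [Function.comp_apply]
  rw [← norm_neg]
  congr 1
  ring

theorem exists_upper_bound_eval (q : Polynomial ℂ) (α : ℂ) :
    ∃ C, 0 ≤ C ∧ ∀ ζ : ℂ, ‖q.eval (-α - ζ)‖ ≤ C * (1 + ‖ζ‖) ^ q.natDegree := by
  refine ⟨∑ i ∈ Finset.range (q.natDegree + 1), ‖q.coeff i‖ * (1 + ‖α‖) ^ i, by positivity,
    fun ζ => ?_⟩
  rw [Polynomial.eval_eq_sum_range, Finset.sum_mul]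
  refine norm_sum_le_of_le _ fun i hi => ?_
  rw [norm_mul, norm_pow, mul_assoc]
  refine mul_le_mul_of_nonneg_left ?_ (norm_nonneg _)
  have h1 : ‖-α - ζ‖ ≤ (1 + ‖α‖) * (1 + ‖ζ‖) := by
    have := norm_sub_le (-α) ζ
    rw [norm_neg] at this
    nlinarith [norm_nonneg α, norm_nonneg ζ]
  calc ‖-α - ζ‖ ^ i ≤ ((1 + ‖α‖) * (1 + ‖ζ‖)) ^ i := by gcongr
    _ = (1 + ‖α‖) ^ i * (1 + ‖ζ‖) ^ i := mul_pow _ _ _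
    _ ≤ _ := by
      gcongr
      · linarith [norm_nonneg ζ]
      · exact Nat.lt_succ_iff.1 (Finset.mem_range.1 hi)

/-- The kernel of the Volterra equation that is the Borel transform of the differential equation,
normalised by the symbol `p` of the leading part divided by its zero at the tip. -/
noncomputable def borelKernel (p q : Polynomial ℂ) (ρ : ℕ → ℂ) (α ζ : ℂ) (x : ℝ) : ℂ :=
  (q.eval (-α - x * ζ) + borelTail ρ ((1 - x) * ζ)) / -p.eval (-α - ζ)

/-- The quotient Q(-α-xζ)/p(-α-ζ) is bounded because the degrees agree and p has no zeros nearby.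
The convolution term contributes exp(B|ζ|(1-x)), which is precisely the growth allowed for a kernel.
-/
theorem exists_isKernel_borelKernel {S : Set ℂ} {p q : Polynomial ℂ} (hp : p.Monic) (α : ℂ)
    (hroots : ∀ γ, p.IsRoot (-α - γ) → γ ≠ 0 ∧ γ ∉ closure S)
    (hdeg : q.natDegree = p.natDegree) {ρ : ℕ → ℂ} {C B : ℝ} (hB : 0 < B)
    (hρ : ∀ n, ‖ρ n‖ ≤ C * B ^ n) :
    ∃ ε > 0, (∀ ζ ∈ ball 0 ε ∪ S, p.eval (-α - ζ) ≠ 0) ∧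
      ∃ C', IsKernel (ball 0 ε ∪ S) B C' (borelKernel p q ρ α) := by
  obtain ⟨ε, hε, c, hc, hlow⟩ := exists_lower_bound_eval hp α hroots
  obtain ⟨C₁, hC₁, hup⟩ := exists_upper_bound_eval q α
  have hC : 0 ≤ C := by simpa using (norm_nonneg _).trans (hρ 0)
  have hne : ∀ ζ ∈ ball 0 ε ∪ S, p.eval (-α - ζ) ≠ 0 := fun ζ hζ =>
    norm_pos_iff.1 (lt_of_lt_of_le (by positivity) (hlow ζ hζ))
  have hr := differentiable_borelTail hB hρ
  have hrc := hr.continuous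
  refine ⟨ε, hε, hne, (C₁ + C / B) / c, ?_, ?_, ?_⟩
  · intro x _
    unfold borelKernel
    refine DifferentiableOn.div ?_ ?_ fun ζ hζ => neg_ne_zero.2 (hne ζ hζ)
    · refine Differentiable.differentiableOn ?_
      refine (q.differentiable.comp (by fun_prop)).add (hr.comp (by fun_prop))
    · exact (p.differentiable.comp (by fun_prop)).neg.differentiableOn
  · intro ζ hζ
    unfold borelKernel
    refine Continuous.continuousOn ?_
    refine Continuous.div_const ?_ _
    exact (q.continuous.comp (by fun_prop)).add (hrc.comp (by fun_prop))
  · intro ζ hζ x hx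
    have h1 : ‖q.eval (-α - x * ζ)‖ ≤ C₁ * (1 + ‖ζ‖) ^ p.natDegree := by
      refine (hup _).trans ?_
      rw [hdeg, norm_mul, Complex.norm_real, Real.norm_of_nonneg hx.1]
      have : x * ‖ζ‖ ≤ ‖ζ‖ := mul_le_of_le_one_left (norm_nonneg _) hx.2
      have := mul_nonneg hx.1 (norm_nonneg ζ)
      gcongr
    have h2 := norm_borelTail_le hB hρ ((1 - x) * ζ)
    have h3 : ‖(1 - x : ℂ) * ζ‖ = ‖ζ‖ * (1 - x) := by
      rw [norm_mul, ← Complex.ofReal_one, ← Complex.ofReal_sub, Complex.norm_real,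
        Real.norm_of_nonneg (sub_nonneg.2 hx.2), mul_comm]
    rw [h3] at h2
    set E := Real.exp (B * (‖ζ‖ * (1 - x))) with hE
    have hE1 : 1 ≤ E := Real.one_le_exp (by
      have := sub_nonneg.2 hx.2; positivity)
    have hpow : 1 ≤ (1 + ‖ζ‖) ^ p.natDegree := one_le_pow₀ (by linarith [norm_nonneg ζ])
    have hCB : 0 ≤ C / B := by positivity
    rw [borelKernel, norm_div, norm_neg]
    rw [div_le_iff₀ (norm_pos_iff.2 (hne ζ hζ))]
    have h4 : (C₁ + C / B) / c * E * (c * (1 + ‖ζ‖) ^ p.natDegree)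
        ≤ (C₁ + C / B) / c * E * ‖p.eval (-α - ζ)‖ :=
      mul_le_mul_of_nonneg_left (hlow ζ hζ) (by positivity)
    refine le_trans ?_ h4
    have h5 : (C₁ + C / B) / c * E * (c * (1 + ‖ζ‖) ^ p.natDegree)
        = C₁ * (1 + ‖ζ‖) ^ p.natDegree * E + C / B * E * (1 + ‖ζ‖) ^ p.natDegree := by
      field_simp
    rw [h5]
    refine (norm_add_le _ _).trans (add_le_add ?_ ?_)
    · exact h1.trans (le_mul_of_one_le_right (by positivity) hE1)
    · exact h2.trans (le_mul_of_one_le_right (by positivity) hpow)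

/-! ### Laplace integrals along rays and rotation of the contour -/

theorem integrableOn_rpow_mul_exp_Ioi {s c : ℝ} (hs : 0 < s) (hc : 0 < c) :
    IntegrableOn (fun t : ℝ => t ^ (s - 1) * Real.exp (-(c * t))) (Ioi 0) := by
  have := integrableOn_rpow_mul_exp_neg_mul_rpow (p := 1) (s := s - 1) (by linarith) one_pos hc
  simpa using this

/-- The integrand of the Laplace integral of `ζ ^ (σ - 1) * h ζ` along the ray with direction
`exp w`, where `w` is the logarithm of the direction. -/
noncomputable def rayIntegrand (σ : ℂ) (h : ℂ → ℂ) (z w : ℂ) (t : ℝ) : ℂ :=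
  Complex.exp (-(z * (t * Complex.exp w))) * (t : ℂ) ^ (σ - 1) * Complex.exp (w * σ)
    * h (t * Complex.exp w)

/-- The Laplace integral of `ζ ^ (σ - 1) * h ζ` along the ray with direction `exp w`. -/
noncomputable def rayLaplace (σ : ℂ) (h : ℂ → ℂ) (z w : ℂ) : ℂ :=
  ∫ t in Ioi (0 : ℝ), rayIntegrand σ h z w t

section RayLaplace

variable {D : Set ℂ} {Λ C : ℝ} {σ : ℂ} {h : ℂ → ℂ} {z w : ℂ}

theorem rayIntegrand_aestronglyMeasurable (hh : ContinuousOn h D)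
    (hw : ∀ t : ℝ, 0 < t → t * Complex.exp w ∈ D) :
    AEStronglyMeasurable (rayIntegrand σ h z w) (volume.restrict (Ioi 0)) := by
  refine ContinuousOn.aestronglyMeasurable ?_ measurableSet_Ioi
  unfold rayIntegrand
  refine ContinuousOn.mul (ContinuousOn.mul (ContinuousOn.mul ?_ ?_) ?_) ?_
  · exact Continuous.continuousOn (by fun_prop)
  · exact fun x hx => (Complex.continuousAt_ofReal_cpow_const x (σ - 1)
      (Or.inr (ne_of_gt hx))).continuousWithinAt
  · exact continuousOn_const
  · exact hh.comp (Continuous.continuousOn (by fun_prop)) fun t ht => hw t ht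

theorem norm_rayIntegrand_le (hC : ∀ ζ ∈ D, ‖h ζ‖ ≤ C * Real.exp (Λ * ‖ζ‖))
    (hw : ∀ t : ℝ, 0 < t → t * Complex.exp w ∈ D) {t : ℝ} (ht : 0 < t) :
    ‖rayIntegrand σ h z w t‖ ≤ Real.exp (w * σ).re * C *
      (t ^ (σ.re - 1) *
        Real.exp (-(((z * Complex.exp w).re - Λ * Real.exp w.re) * t))) := by
  have h1 := hC _ (hw t ht)
  have h2 : ‖(t : ℂ) * Complex.exp w‖ = t * Real.exp w.re := by
    rw [norm_mul, Complex.norm_real, Real.norm_of_nonneg ht.le, Complex.norm_exp]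
  have h3 : (-(z * (t * Complex.exp w))).re = -((z * Complex.exp w).re * t) := by
    rw [mul_left_comm, Complex.neg_re, Complex.re_ofReal_mul]; ring
  rw [h2] at h1
  rw [rayIntegrand, norm_mul, norm_mul, norm_mul, Complex.norm_exp, Complex.norm_exp, h3,
    Complex.norm_cpow_eq_rpow_re_of_pos ht, Complex.sub_re, Complex.one_re]
  have h4 : Real.exp (-(((z * Complex.exp w).re - Λ * Real.exp w.re) * t))
      = Real.exp (-((z * Complex.exp w).re * t)) * Real.exp (Λ * (t * Real.exp w.re)) := by
    rw [← Real.exp_add]; congr 1; ring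
  rw [h4]
  have ht' := Real.rpow_nonneg ht.le (σ.re - 1)
  refine (mul_le_mul_of_nonneg_left h1 (by positivity)).trans (le_of_eq ?_)
  ring

theorem rayIntegrand_integrable (hσ : 0 < σ.re) (hh : ExpBdd D Λ h)
    (hw : ∀ t : ℝ, 0 < t → t * Complex.exp w ∈ D)
    (hz : Λ * Real.exp w.re < (z * Complex.exp w).re) :
    IntegrableOn (rayIntegrand σ h z w) (Ioi 0) := by
  obtain ⟨C, hC⟩ := hh.bound
  refine Integrable.mono'
    ((integrableOn_rpow_mul_exp_Ioi hσ (sub_pos.2 hz)).const_mul (Real.exp (w * σ).re * C))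
    (rayIntegrand_aestronglyMeasurable hh.holo.continuousOn hw) ?_
  exact (ae_restrict_iff' measurableSet_Ioi).2
    (Eventually.of_forall fun t ht => norm_rayIntegrand_le hC hw ht)

/-- Watson's estimate. -/
theorem norm_rayLaplace_le (hσ : 0 < σ.re) (hC : ∀ ζ ∈ D, ‖h ζ‖ ≤ C * Real.exp (Λ * ‖ζ‖))
    (hw : ∀ t : ℝ, 0 < t → t * Complex.exp w ∈ D)
    (hz : Λ * Real.exp w.re < (z * Complex.exp w).re) :
    ‖rayLaplace σ h z w‖ ≤ Real.exp (w * σ).re * C * Real.Gamma σ.re *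
      ((z * Complex.exp w).re - Λ * Real.exp w.re) ^ (-σ.re) := by
  have hc := sub_pos.2 hz
  have h1 : ‖rayLaplace σ h z w‖ ≤ _ :=
    norm_integral_le_of_norm_le
      ((integrableOn_rpow_mul_exp_Ioi hσ hc).const_mul (Real.exp (w * σ).re * C))
      ((ae_restrict_iff' measurableSet_Ioi).2
        (Eventually.of_forall fun t ht => norm_rayIntegrand_le hC hw ht))
  rw [integral_const_mul, Real.integral_rpow_mul_exp_neg_mul_Ioi hσ hc, one_div,
    Real.inv_rpow hc.le, ← Real.rpow_neg hc.le] at h1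
  refine h1.trans (le_of_eq ?_)
  ring

/-- With w as a complex logarithm of the direction, rescaling and rotating the ray are the real and
imaginary translations of a single holomorphic variable. This replaces a contour argument with arcs
at infinity. -/
theorem differentiableAt_rayLaplace (hσ : 0 < σ.re) (hh : ExpBdd D Λ h)
    (hw : ∀ᶠ w' in 𝓝 w, ∀ t : ℝ, 0 < t → t * Complex.exp w' ∈ D)
    (hz : Λ * Real.exp w.re < (z * Complex.exp w).re) :
    DifferentiableAt ℂ (rayLaplace σ h z) w := by
  obtain ⟨C, hC⟩ := hh.bound
  set c := ((z * Complex.exp w).re - Λ * Real.exp w.re) / 2 with hc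
  have hc0 : 0 < c := half_pos (sub_pos.2 hz)
  have hcont : Continuous fun w' : ℂ => (z * Complex.exp w').re - Λ * Real.exp w'.re := by fun_prop
  have hcont2 : Continuous fun w' : ℂ => Real.exp (w' * σ).re := by fun_prop
  have e1 : ∀ᶠ w' in 𝓝 w, c < (z * Complex.exp w').re - Λ * Real.exp w'.re :=
    hcont.continuousAt.eventually_const_lt (by linarith)
  have e2 : ∀ᶠ w' in 𝓝 w, Real.exp (w' * σ).re < Real.exp (w * σ).re + 1 :=
    hcont2.continuousAt.eventually_lt_const (by linarith)
  obtain ⟨ρ, hρ, hρ'⟩ := Metric.eventually_nhds_iff_ball.1 (hw.and (e1.and e2))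
  refine (hasDerivAt_integral_of_dominated_holomorphic
    (m := volume.restrict (Ioi (0 : ℝ))) (F := rayIntegrand σ h z)
    (bound := fun t => (Real.exp (w * σ).re + 1) * |C| *
      (t ^ (σ.re - 1) * Real.exp (-(c * t)))) hρ
    (fun w' hw' => rayIntegrand_aestronglyMeasurable hh.holo.continuousOn (hρ' w' hw').1)
    ?_ ?_ ((integrableOn_rpow_mul_exp_Ioi hσ hc0).const_mul _)).2.differentiableAt
  · refine (ae_restrict_iff' measurableSet_Ioi).2 (Eventually.of_forall fun t ht => ?_)
    unfold rayIntegrand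
    refine DifferentiableOn.mul (Differentiable.differentiableOn (by fun_prop)) ?_
    exact hh.holo.comp (Differentiable.differentiableOn (by fun_prop))
      fun w' hw' => (hρ' w' hw').1 t ht
  · refine (ae_restrict_iff' measurableSet_Ioi).2 (Eventually.of_forall fun t ht w' hw' => ?_)
    obtain ⟨h1, h2, h3⟩ := hρ' w' hw'
    refine (norm_rayIntegrand_le hC h1 ht).trans ?_
    have ht0 : 0 < t := ht
    refine mul_le_mul (mul_le_mul h3.le (le_abs_self C) ?_ (by positivity)) ?_ (by positivity)
      (by positivity)
    · have := (norm_nonneg _).trans (hC _ (h1 1 one_pos))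
      exact nonneg_of_mul_nonneg_left this (Real.exp_pos _)
    · gcongr

/-- The Laplace integral depends only on the direction of the ray. -/
theorem rayLaplace_add_ofReal (s : ℝ) : rayLaplace σ h z (w + s) = rayLaplace σ h z w := by
  unfold rayLaplace
  have h1 : ∀ t ∈ Ioi (0 : ℝ), rayIntegrand σ h z (w + s) t
      = Real.exp s • rayIntegrand σ h z w (Real.exp s * t) := by
    intro t ht
    have hs : ((Real.exp s : ℝ) : ℂ) ≠ 0 := Complex.ofReal_ne_zero.2 (Real.exp_ne_zero s)
    have e1 : (((Real.exp s * t : ℝ) : ℂ)) ^ (σ - 1)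
        = Complex.exp (s * (σ - 1)) * (t : ℂ) ^ (σ - 1) := by
      rw [Complex.ofReal_mul, Complex.mul_cpow_ofReal_nonneg (Real.exp_nonneg s) (le_of_lt ht),
        Complex.cpow_def_of_ne_zero hs, ← Complex.ofReal_log (Real.exp_nonneg s), Real.log_exp]
    have e2 : (t : ℂ) * Complex.exp (w + s) = ((Real.exp s * t : ℝ) : ℂ) * Complex.exp w := by
      rw [Complex.exp_add]; push_cast; ring
    have e3 : Complex.exp ((w + s) * σ)
        = Complex.exp s * Complex.exp (s * (σ - 1)) * Complex.exp (w * σ) := by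
      rw [← Complex.exp_add, ← Complex.exp_add]; congr 1; ring
    rw [rayIntegrand, rayIntegrand, e1, e2, e3, Complex.real_smul, Complex.ofReal_exp]
    ring
  rw [setIntegral_congr_fun measurableSet_Ioi h1, integral_smul,
    integral_comp_mul_left_Ioi _ _ (Real.exp_pos s), mul_zero, smul_smul,
    mul_inv_cancel₀ (Real.exp_ne_zero s), one_smul]

/-- Rotation of the contour. -/
theorem rayLaplace_eq_of_le (hσ : 0 < σ.re) (hh : ExpBdd D Λ h) {θ₁ θ₂ : ℝ} (hle : θ₁ ≤ θ₂)
    (hw : ∀ θ ∈ Icc θ₁ θ₂, ∀ᶠ w' in 𝓝 (θ * Complex.I),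
      ∀ t : ℝ, 0 < t → t * Complex.exp w' ∈ D)
    (hz : ∀ θ ∈ Icc θ₁ θ₂, Λ < (z * Complex.exp (θ * Complex.I)).re) :
    rayLaplace σ h z (θ₁ * Complex.I) = rayLaplace σ h z (θ₂ * Complex.I) := by
  have hder : ∀ θ ∈ Icc θ₁ θ₂, HasDerivAt (fun θ : ℝ => rayLaplace σ h z (θ * Complex.I)) 0 θ := by
    intro θ hθ
    have hd := differentiableAt_rayLaplace hσ hh (hw θ hθ) (by simpa using hz θ hθ)
    -- A complex derivative can be computed along the real direction, where the function is constant
    -- by rescaling. Its vanishing then gives constancy under rotation.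
    have hzero : deriv (rayLaplace σ h z) (θ * Complex.I) = 0 := by
      have h1 : HasDerivAt (fun s : ℝ => θ * Complex.I + (s : ℂ)) 1 0 := by
        simpa using (Complex.ofRealCLM.hasDerivAt (x := (0 : ℝ))).const_add (θ * Complex.I)
      have h2 := HasDerivAt.scomp (𝕜 := ℝ) (g₁ := rayLaplace σ h z) (0 : ℝ)
        (g₁' := deriv (rayLaplace σ h z) (θ * Complex.I)) (by simpa using hd.hasDerivAt) h1
      have h3 : (rayLaplace σ h z ∘ fun s : ℝ => θ * Complex.I + (s : ℂ))
          = fun _ => rayLaplace σ h z (θ * Complex.I) := by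
        ext s; exact rayLaplace_add_ofReal s
      rw [h3] at h2
      simpa using h2.unique (hasDerivAt_const _ _)
    have h1 : HasDerivAt (fun s : ℝ => (s : ℂ) * Complex.I) Complex.I θ := by
      simpa using (Complex.ofRealCLM.hasDerivAt (x := θ)).mul_const Complex.I
    have h2 := HasDerivAt.scomp (𝕜 := ℝ) (g₁ := rayLaplace σ h z) θ hd.hasDerivAt h1
    rw [hzero, smul_zero] at h2
    exact h2
  exact (constant_of_has_deriv_right_zero
    (fun θ hθ => (hder θ hθ).continuousAt.continuousWithinAt)
    (fun θ hθ => (hder θ (Ico_subset_Icc_self hθ)).hasDerivWithinAt) θ₂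
    (right_mem_Icc.2 hle)).symm

end RayLaplace

theorem re_mul_exp_mul_I (z : ℂ) (θ : ℝ) :
    (z * Complex.exp (θ * Complex.I)).re = z.re * Real.cos θ - z.im * Real.sin θ := by
  rw [Complex.mul_re, Complex.exp_ofReal_mul_I_re, Complex.exp_ofReal_mul_I_im]

/-- If two directions less than a half-turn apart lie in the half-plane dual to `z`, so do all
directions between them. -/
theorem lt_re_mul_exp_of_mem_Icc {z : ℂ} {Λ θ₁ θ₂ θ : ℝ} (hΛ : 0 ≤ Λ) (hθ : θ ∈ Icc θ₁ θ₂)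
    (hπ : θ₂ - θ₁ < Real.pi) (h₁ : Λ < (z * Complex.exp (θ₁ * Complex.I)).re)
    (h₂ : Λ < (z * Complex.exp (θ₂ * Complex.I)).re) :
    Λ < (z * Complex.exp (θ * Complex.I)).re := by
  obtain ⟨ha, hb⟩ := hθ
  rcases ha.eq_or_lt with rfl | ha
  · exact h₁
  rcases hb.eq_or_lt with rfl | hb
  · exact h₂
  rw [re_mul_exp_mul_I] at *
  have hS : 0 < Real.sin (θ₂ - θ₁) := Real.sin_pos_of_pos_of_lt_pi (by linarith) hπ
  have hS1 : 0 < Real.sin (θ₂ - θ) := Real.sin_pos_of_pos_of_lt_pi (by linarith) (by linarith)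
  have hS2 : 0 < Real.sin (θ - θ₁) := Real.sin_pos_of_pos_of_lt_pi (by linarith) (by linarith)
  have hsub : Real.sin (θ₂ - θ₁) ≤ Real.sin (θ₂ - θ) + Real.sin (θ - θ₁) := by
    have : Real.sin (θ₂ - θ₁) = Real.sin (θ₂ - θ) * Real.cos (θ - θ₁)
        + Real.cos (θ₂ - θ) * Real.sin (θ - θ₁) := by
      rw [← Real.sin_add]; congr 1; ring
    nlinarith [Real.cos_le_one (θ - θ₁), Real.cos_le_one (θ₂ - θ)]
  -- This is sin(θ₂-θ₁) e^(iθ) = sin(θ₂-θ) e^(iθ₁) + sin(θ-θ₁) e^(iθ₂), multiplied by z, in real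
  -- parts. The coefficients on the right are nonnegative and their sum is at least the one on the
  -- left, which suffices since Λ ≥ 0.
  have hid : Real.sin (θ₂ - θ₁) * (z.re * Real.cos θ - z.im * Real.sin θ)
      = Real.sin (θ₂ - θ) * (z.re * Real.cos θ₁ - z.im * Real.sin θ₁)
        + Real.sin (θ - θ₁) * (z.re * Real.cos θ₂ - z.im * Real.sin θ₂) := by
    rw [Real.sin_sub, Real.sin_sub, Real.sin_sub]
    ring
  nlinarith [mul_lt_mul_of_pos_left h₁ hS1, mul_lt_mul_of_pos_left h₂ hS2,
    mul_le_mul_of_nonneg_left hsub hΛ]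

theorem eventually_ray_mem_sector {μ δ θ : ℝ} (hθ : |θ - μ| < δ) :
    ∀ᶠ w' in 𝓝 (θ * Complex.I), ∀ t : ℝ, 0 < t → t * Complex.exp w' ∈ sector 0 μ δ := by
  have : ∀ᶠ w' : ℂ in 𝓝 (θ * Complex.I), |w'.im - μ| < δ := by
    have hc : Continuous fun w' : ℂ => |w'.im - μ| := by fun_prop
    exact hc.continuousAt.eventually_lt_const (by simpa using hθ)
  filter_upwards [this] with w hw t ht
  rw [sector_zero_eq]
  refine ⟨Real.log t + w, by simpa using hw, ?_⟩
  rw [Complex.exp_add, ← Complex.ofReal_exp, Real.exp_log ht]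

/-- The Laplace integrals along all rays of a sector agree where they converge. -/
theorem rayLaplace_eq {D : Set ℂ} {Λ μ δ θ₁ θ₂ : ℝ} {σ z : ℂ} {h : ℂ → ℂ} (hΛ : 0 ≤ Λ)
    (hδ : δ ≤ Real.pi / 2) (hσ : 0 < σ.re) (hD : sector 0 μ δ ⊆ D) (hh : ExpBdd D Λ h)
    (hθ₁ : |θ₁ - μ| < δ) (hθ₂ : |θ₂ - μ| < δ)
    (h₁ : Λ < (z * Complex.exp (θ₁ * Complex.I)).re)
    (h₂ : Λ < (z * Complex.exp (θ₂ * Complex.I)).re) :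
    rayLaplace σ h z (θ₁ * Complex.I) = rayLaplace σ h z (θ₂ * Complex.I) := by
  wlog hle : θ₁ ≤ θ₂ generalizing θ₁ θ₂
  · exact (this hθ₂ hθ₁ h₂ h₁ (le_of_not_ge hle)).symm
  rw [abs_lt] at hθ₁ hθ₂
  refine rayLaplace_eq_of_le hσ hh hle (fun θ hθ => ?_) fun θ hθ =>
    lt_re_mul_exp_of_mem_Icc hΛ hθ (by linarith) h₁ h₂
  refine (eventually_ray_mem_sector (μ := μ) (δ := δ) ?_).mono fun w hw t ht => hD (hw t ht)
  rw [abs_lt]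
  exact ⟨by linarith [hθ.1], by linarith [hθ.2]⟩

/-- The Laplace transform of a power. -/
theorem rayLaplace_one {σ : ℂ} (hσ : 0 < σ.re) {r φ θ : ℝ} (hr : 0 < r)
    (hφ : |φ - θ| < Real.pi / 2) :
    rayLaplace σ (fun _ => 1) (r * Complex.exp (-(φ * Complex.I))) (θ * Complex.I)
      = Complex.Gamma σ * Complex.exp (-σ * (Real.log r - φ * Complex.I)) := by
  have hh : ExpBdd univ 0 (fun _ => (1 : ℂ)) := ExpBdd.const le_rfl 1
  have hre : ∀ θ' : ℝ, |φ - θ'| < Real.pi / 2 →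
      0 < (r * Complex.exp (-(φ * Complex.I)) * Complex.exp (θ' * Complex.I)).re := by
    intro θ' h
    rw [mul_assoc, ← Complex.exp_add]
    have : -(φ * Complex.I) + θ' * Complex.I = ((θ' - φ : ℝ) : ℂ) * Complex.I := by
      push_cast; ring
    rw [this, Complex.re_ofReal_mul, Complex.exp_ofReal_mul_I_re]
    rw [abs_sub_comm, abs_lt] at h
    exact mul_pos hr (Real.cos_pos_of_mem_Ioo h)
  -- Rotate to the direction φ conjugate to the argument of z: there the exponent is -rt, and the
  -- integral is Euler's integral for Γ(σ).
  have h1 : rayLaplace σ (fun _ => 1) (r * Complex.exp (-(φ * Complex.I))) (θ * Complex.I)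
      = rayLaplace σ (fun _ => 1) (r * Complex.exp (-(φ * Complex.I))) (φ * Complex.I) :=
    rayLaplace_eq (D := univ) (Λ := 0) (μ := φ) (δ := Real.pi / 2) le_rfl le_rfl hσ
      (subset_univ _) hh (by rwa [abs_sub_comm]) (by simp [Real.pi_pos]) (hre θ hφ)
      (hre φ (by simp [Real.pi_pos]))
  rw [h1, rayLaplace]
  have h2 : ∀ t : ℝ, rayIntegrand σ (fun _ => 1) (r * Complex.exp (-(φ * Complex.I)))
      (φ * Complex.I) t
      = Complex.exp (φ * Complex.I * σ) * ((t : ℂ) ^ (σ - 1) * Complex.exp (-(r * t))) := by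
    intro t
    have : (r * Complex.exp (-(φ * Complex.I))) * (t * Complex.exp (φ * Complex.I))
        = r * t * (Complex.exp (-(φ * Complex.I)) * Complex.exp (φ * Complex.I)) := by ring
    rw [rayIntegrand, this, ← Complex.exp_add, neg_add_cancel, Complex.exp_zero]
    ring_nf
  simp_rw [h2]
  rw [integral_const_mul, Complex.integral_cpow_mul_exp_neg_mul_Ioi hσ hr]
  have hr0 : (r : ℂ) ≠ 0 := Complex.ofReal_ne_zero.2 hr.ne'
  rw [one_div, Complex.cpow_def_of_ne_zero (inv_ne_zero hr0), ← Complex.ofReal_inv,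
    ← Complex.ofReal_log (inv_pos.2 hr).le, Real.log_inv, ← mul_assoc, ← Complex.exp_add, mul_comm]
  congr 2
  push_cast
  ring

/-! ### Distance to the boundary of the dual domain -/

theorem re_exp_mul_polar (r φ θ : ℝ) :
    (Complex.exp (θ * Complex.I) * (r * Complex.exp (-(φ * Complex.I)))).re
      = r * Real.cos (φ - θ) := by
  have : Complex.exp (θ * Complex.I) * (r * Complex.exp (-(φ * Complex.I)))
      = r * Complex.exp (((θ - φ : ℝ) : ℂ) * Complex.I) := by
    rw [mul_left_comm, ← Complex.exp_add]
    congr 2; push_cast; ring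
  rw [this, Complex.re_ofReal_mul, Complex.exp_ofReal_mul_I_re, ← Real.cos_neg]
  congr 2; ring

/-- The argument of z is recorded as -φ, so that φ is directly comparable with the directions θ of
rays in the position domain: Re(e^(iθ) z) = r cos(φ-θ). -/
theorem exists_polar {z : ℂ} {θ : ℝ} (h : 0 < (Complex.exp (θ * Complex.I) * z).re) :
    ∃ r φ : ℝ, 0 < r ∧ |φ - θ| < Real.pi / 2 ∧ z = r * Complex.exp (-(φ * Complex.I)) := by
  set v := Complex.exp (θ * Complex.I) * z with hv
  have hv0 : v ≠ 0 := fun h0 => by simp [h0] at h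
  refine ⟨‖v‖, θ - v.arg, norm_pos_iff.2 hv0, ?_, ?_⟩
  · rw [show θ - v.arg - θ = -v.arg by ring, abs_neg]
    exact Complex.abs_arg_lt_pi_div_two_iff.2 (Or.inl h)
  · have h1 : -(((θ - v.arg : ℝ) : ℂ) * Complex.I)
        = v.arg * Complex.I + -(θ * Complex.I) := by push_cast; ring
    rw [h1, Complex.exp_add, ← mul_assoc, Complex.norm_mul_exp_arg_mul_I, hv, mul_right_comm,
      ← Complex.exp_add, add_neg_cancel, Complex.exp_zero, one_mul]

theorem isOpen_dualDomain (μ δ Λ : ℝ) : IsOpen (dualDomain μ δ Λ) := by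
  have : dualDomain μ δ Λ = ⋃ θ ∈ {θ : ℝ | |θ - μ| < δ},
      {z : ℂ | Λ < (Complex.exp (θ * Complex.I) * z).re} := by
    ext z; simp [dualDomain]
  rw [this]
  exact isOpen_biUnion fun θ _ => isOpen_lt continuous_const (by fun_prop)

theorem zero_notMem_dualDomain {μ δ Λ : ℝ} (hΛ : 0 ≤ Λ) : (0 : ℂ) ∉ dualDomain μ δ Λ := by
  rintro ⟨θ, _, h⟩
  simp at h
  linarith

theorem exists_mem_frontier_dualDomain {μ δ Λ : ℝ} (hΛ : 0 ≤ Λ) {z : ℂ}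
    (hz : z ∈ dualDomain μ δ Λ) : ∃ y ∈ frontier (dualDomain μ δ Λ),
      infDist z (dualDomain μ δ Λ)ᶜ = dist z y :=
  exists_mem_frontier_infDist_compl_eq_dist hz fun h =>
    zero_notMem_dualDomain (μ := μ) (δ := δ) hΛ (h ▸ mem_univ _)

/-- The distance to the complement is attained at a frontier point, so any point outside the domain
bounds the distance to the frontier. -/
theorem infDist_frontier_le {μ δ Λ : ℝ} (hΛ : 0 ≤ Λ) {z y : ℂ}
    (hz : z ∈ dualDomain μ δ Λ) (hy : y ∉ dualDomain μ δ Λ) :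
    infDist z (frontier (dualDomain μ δ Λ)) ≤ dist z y := by
  obtain ⟨x, hx, h⟩ := exists_mem_frontier_dualDomain hΛ hz
  exact (infDist_le_dist_of_mem hx).trans (h.symm.le.trans (infDist_le_dist_of_mem hy))

/-- The distance to the boundary of the dual domain is bounded below by the distance to the
boundary of each half-plane. -/
theorem le_infDist_frontier {μ δ Λ θ : ℝ} (hΛ : 0 ≤ Λ) (hθ : |θ - μ| < δ) {z : ℂ}
    (hz : Λ < (Complex.exp (θ * Complex.I) * z).re) :
    (Complex.exp (θ * Complex.I) * z).re - Λ ≤ infDist z (frontier (dualDomain μ δ Λ)) := by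
  obtain ⟨x, hx, -⟩ := exists_mem_frontier_dualDomain hΛ (show z ∈ dualDomain μ δ Λ from ⟨θ, hθ, hz⟩)
  refine (le_infDist ⟨x, hx⟩).2 fun y hy => ?_
  rw [(isOpen_dualDomain μ δ Λ).frontier_eq] at hy
  have h1 : (Complex.exp (θ * Complex.I) * y).re ≤ Λ := by
    by_contra! hlt
    exact hy.2 ⟨θ, hθ, hlt⟩
  have h2 : (Complex.exp (θ * Complex.I) * (z - y)).re ≤ ‖z - y‖ := by
    refine (Complex.re_le_norm _).trans ?_
    rw [norm_mul, Complex.norm_exp_ofReal_mul_I, one_mul]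
  rw [mul_sub, Complex.sub_re] at h2
  rw [dist_eq_norm]
  linarith

/-- When φ lies beyond the edge direction μ + sδ, the projection of z to the boundary line of the
edge half-plane already lies outside the domain. The sign s treats both edges at once. -/
theorem infDist_le_of_beyond_edge {μ δ Λ r φ θ s : ℝ} (hs : s = 1 ∨ s = -1) (hΛ : 0 ≤ Λ)
    (hδ : 0 < δ) (hδπ : δ ≤ Real.pi / 2) (hr : 0 < r) (hθ : |θ - μ| < δ)
    (hφ : |φ - θ| < Real.pi / 2)
    (hz : Λ < (Complex.exp (θ * Complex.I) * (r * Complex.exp (-(φ * Complex.I)))).re)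
    (hedge : 0 ≤ s * (φ - (μ + s * δ))) :
    ∃ θ', |θ' - μ| < δ ∧
      Λ < (Complex.exp (θ' * Complex.I) * (r * Complex.exp (-(φ * Complex.I)))).re ∧
      infDist (r * Complex.exp (-(φ * Complex.I))) (frontier (dualDomain μ δ Λ)) ≤
        2 * ((Complex.exp (θ' * Complex.I) * (r * Complex.exp (-(φ * Complex.I)))).re - Λ) := by
  set z : ℂ := r * Complex.exp (-(φ * Complex.I)) with hzdef
  have hzmem : z ∈ dualDomain μ δ Λ := ⟨θ, hθ, hz⟩
  set θ₀ := μ + s * δ with hθ₀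
  set m := (Complex.exp (θ₀ * Complex.I) * z).re - Λ with hm
  have hθ' := abs_lt.1 hθ
  have hφ' := abs_lt.1 hφ
  have habs : |φ - θ₀| ≤ |φ - θ| := by
    rcases hs with rfl | rfl
    · rw [abs_of_nonneg (by linarith), abs_of_nonneg (by linarith)]; linarith
    · rw [abs_of_nonpos (by linarith), abs_of_nonpos (by linarith)]; linarith
  have hm0 : 0 < m := by
    have h1 : Real.cos (φ - θ) ≤ Real.cos (φ - θ₀) := by
      rw [← Real.cos_abs (φ - θ), ← Real.cos_abs (φ - θ₀)]
      exact Real.cos_le_cos_of_nonneg_of_le_pi (abs_nonneg _) (by linarith [Real.pi_pos]) habs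
    rw [hm, hzdef, re_exp_mul_polar]
    rw [hzdef, re_exp_mul_polar] at hz
    nlinarith
  -- For θ' in the sector, φ - θ₀ and θ₀ - θ' have the same sign. Hence the real part at the
  -- projected point is Λ cos(θ₀-θ') minus a nonnegative product of sines, so at most Λ.
  have hy : z - m * Complex.exp (-(θ₀ * Complex.I)) ∉ dualDomain μ δ Λ := by
    rintro ⟨θ', hθ1, hlt⟩
    rw [mul_sub, Complex.sub_re, re_exp_mul_polar, hm, hzdef, re_exp_mul_polar, re_exp_mul_polar]
      at hlt
    have hθ1' := abs_lt.1 hθ1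
    have e1 : Real.cos (φ - θ') = Real.cos (φ - θ₀) * Real.cos (θ₀ - θ')
        - Real.sin (φ - θ₀) * Real.sin (θ₀ - θ') := by
      rw [← Real.cos_add]; congr 1; ring
    rw [e1] at hlt
    have e2 : 0 ≤ Real.sin (φ - θ₀) * Real.sin (θ₀ - θ') := by
      rcases hs with rfl | rfl
      · refine mul_nonneg (Real.sin_nonneg_of_nonneg_of_le_pi ?_ ?_)
          (Real.sin_nonneg_of_nonneg_of_le_pi ?_ ?_) <;> linarith [Real.pi_pos]
      · refine mul_nonneg_of_nonpos_of_nonpos (Real.sin_nonpos_of_nonpos_of_neg_pi_le ?_ ?_)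
          (Real.sin_nonpos_of_nonpos_of_neg_pi_le ?_ ?_) <;> linarith [Real.pi_pos]
    nlinarith [mul_nonneg hr.le e2, Real.cos_le_one (θ₀ - θ')]
  have hle : infDist z (frontier (dualDomain μ δ Λ)) ≤ m := by
    refine (infDist_frontier_le hΛ hzmem hy).trans (le_of_eq ?_)
    rw [dist_eq_norm, sub_sub_cancel, norm_mul, Complex.norm_real, Real.norm_of_nonneg hm0.le,
      ← neg_mul, ← Complex.ofReal_neg, Complex.norm_exp_ofReal_mul_I, mul_one]
  have hcont : Continuous fun u : ℝ =>
      (Complex.exp (((θ₀ - s * u : ℝ) : ℂ) * Complex.I) * z).re - Λ := by fun_prop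
  -- The edge direction is excluded from the open sector. Turning slightly inward keeps more than
  -- half of the depth m; this is the origin of the factor two.
  have hev : ∀ᶠ u in 𝓝[>] (0 : ℝ),
      m / 2 < (Complex.exp (((θ₀ - s * u : ℝ) : ℂ) * Complex.I) * z).re - Λ :=
    (hcont.continuousAt.eventually_const_lt (by simp only [mul_zero, sub_zero]; linarith)).filter_mono
      nhdsWithin_le_nhds
  have hev2 : ∀ᶠ u in 𝓝[>] (0 : ℝ), u ∈ Ioo 0 δ := Ioo_mem_nhdsGT hδ
  obtain ⟨u, hu1, hu2⟩ := (hev.and hev2).exists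
  refine ⟨θ₀ - s * u, ?_, by linarith, by linarith⟩
  rw [hθ₀, abs_lt]
  obtain ⟨h1, h2⟩ := hu2
  rcases hs with rfl | rfl <;> constructor <;> linarith

/-- The distance to the boundary of the dual domain is bounded above, up to a factor of two, by
the distance to the boundary of some half-plane. -/
theorem exists_infDist_frontier_le {μ δ Λ : ℝ} (hΛ : 0 ≤ Λ) (hδ : 0 < δ)
    (hδπ : δ ≤ Real.pi / 2) {z : ℂ} (hz : z ∈ dualDomain μ δ Λ) :
    ∃ θ, |θ - μ| < δ ∧ Λ < (Complex.exp (θ * Complex.I) * z).re ∧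
      infDist z (frontier (dualDomain μ δ Λ)) ≤
        2 * ((Complex.exp (θ * Complex.I) * z).re - Λ) := by
  obtain ⟨θ, hθ, hlt⟩ := id hz
  obtain ⟨r, φ, hr, hφ, rfl⟩ := exists_polar (hΛ.trans_lt hlt)
  by_cases h1 : μ + δ ≤ φ
  · exact infDist_le_of_beyond_edge (Or.inl rfl) hΛ hδ hδπ hr hθ hφ hlt (by linarith)
  by_cases h2 : φ ≤ μ - δ
  · exact infDist_le_of_beyond_edge (Or.inr rfl) hΛ hδ hδπ hr hθ hφ hlt (by linarith)
  push Not at h1 h2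
  have hφμ : |φ - μ| < δ := abs_lt.2 ⟨by linarith, by linarith⟩
  have hre : (Complex.exp (φ * Complex.I) * (r * Complex.exp (-(φ * Complex.I)))).re = r := by
    rw [re_exp_mul_polar]; simp
  have hΛr : Λ < r := by
    rw [re_exp_mul_polar] at hlt
    nlinarith [Real.cos_le_one (φ - θ)]
  refine ⟨φ, hφμ, by rwa [hre], ?_⟩
  rw [hre]
  -- When φ lies in the sector, the point of modulus Λ on the same ray is outside every half-plane,
  -- so the distance is at most r - Λ, the depth of z in the half-plane of direction φ.
  have hy : (Λ : ℂ) * Complex.exp (-(φ * Complex.I)) ∉ dualDomain μ δ Λ := by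
    rintro ⟨θ', -, h⟩
    rw [re_exp_mul_polar] at h
    nlinarith [Real.cos_le_one (φ - θ')]
  refine (infDist_frontier_le hΛ hz hy).trans ?_
  rw [dist_eq_norm, ← sub_mul, norm_mul, ← Complex.ofReal_sub, Complex.norm_real,
    Real.norm_of_nonneg (by linarith), ← neg_mul, ← Complex.ofReal_neg,
    Complex.norm_exp_ofReal_mul_I]
  linarith

theorem infDist_frontier_pos {μ δ Λ : ℝ} (hΛ : 0 ≤ Λ) {z : ℂ} (hz : z ∈ dualDomain μ δ Λ) :
    0 < infDist z (frontier (dualDomain μ δ Λ)) := by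
  obtain ⟨θ, hθ, h⟩ := hz
  exact lt_of_lt_of_le (sub_pos.2 h) (le_infDist_frontier hΛ hθ h)

/-! ### The Laplace transform turns the Volterra equation into the differential equation -/

theorem integrableOn_convolution_Ioi {f g : ℝ → ℂ} (hf : IntegrableOn f (Ioi 0))
    (hg : IntegrableOn g (Ioi 0)) :
    IntegrableOn (fun x => ∫ t in (0 : ℝ)..x, f t * g (x - t)) (Ioi 0) := by
  have := integrable_posConvolution hf hg (ContinuousLinearMap.mul ℝ ℂ)
  rw [posConvolution, integrable_indicator_iff measurableSet_Ioi] at this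
  exact this

theorem integral_convolution_Ioi {f g : ℝ → ℂ} (hf : IntegrableOn f (Ioi 0))
    (hg : IntegrableOn g (Ioi 0)) :
    ∫ x in Ioi (0 : ℝ), ∫ t in (0 : ℝ)..x, f t * g (x - t)
      = (∫ x in Ioi (0 : ℝ), f x) * ∫ x in Ioi (0 : ℝ), g x :=
  integral_posConvolution hf hg (ContinuousLinearMap.mul ℝ ℂ)

/-- Functions on a ray whose Laplace transforms converge absolutely beyond the abscissa `Λ`. -/
structure HasAbscissa (Λ : ℝ) (b : ℝ → ℂ) : Prop where
  meas : AEStronglyMeasurable b (volume.restrict (Ioi 0))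
  integrable : ∀ c, Λ < c → IntegrableOn (fun t => ‖b t‖ * Real.exp (-(c * t))) (Ioi 0)

/-- The Laplace transform along the ray from `α` in direction `l`. -/
noncomputable def expLaplace (α l : ℂ) (b : ℝ → ℂ) (z : ℂ) : ℂ :=
  ∫ t in Ioi (0 : ℝ), Complex.exp (-(z * (α + t * l))) * b t

section

variable {Λ : ℝ} {α l z : ℂ} {b : ℝ → ℂ}

theorem norm_exp_ray (α l z : ℂ) (t : ℝ) :
    ‖Complex.exp (-(z * (α + t * l)))‖
      = Real.exp (-(z * α).re) * Real.exp (-((z * l).re * t)) := by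
  rw [Complex.norm_exp, ← Real.exp_add]
  congr 1
  have : -(z * (α + t * l)) = -(z * α) - t * (z * l) := by ring
  rw [this, Complex.sub_re, Complex.neg_re, Complex.re_ofReal_mul]
  ring

theorem HasAbscissa.aestronglyMeasurable (hb : HasAbscissa Λ b) :
    AEStronglyMeasurable (fun t : ℝ => Complex.exp (-(z * (α + t * l))) * b t)
      (volume.restrict (Ioi 0)) := by
  refine AEStronglyMeasurable.mul (Continuous.aestronglyMeasurable (by fun_prop)) hb.meas

theorem HasAbscissa.integrableOn (hb : HasAbscissa Λ b) (hz : Λ < (z * l).re) :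
    IntegrableOn (fun t : ℝ => Complex.exp (-(z * (α + t * l))) * b t) (Ioi 0) := by
  refine Integrable.mono' ((hb.integrable _ hz).const_mul (Real.exp (-(z * α).re)))
    hb.aestronglyMeasurable (Eventually.of_forall fun t => ?_)
  rw [norm_mul, norm_exp_ray]
  exact le_of_eq (by ring)

/-- A factor t costs an arbitrarily small exponential, which is absorbed because integrability is
required for each c > Λ and not at Λ itself. Polynomial factors therefore leave the abscissa
unchanged. -/
theorem HasAbscissa.ofReal_mul (hb : HasAbscissa Λ b) : HasAbscissa Λ (fun t => t * b t) := by
  refine ⟨AEStronglyMeasurable.mul (Continuous.aestronglyMeasurable (by fun_prop)) hb.meas,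
    fun c hc => ?_⟩
  obtain ⟨d, hd, hdc⟩ := exists_between hc
  refine Integrable.mono' ((hb.integrable d hd).const_mul (c - d)⁻¹) ?_ ?_
  · refine AEStronglyMeasurable.mul (AEStronglyMeasurable.norm ?_)
      (Continuous.aestronglyMeasurable (by fun_prop))
    exact AEStronglyMeasurable.mul (Continuous.aestronglyMeasurable (by fun_prop)) hb.meas
  · refine (ae_restrict_iff' measurableSet_Ioi).2 (Eventually.of_forall fun t ht => ?_)
    have ht0 : 0 < t := ht
    have hcd : 0 < c - d := sub_pos.2 hdc
    rw [norm_mul, norm_norm, Real.norm_of_nonneg (Real.exp_nonneg _), norm_mul, Complex.norm_real,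
      Real.norm_of_nonneg ht0.le]
    have h1 : (c - d) * t ≤ Real.exp ((c - d) * t) := by
      linarith [Real.add_one_le_exp ((c - d) * t)]
    have h2 : Real.exp (-(d * t)) = Real.exp ((c - d) * t) * Real.exp (-(c * t)) := by
      rw [← Real.exp_add]; congr 1; ring
    rw [h2]
    have h3 : t ≤ (c - d)⁻¹ * Real.exp ((c - d) * t) := by
      rw [inv_mul_eq_div, le_div_iff₀ hcd]; linarith
    have h4 := mul_le_mul_of_nonneg_right h3
      (mul_nonneg (norm_nonneg (b t)) (Real.exp_nonneg (-(c * t))))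
    linarith

theorem HasAbscissa.const_mul (a : ℂ) (hb : HasAbscissa Λ b) :
    HasAbscissa Λ (fun t => a * b t) := by
  refine ⟨hb.meas.const_mul a, fun c hc => ?_⟩
  refine ((hb.integrable c hc).const_mul ‖a‖).congr (Eventually.of_forall fun t => ?_)
  simp only [norm_mul]; ring

theorem HasAbscissa.add {b' : ℝ → ℂ} (hb : HasAbscissa Λ b) (hb' : HasAbscissa Λ b') :
    HasAbscissa Λ (fun t => b t + b' t) := by
  refine ⟨hb.meas.add hb'.meas, fun c hc => ?_⟩
  refine Integrable.mono' ((hb.integrable c hc).add (hb'.integrable c hc)) ?_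
    (Eventually.of_forall fun t => ?_)
  · exact AEStronglyMeasurable.mul (hb.meas.add hb'.meas).norm
      (Continuous.aestronglyMeasurable (by fun_prop))
  · rw [norm_mul, norm_norm, Real.norm_of_nonneg (Real.exp_nonneg _), Pi.add_apply, ← add_mul]
    exact mul_le_mul_of_nonneg_right (norm_add_le _ _) (Real.exp_nonneg _)

theorem HasAbscissa.symbol_mul (hb : HasAbscissa Λ b) (α l : ℂ) :
    HasAbscissa Λ (fun t => (-α - t * l) * b t) := by
  have := (hb.const_mul (-α)).add (hb.ofReal_mul.const_mul (-l))
  convert this using 2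
  ring

theorem HasAbscissa.symbol_pow_mul (hb : HasAbscissa Λ b) (α l : ℂ) (k : ℕ) :
    HasAbscissa Λ (fun t => (-α - t * l) ^ k * b t) := by
  induction k with
  | zero => simpa using hb
  | succ k ih =>
    convert ih.symbol_mul α l using 2
    ring

theorem HasAbscissa.eval_mul (hb : HasAbscissa Λ b) (α l : ℂ) (p : Polynomial ℂ) :
    HasAbscissa Λ (fun t => p.eval (-α - t * l) * b t) := by
  induction p using Polynomial.induction_on' with
  | add p q hp hq =>
    convert hp.add hq using 2
    rw [Polynomial.eval_add]; ring
  | monomial n a =>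
    convert (hb.symbol_pow_mul α l n).const_mul a using 2
    rw [Polynomial.eval_monomial]; ring

/-- Differentiating under the integral multiplies the density by -ζ = -α - tl. On a ball whose
radius is half the distance to the abscissa the integrand stays dominated, since |l| = 1 bounds the
change of Re(zl) by the radius. -/
theorem hasDerivAt_expLaplace (hb : HasAbscissa Λ b) (hl : ‖l‖ = 1) (hz : Λ < (z * l).re) :
    HasDerivAt (expLaplace α l b) (expLaplace α l (fun t => (-α - t * l) * b t) z) z := by
  set ρ := ((z * l).re - Λ) / 2 with hρ
  have hρ0 : 0 < ρ := half_pos (sub_pos.2 hz)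
  have hF : ∀ t : ℝ, ∀ z' : ℂ, HasDerivAt
      (fun z' : ℂ => Complex.exp (-(z' * (α + t * l))) * b t)
      (Complex.exp (-(z' * (α + t * l))) * ((-α - t * l) * b t)) z' := by
    intro t z'
    have h1 : HasDerivAt (fun z' : ℂ => -(z' * (α + t * l))) (-(α + t * l)) z' := by
      have := (hasDerivAt_id z').mul_const (-(α + t * l))
      simp only [id_eq, mul_neg, one_mul] at this
      exact this
    refine (h1.cexp.mul_const (b t)).congr_deriv ?_
    ring
  have key := (hasDerivAt_integral_of_dominated_holomorphic
    (m := volume.restrict (Ioi (0 : ℝ)))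
    (F := fun z' t => Complex.exp (-(z' * (α + t * l))) * b t) (z₀ := z)
    (bound := fun t => Real.exp (ρ * ‖α‖ - (z * α).re) *
      (‖b t‖ * Real.exp (-(((z * l).re - ρ) * t)))) hρ0
    (fun z' _ => hb.aestronglyMeasurable) ?_ ?_
    ((hb.integrable _ (by linarith)).const_mul _)).2
  · refine key.congr_deriv ?_
    unfold expLaplace
    congr 1
    ext t
    exact (hF t z).deriv
  · exact Eventually.of_forall fun t z' _ => (hF t z').differentiableAt.differentiableWithinAt
  · refine (ae_restrict_iff' measurableSet_Ioi).2 (Eventually.of_forall fun t ht z' hz' => ?_)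
    have ht0 : 0 < t := ht
    rw [mem_ball, dist_eq_norm] at hz'
    rw [norm_mul, norm_exp_ray]
    have h1 : -(z' * α).re ≤ ρ * ‖α‖ - (z * α).re := by
      have h2 : ((z - z') * α).re ≤ ρ * ‖α‖ := by
        refine (Complex.re_le_norm _).trans ?_
        rw [norm_mul, norm_sub_rev]
        exact mul_le_mul_of_nonneg_right hz'.le (norm_nonneg _)
      rw [sub_mul, Complex.sub_re] at h2
      linarith
    have h3 : (z * l).re - ρ ≤ (z' * l).re := by
      have h2 : ((z - z') * l).re ≤ ρ := by
        refine (Complex.re_le_norm _).trans ?_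
        rw [norm_mul, norm_sub_rev, hl, mul_one]
        exact hz'.le
      rw [sub_mul, Complex.sub_re] at h2
      linarith
    have h4 : Real.exp (-((z' * l).re * t)) ≤ Real.exp (-(((z * l).re - ρ) * t)) := by gcongr
    calc Real.exp (-(z' * α).re) * Real.exp (-((z' * l).re * t)) * ‖b t‖
        ≤ Real.exp (ρ * ‖α‖ - (z * α).re) * Real.exp (-(((z * l).re - ρ) * t)) * ‖b t‖ := by
          gcongr
      _ = _ := by ring

theorem iteratedDeriv_expLaplace (hb : HasAbscissa Λ b) (hl : ‖l‖ = 1) (hz : Λ < (z * l).re)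
    (k : ℕ) :
    iteratedDeriv k (expLaplace α l b) z = expLaplace α l (fun t => (-α - t * l) ^ k * b t) z := by
  induction k generalizing z with
  | zero => simp
  | succ k ih =>
    have hev : iteratedDeriv k (expLaplace α l b) =ᶠ[𝓝 z]
        expLaplace α l (fun t => (-α - t * l) ^ k * b t) := by
      have : Continuous fun z : ℂ => (z * l).re := by fun_prop
      filter_upwards [this.continuousAt.eventually_const_lt hz] with z' hz' using ih hz'
    rw [iteratedDeriv_succ, hev.deriv_eq,
      (hasDerivAt_expLaplace (hb.symbol_pow_mul α l k) hl hz).deriv]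
    congr 1
    ext t
    ring

theorem sum_iteratedDeriv_expLaplace (hb : HasAbscissa Λ b) (hl : ‖l‖ = 1)
    (hz : Λ < (z * l).re) (p : Polynomial ℂ) :
    p.sum (fun k c => c * iteratedDeriv k (expLaplace α l b) z)
      = expLaplace α l (fun t => p.eval (-α - t * l) * b t) z := by
  simp only [iteratedDeriv_expLaplace hb hl hz, Polynomial.sum_def, Polynomial.eval_eq_sum,
    expLaplace]
  simp_rw [← integral_const_mul]
  rw [← integral_finsetSum _ fun k _ =>
    ((hb.symbol_pow_mul α l k).integrableOn hz).const_mul (p.coeff k)]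
  congr 1
  ext t
  rw [Finset.sum_mul, Finset.mul_sum]
  exact Finset.sum_congr rfl fun k _ => by ring

end

/-- The Laplace transform of a monomial. -/
theorem integral_exp_mul_monomial {z : ℂ} {θ : ℝ} (hz : 0 < (z * Complex.exp (θ * Complex.I)).re)
    (n : ℕ) :
    ∫ t in Ioi (0 : ℝ), Complex.exp (-(z * (t * Complex.exp (θ * Complex.I)))) *
        ((t : ℂ) ^ n * Complex.exp (θ * Complex.I) ^ (n + 1))
      = n.factorial * z⁻¹ ^ (n + 1) := by
  rw [mul_comm] at hz
  obtain ⟨r, φ, hr, hφ, rfl⟩ := exists_polar hz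
  have hre : 0 < ((n + 1 : ℕ) : ℂ).re := by rw [Complex.natCast_re]; positivity
  have h1 := rayLaplace_one hre hr hφ
  have h2 : ∀ z : ℂ, ∀ t : ℝ, rayIntegrand ((n + 1 : ℕ) : ℂ) (fun _ => 1) z (θ * Complex.I) t
      = Complex.exp (-(z * (t * Complex.exp (θ * Complex.I)))) *
        ((t : ℂ) ^ n * Complex.exp (θ * Complex.I) ^ (n + 1)) := by
    intro z t
    have : (((n + 1 : ℕ) : ℂ)) - 1 = (n : ℕ) := by push_cast; ring
    rw [rayIntegrand, this, Complex.cpow_natCast, mul_one, ← Complex.exp_nat_mul, mul_assoc,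
      mul_comm (θ * Complex.I)]
  simp only [rayLaplace, h2] at h1
  rw [h1]
  have h3 : ((n + 1 : ℕ) : ℂ) = (n : ℂ) + 1 := by push_cast; ring
  rw [h3, Complex.Gamma_nat_eq_factorial, mul_inv, ← Complex.exp_neg, neg_neg,
    ← Complex.ofReal_inv, ← Real.exp_log (inv_pos.2 hr), Real.log_inv, Complex.ofReal_exp,
    ← Complex.exp_add, ← Complex.exp_nat_mul]
  congr 2
  push_cast
  ring

theorem HasAbscissa.mono {Λ Λ' : ℝ} {b : ℝ → ℂ} (h : Λ ≤ Λ') (hb : HasAbscissa Λ b) :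
    HasAbscissa Λ' b :=
  ⟨hb.meas, fun c hc => hb.integrable c (h.trans_lt hc)⟩

theorem HasAbscissa.integrableOn_Ioc {Λ : ℝ} {b : ℝ → ℂ} (hb : HasAbscissa Λ b) (T : ℝ) :
    IntegrableOn b (Ioc 0 T) := by
  set c := max Λ 0 + 1 with hc
  have h1 : Λ < c := by linarith [le_max_left Λ 0]
  have hc0 : 0 ≤ c := by linarith [le_max_right Λ 0]
  refine Integrable.mono' (((hb.integrable c h1).mono_set Ioc_subset_Ioi_self).const_mul
    (Real.exp (c * T))) (hb.meas.mono_measure (Measure.restrict_mono Ioc_subset_Ioi_self le_rfl)) ?_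
  refine (ae_restrict_iff' measurableSet_Ioc).2 (Eventually.of_forall fun t ht => ?_)
  have : 1 ≤ Real.exp (c * T) * Real.exp (-(c * t)) := by
    rw [← Real.exp_add]
    exact Real.one_le_exp (by nlinarith [ht.2])
  nlinarith [norm_nonneg (b t)]

theorem HasAbscissa.intervalIntegrable {Λ : ℝ} {b : ℝ → ℂ} (hb : HasAbscissa Λ b) {T : ℝ}
    (hT : 0 ≤ T) : IntervalIntegrable b volume 0 T :=
  (intervalIntegrable_iff_integrableOn_Ioc_of_le hT).2 (hb.integrableOn_Ioc T)

theorem hasAbscissa_of_bound {Λ C s : ℝ} {b : ℝ → ℂ} (hs : 0 < s)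
    (hm : AEStronglyMeasurable b (volume.restrict (Ioi 0)))
    (hb : ∀ t, 0 < t → ‖b t‖ ≤ C * (t ^ (s - 1) * Real.exp (Λ * t))) : HasAbscissa Λ b := by
  refine ⟨hm, fun c hc => ?_⟩
  refine Integrable.mono' ((integrableOn_rpow_mul_exp_Ioi hs (sub_pos.2 hc)).const_mul C)
    (hm.norm.mul (Continuous.aestronglyMeasurable (by fun_prop))) ?_
  refine (ae_restrict_iff' measurableSet_Ioi).2 (Eventually.of_forall fun t ht => ?_)
  rw [norm_mul, norm_norm, Real.norm_of_nonneg (Real.exp_nonneg _)]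
  refine (mul_le_mul_of_nonneg_right (hb t ht) (Real.exp_nonneg _)).trans (le_of_eq ?_)
  have : Real.exp (-((c - Λ) * t)) = Real.exp (Λ * t) * Real.exp (-(c * t)) := by
    rw [← Real.exp_add]; congr 1; ring
  rw [this]; ring

section Tail

variable {ρ : ℕ → ℂ} {C B θ : ℝ} {z : ℂ}

theorem hasAbscissa_borelTail (hB : 0 < B) (hρ : ∀ n, ‖ρ n‖ ≤ C * B ^ n) (θ : ℝ) :
    HasAbscissa B (fun t : ℝ => Complex.exp (θ * Complex.I) *
      borelTail ρ (t * Complex.exp (θ * Complex.I))) := by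
  refine hasAbscissa_of_bound (C := C / B) one_pos ?_ fun t ht => ?_
  · exact (continuous_const.mul ((differentiable_borelTail hB hρ).continuous.comp
      (by fun_prop))).aestronglyMeasurable
  · have := norm_borelTail_le hB hρ (t * Complex.exp (θ * Complex.I))
    rw [norm_mul _ (Complex.exp _), Complex.norm_exp_ofReal_mul_I, mul_one, Complex.norm_real,
      Real.norm_of_nonneg ht.le] at this
    simpa [Complex.norm_exp_ofReal_mul_I] using this

/-- The Laplace transform inverts the Borel transform of a convergent series. -/
theorem hasSum_laplace_borelTail (hB : 0 < B) (hρ : ∀ n, ‖ρ n‖ ≤ C * B ^ n)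
    (hz : B < (z * Complex.exp (θ * Complex.I)).re) :
    HasSum (fun n : ℕ => ρ n * z⁻¹ ^ (n + 2))
      (∫ t in Ioi (0 : ℝ), Complex.exp (-(z * (t * Complex.exp (θ * Complex.I)))) *
        (Complex.exp (θ * Complex.I) * borelTail ρ (t * Complex.exp (θ * Complex.I)))) := by
  set l := Complex.exp (θ * Complex.I) with hl
  set c := (z * l).re with hc
  have hl1 : ‖l‖ = 1 := Complex.norm_exp_ofReal_mul_I θ
  have hterm : ∀ n : ℕ, ∫ t in Ioi (0 : ℝ), Complex.exp (-(z * (t * l))) *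
      (l * (ρ n * ((t * l) ^ (n + 1) / ((n + 1).factorial : ℂ)))) = ρ n * z⁻¹ ^ (n + 2) := by
    intro n
    have h1 := integral_exp_mul_monomial (hB.trans hz) (n + 1)
    have h2 : ((n + 1).factorial : ℂ) ≠ 0 := Nat.cast_ne_zero.2 (Nat.factorial_ne_zero _)
    calc _ = ∫ t in Ioi (0 : ℝ), ρ n / ((n + 1).factorial : ℂ) *
          (Complex.exp (-(z * (t * l))) * ((t : ℂ) ^ (n + 1) * l ^ (n + 1 + 1))) := by
          congr 1; ext t; rw [mul_pow]; field_simp; ring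
      _ = _ := by
          rw [integral_const_mul, h1, ← mul_assoc, div_mul_cancel₀ _ h2]
  simp_rw [← hterm]
  have hexp : ∀ t : ℝ, ‖Complex.exp (-(z * (t * l)))‖ = Real.exp (-(c * t)) := by
    intro t
    have := norm_exp_ray 0 l z t
    simp only [zero_add, mul_zero, Complex.zero_re, neg_zero, Real.exp_zero, one_mul] at this
    exact this
  refine hasSum_integral_of_dominated_convergence
    (fun n t => Real.exp (-(c * t)) * (C / B * ((B * t) ^ (n + 1) / ((n + 1).factorial : ℝ))))
    (fun n => Continuous.aestronglyMeasurable (by fun_prop)) (fun n => ?_) ?_ ?_ ?_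
  · refine (ae_restrict_iff' measurableSet_Ioi).2 (Eventually.of_forall fun t ht => ?_)
    have ht0 : 0 < t := ht
    have h1 := norm_borelTail_term_le hB hρ n (t * l)
    rw [norm_mul (t : ℂ), hl1, mul_one, Complex.norm_real, Real.norm_of_nonneg ht0.le] at h1
    rw [norm_mul, hexp, norm_mul l, hl1, one_mul]
    exact mul_le_mul_of_nonneg_left h1 (Real.exp_nonneg _)
  · exact Eventually.of_forall fun t => ((hasSum_exp_tail (B * t)).summable.mul_left _).mul_left _
  · simp_rw [tsum_mul_left, (hasSum_exp_tail _).tsum_eq]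
    have h1 := (exp_neg_integrableOn_Ioi 0 (sub_pos.2 hz)).sub
      (exp_neg_integrableOn_Ioi 0 (hB.trans hz))
    refine (h1.const_mul (C / B)).congr (Eventually.of_forall fun t => ?_)
    simp only [Pi.sub_apply]
    have : Real.exp (-(c - B) * t) = Real.exp (-(c * t)) * Real.exp (B * t) := by
      rw [← Real.exp_add]; congr 1; ring
    rw [this, neg_mul]
    ring
  · refine Eventually.of_forall fun t => ?_
    exact ((summable_norm_borelTail hB hρ _).of_norm.hasSum.mul_left _).mul_left _

end Tail

theorem taylorSeries_hasSum {R : ℂ → ℂ} {r : ℝ} (hR : DifferentiableOn ℂ R (ball 0 r)) {w : ℂ}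
    (hw : w ∈ ball (0 : ℂ) r) :
    HasSum (fun n => PowerSeries.coeff n (taylorSeries R) * w ^ n) (R w) := by
  have := Complex.hasSum_taylorSeries_on_ball hR hw
  have hf : (fun n => PowerSeries.coeff n (taylorSeries R) * w ^ n)
      = fun n => (n.factorial : ℂ)⁻¹ • (w - 0) ^ n • iteratedDeriv n R 0 := by
    ext n
    simp only [taylorSeries, PowerSeries.coeff_mk, sub_zero, smul_eq_mul]
    ring
  rwa [hf]

/-- The Laplace transform of a solution of the Volterra equation solves the differential
equation. -/
theorem levelOneOp_expLaplace {P Q : Polynomial ℂ} {R : ℂ → ℂ} {A B C Λ θ : ℝ} {α z : ℂ}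
    {b : ℝ → ℂ} (hA : 0 < A) (hR : DifferentiableOn ℂ R (ball 0 A⁻¹)) (hAB : A < B)
    (hρ : ∀ n, ‖PowerSeries.coeff n (taylorSeries R)‖ ≤ C * B ^ n) (hBΛ : B ≤ Λ)
    (hb : HasAbscissa Λ b)
    (heq : ∀ t : ℝ, 0 < t → P.eval (-α - t * Complex.exp (θ * Complex.I)) * b t +
      ∫ s in (0 : ℝ)..t, b s * (Complex.exp (θ * Complex.I) *
        (Q.eval (-α - s * Complex.exp (θ * Complex.I)) +
          borelTail (fun n => PowerSeries.coeff n (taylorSeries R))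
            ((t - s) * Complex.exp (θ * Complex.I)))) = 0)
    (hz : Λ < (z * Complex.exp (θ * Complex.I)).re) :
    levelOneOp P Q R (expLaplace α (Complex.exp (θ * Complex.I)) b) z = 0 := by
  set ρ : ℕ → ℂ := fun n => PowerSeries.coeff n (taylorSeries R) with hρdef
  set l := Complex.exp (θ * Complex.I) with hl
  have hl1 : ‖l‖ = 1 := Complex.norm_exp_ofReal_mul_I θ
  have hB : 0 < B := hA.trans hAB
  have hz0 : 0 < (z * l).re := by linarith
  have hzn : A < ‖z‖ := by
    have := (Complex.re_le_norm (z * l))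
    rw [norm_mul, hl1, mul_one] at this
    linarith
  have hzinv : z⁻¹ ∈ ball (0 : ℂ) A⁻¹ := by
    rw [mem_ball_zero_iff, norm_inv]
    exact (inv_lt_inv₀ (hA.trans hzn) hA).2 hzn
  -- Both coefficient functions are written as Laplace transforms, z⁻² R(z⁻¹) of the Borel tail and
  -- z⁻¹ of a constant. Multiplication by them then becomes convolution of densities.
  have hR1 : z⁻¹ ^ 2 * R z⁻¹ =
      ∫ t in Ioi (0 : ℝ), Complex.exp (-(z * (t * l))) * (l * borelTail ρ (t * l)) := by
    refine HasSum.unique ?_ (hasSum_laplace_borelTail hB hρ (hBΛ.trans_lt hz))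
    have hf : (fun n => ρ n * z⁻¹ ^ (n + 2)) = fun n => z⁻¹ ^ 2 * (ρ n * z⁻¹ ^ n) := by
      ext n; ring
    rw [hf]
    exact (taylorSeries_hasSum hR hzinv).mul_left (z⁻¹ ^ 2)
  have hone : z⁻¹ = ∫ t in Ioi (0 : ℝ), Complex.exp (-(z * (t * l))) * l := by
    have := integral_exp_mul_monomial hz0 0
    simpa using this.symm
  have hrc := (differentiable_borelTail hB hρ).continuous
  have hconst : HasAbscissa Λ (fun _ : ℝ => l) := by
    refine hasAbscissa_of_bound (C := 1) one_pos aestronglyMeasurable_const fun t ht => ?_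
    have : 1 ≤ Real.exp (Λ * t) :=
      Real.one_le_exp (mul_nonneg (hB.le.trans hBΛ) ht.le)
    simpa [hl1] using this
  have i0 : IntegrableOn (fun t : ℝ => Complex.exp (-(z * (α + t * l))) *
      (P.eval (-α - t * l) * b t)) (Ioi 0) := (hb.eval_mul α l P).integrableOn hz
  have i1 : IntegrableOn (fun t : ℝ => Complex.exp (-(z * (α + t * l))) *
      (Q.eval (-α - t * l) * b t)) (Ioi 0) := (hb.eval_mul α l Q).integrableOn hz
  have i2 : IntegrableOn (fun t : ℝ => Complex.exp (-(z * (α + t * l))) * b t) (Ioi 0) :=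
    hb.integrableOn hz
  have j1 : IntegrableOn (fun t : ℝ => Complex.exp (-(z * (t * l))) * l) (Ioi 0) := by
    simpa using hconst.integrableOn (α := 0) hz
  have j2 : IntegrableOn (fun t : ℝ => Complex.exp (-(z * (t * l))) *
      (l * borelTail ρ (t * l))) (Ioi 0) := by
    simpa using ((hasAbscissa_borelTail hB hρ θ).mono hBΛ).integrableOn (α := 0) hz
  unfold levelOneOp
  rw [sum_iteratedDeriv_expLaplace hb hl1 hz, sum_iteratedDeriv_expLaplace hb hl1 hz, hR1]
  conv_lhs => enter [1, 2, 1]; rw [hone]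
  unfold expLaplace
  rw [mul_comm (∫ t in Ioi (0 : ℝ), Complex.exp (-(z * (t * l))) * l),
    mul_comm (∫ t in Ioi (0 : ℝ), Complex.exp (-(z * (t * l))) * (l * borelTail ρ (t * l))),
    ← integral_convolution_Ioi i1 j1, ← integral_convolution_Ioi i2 j2,
    ← integral_add i0 (integrableOn_convolution_Ioi i1 j1)]
  have i3 := i0.add (integrableOn_convolution_Ioi i1 j1)
  simp only [Pi.add_def] at i3
  rw [← integral_add i3 (integrableOn_convolution_Ioi i2 j2)]
  rw [← integral_zero (α := ℝ) (G := ℂ) (μ := volume.restrict (Ioi 0))]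
  refine setIntegral_congr_fun measurableSet_Ioi fun t ht => ?_
  have ht0 : 0 < t := ht
  have hbt := hb.intervalIntegrable ht0.le
  have k1 : IntervalIntegrable (fun s : ℝ => b s * (l * Q.eval (-α - s * l))) volume 0 t :=
    hbt.mul_continuousOn (continuous_const.mul
      (Q.continuous.comp (by fun_prop))).continuousOn
  have k2 : IntervalIntegrable (fun s : ℝ => b s * (l * borelTail ρ ((t - s) * l))) volume 0 t :=
    hbt.mul_continuousOn (continuous_const.mul (hrc.comp (by fun_prop))).continuousOn
  -- The exponentials of the two convolution factors multiply to one independent of s. The full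
  -- integrand at t is thus this exponential times the Volterra equation at t, which vanishes.
  have he : ∀ s : ℝ, Complex.exp (-(z * (α + s * l))) * Complex.exp (-(z * ((t - s : ℝ) * l)))
      = Complex.exp (-(z * (α + t * l))) := by
    intro s
    rw [← Complex.exp_add]; congr 1; push_cast; ring
  have e1 : ∫ s in (0 : ℝ)..t, Complex.exp (-(z * (α + s * l))) * (Q.eval (-α - s * l) * b s) *
      (Complex.exp (-(z * ((t - s : ℝ) * l))) * l) = Complex.exp (-(z * (α + t * l))) *
        ∫ s in (0 : ℝ)..t, b s * (l * Q.eval (-α - s * l)) := by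
    rw [← intervalIntegral.integral_const_mul]
    congr 1; ext s
    rw [← he s]; ring
  have e2 : ∫ s in (0 : ℝ)..t, Complex.exp (-(z * (α + s * l))) * b s *
      (Complex.exp (-(z * ((t - s : ℝ) * l))) * (l * borelTail ρ ((t - s : ℝ) * l)))
        = Complex.exp (-(z * (α + t * l))) *
        ∫ s in (0 : ℝ)..t, b s * (l * borelTail ρ ((t - s) * l)) := by
    rw [← intervalIntegral.integral_const_mul]
    congr 1; ext s
    rw [← he s]; push_cast; ring
  have h3 := heq t ht0
  simp only [mul_add] at h3
  rw [intervalIntegral.integral_add k1 k2] at h3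
  rw [e1, e2]
  linear_combination Complex.exp (-(z * (α + t * l))) * h3

/-- A solution of the normalised Volterra equation solves the Volterra equation along each ray. -/
theorem ray_equation {P p Q : Polynomial ℂ} {ρ : ℕ → ℂ} {α τ : ℂ} {g : ℂ → ℂ} {θ t : ℝ}
    (hP : P = (Polynomial.X + Polynomial.C α) * p) (ht : 0 < t)
    (hp : p.eval (-α - t * Complex.exp (θ * Complex.I)) ≠ 0)
    (hg : g (t * Complex.exp (θ * Complex.I)) +
      volterra (borelKernel p Q ρ α) τ g (t * Complex.exp (θ * Complex.I)) = 0) :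
    P.eval (-α - t * Complex.exp (θ * Complex.I)) *
        (Complex.exp (θ * Complex.I * τ) * (t : ℂ) ^ (τ - 1) *
          g (t * Complex.exp (θ * Complex.I))) +
      ∫ s in (0 : ℝ)..t, Complex.exp (θ * Complex.I * τ) * (s : ℂ) ^ (τ - 1) *
        g (s * Complex.exp (θ * Complex.I)) * (Complex.exp (θ * Complex.I) *
        (Q.eval (-α - s * Complex.exp (θ * Complex.I)) +
          borelTail ρ ((t - s) * Complex.exp (θ * Complex.I)))) = 0 := by
  set l := Complex.exp (θ * Complex.I) with hl
  set E := Complex.exp (θ * Complex.I * τ) with hE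
  set I := ∫ s in (0 : ℝ)..t, E * (s : ℂ) ^ (τ - 1) * g (s * l) * (l *
        (Q.eval (-α - s * l) + borelTail ρ ((t - s) * l))) with hI
  -- The substitution s = tx passes between the integral along the ray and the scale-invariant form
  -- over [0, 1].
  have hsub : (∫ x in (0 : ℝ)..1, E * ((t * x : ℝ) : ℂ) ^ (τ - 1) * g ((t * x : ℝ) * l) * (l *
        (Q.eval (-α - (t * x : ℝ) * l) + borelTail ρ ((t - (t * x : ℝ)) * l)))) = (t : ℂ)⁻¹ * I := by
    have := intervalIntegral.integral_comp_mul_left (a := 0) (b := 1)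
      (fun s : ℝ => E * (s : ℂ) ^ (τ - 1) * g (s * l) * (l *
        (Q.eval (-α - s * l) + borelTail ρ ((t - s) * l)))) ht.ne'
    rw [mul_zero, mul_one] at this
    rw [this, hI, Complex.real_smul, Complex.ofReal_inv]
  have hV : volterra (borelKernel p Q ρ α) τ g (t * l) =
      (E * (t : ℂ) ^ (τ - 1) * (l * -p.eval (-α - t * l)))⁻¹ * ((t : ℂ)⁻¹ * I) := by
    rw [← hsub, intervalIntegral.integral_of_le zero_le_one, volterra, ← integral_const_mul]
    refine setIntegral_congr_fun measurableSet_Ioc fun x hx => ?_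
    have ht1 : (t : ℂ) ^ (τ - 1) ≠ 0 := by
      rw [Complex.cpow_def_of_ne_zero (Complex.ofReal_ne_zero.2 ht.ne')]
      exact Complex.exp_ne_zero _
    have hl0 : l ≠ 0 := Complex.exp_ne_zero _
    have hE0 : E ≠ 0 := Complex.exp_ne_zero _
    have e1 : ((t * x : ℝ) : ℂ) ^ (τ - 1) = (t : ℂ) ^ (τ - 1) * (x : ℂ) ^ (τ - 1) := by
      rw [Complex.ofReal_mul, Complex.mul_cpow_ofReal_nonneg ht.le hx.1.le]
    have e2 : (x : ℂ) * (t * l) = ((t * x : ℝ) : ℂ) * l := by push_cast; ring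
    have e3 : (1 - (x : ℂ)) * (t * l) = (t - ((t * x : ℝ) : ℂ)) * l := by push_cast; ring
    simp only [borelKernel, e1, e2, e3]
    field_simp
  have ht0 : (t : ℂ) ≠ 0 := Complex.ofReal_ne_zero.2 ht.ne'
  have ht1 : (t : ℂ) ^ (τ - 1) ≠ 0 := by
    rw [Complex.cpow_def_of_ne_zero ht0]
    exact Complex.exp_ne_zero _
  have hl0 : l ≠ 0 := Complex.exp_ne_zero _
  have hE0 : E ≠ 0 := Complex.exp_ne_zero _
  rw [hV] at hg
  have hPe : P.eval (-α - t * l) = -(t * l) * p.eval (-α - t * l) := by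
    rw [hP, Polynomial.eval_mul, Polynomial.eval_add, Polynomial.eval_X, Polynomial.eval_C]
    ring
  have hI' : I = E * (t : ℂ) ^ (τ - 1) * (l * p.eval (-α - t * l)) * t * g (t * l) := by
    have h1 := eq_neg_of_add_eq_zero_left hg
    rw [h1]
    have hp' := hp
    generalize Polynomial.eval (-α - t * l) p = pe at hp' ⊢
    field_simp
  rw [hPe, hI']
  ring

/-! ### Power series expansions and the formal solution -/

/-- The power series `G` converges absolutely to `f` on the disk of radius `ε` around `0`. -/
def HasExpansion (ε : ℝ) (f : ℂ → ℂ) (G : PowerSeries ℂ) : Prop :=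
  ∀ ζ : ℂ, ‖ζ‖ < ε → Summable (fun n => ‖PowerSeries.coeff n G * ζ ^ n‖) ∧
    HasSum (fun n => PowerSeries.coeff n G * ζ ^ n) (f ζ)

namespace HasExpansion

variable {ε : ℝ} {f g : ℂ → ℂ} {F G : PowerSeries ℂ}

theorem add (hf : HasExpansion ε f F) (hg : HasExpansion ε g G) :
    HasExpansion ε (fun ζ => f ζ + g ζ) (F + G) := by
  intro ζ hζ
  obtain ⟨s1, h1⟩ := hf ζ hζ
  obtain ⟨s2, h2⟩ := hg ζ hζ
  simp only [map_add, add_mul]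
  exact ⟨Summable.of_nonneg_of_le (fun _ => norm_nonneg _) (fun _ => norm_add_le _ _)
    (s1.add s2), h1.add h2⟩

theorem mul (hf : HasExpansion ε f F) (hg : HasExpansion ε g G) :
    HasExpansion ε (fun ζ => f ζ * g ζ) (F * G) := by
  intro ζ hζ
  obtain ⟨s1, h1⟩ := hf ζ hζ
  obtain ⟨s2, h2⟩ := hg ζ hζ
  have e : ∀ n, PowerSeries.coeff n (F * G) * ζ ^ n =
      ∑ kl ∈ Finset.HasAntidiagonal.antidiagonal n, (PowerSeries.coeff kl.1 F * ζ ^ kl.1) *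
        (PowerSeries.coeff kl.2 G * ζ ^ kl.2) := by
    intro n
    rw [PowerSeries.coeff_mul, Finset.sum_mul]
    refine Finset.sum_congr rfl fun kl hkl => ?_
    rw [← Finset.HasAntidiagonal.mem_antidiagonal.1 hkl, pow_add]
    ring
  have hs := summable_norm_sum_mul_antidiagonal_of_summable_norm s1 s2
  simp only [e]
  refine ⟨hs, ?_⟩
  have h := tsum_mul_tsum_eq_tsum_sum_antidiagonal_of_summable_norm s1 s2
  rw [h1.tsum_eq, h2.tsum_eq] at h
  rw [h]
  exact hs.of_norm.hasSum

theorem const (a : ℂ) : HasExpansion ε (fun _ => a) (PowerSeries.C a) := by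
  intro ζ _
  have h : ∀ n ≠ 0, PowerSeries.coeff n (PowerSeries.C a) * ζ ^ n = 0 := fun n hn => by
    rw [PowerSeries.coeff_C, if_neg hn, zero_mul]
  refine ⟨(hasSum_single 0 fun n hn => by rw [h n hn, norm_zero]).summable, ?_⟩
  simpa using hasSum_single 0 h

theorem id : HasExpansion ε (fun ζ => ζ) PowerSeries.X := by
  intro ζ _
  have h : ∀ n ≠ 1, PowerSeries.coeff n (PowerSeries.X : PowerSeries ℂ) * ζ ^ n = 0 :=
    fun n hn => by rw [PowerSeries.coeff_X, if_neg hn, zero_mul]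
  refine ⟨(hasSum_single 1 fun n hn => by rw [h n hn, norm_zero]).summable, ?_⟩
  simpa using hasSum_single 1 h

theorem polynomial (hf : HasExpansion ε f F) (p : Polynomial ℂ) :
    HasExpansion ε (fun ζ => p.eval (f ζ)) (Polynomial.aeval F p) := by
  have hC : ∀ a : ℂ, algebraMap ℂ (PowerSeries ℂ) a = PowerSeries.C a := fun _ => rfl
  induction p using Polynomial.induction_on with
  | C a => simpa [hC] using const a
  | add p q hp hq => simpa using hp.add hq
  | monomial n a ih =>
    convert ih.mul hf using 1
    · ext ζ; simp [pow_succ, mul_assoc]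
    · simp [pow_succ, mul_assoc]

/-- Averaging over segments against `x ^ (τ - 1)` divides the coefficients by `τ + n`. -/
theorem average {τ : ℂ} (hτ : 0 < τ.re) (hf : HasExpansion ε f F) {ζ : ℂ} (hζ : ‖ζ‖ < ε) :
    HasSum (fun n : ℕ => PowerSeries.coeff n F / (τ + n) * ζ ^ n)
      (∫ x in Ioc (0 : ℝ) 1, (x : ℂ) ^ (τ - 1) * f (x * ζ)) := by
  obtain ⟨s1, -⟩ := hf ζ hζ
  have hterm : ∀ n : ℕ, ∫ x in Ioc (0 : ℝ) 1, (x : ℂ) ^ (τ - 1) *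
      (PowerSeries.coeff n F * (x * ζ) ^ n) = PowerSeries.coeff n F / (τ + n) * ζ ^ n := by
    intro n
    have hre : 0 < (τ + n).re := by
      simp only [Complex.add_re, Complex.natCast_re]; positivity
    have hne : τ + n ≠ 0 := fun h => by simp [h] at hre
    have h1 : ∫ x in Ioc (0 : ℝ) 1, (x : ℂ) ^ (τ + n - 1) = 1 / (τ + n) := by
      rw [← intervalIntegral.integral_of_le zero_le_one, integral_cpow]
      · simp [hne]
      · left
        simp only [Complex.sub_re, Complex.one_re]
        linarith
    have h2 : ∫ x in Ioc (0 : ℝ) 1, (x : ℂ) ^ (τ - 1) * (PowerSeries.coeff n F * (x * ζ) ^ n)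
        = ∫ x in Ioc (0 : ℝ) 1, PowerSeries.coeff n F * ζ ^ n * (x : ℂ) ^ (τ + n - 1) := by
      refine setIntegral_congr_fun measurableSet_Ioc fun x hx => ?_
      have hx0 : (x : ℂ) ≠ 0 := Complex.ofReal_ne_zero.2 hx.1.ne'
      have : (x : ℂ) ^ (τ + n - 1) = (x : ℂ) ^ (τ - 1) * (x : ℂ) ^ n := by
        rw [← Complex.cpow_natCast, ← Complex.cpow_add _ _ hx0]; congr 1; ring
      simp only [this, mul_pow]
      ring
    rw [h2, integral_const_mul, h1]
    ring
  simp_rw [← hterm]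
  refine hasSum_integral_of_dominated_convergence
    (fun n x => x ^ (τ.re - 1) * ‖PowerSeries.coeff n F * ζ ^ n‖) (fun n => ?_) (fun n => ?_)
    (Eventually.of_forall fun x => s1.mul_left _) ?_ ?_
  · refine ContinuousOn.aestronglyMeasurable ?_ measurableSet_Ioc
    refine ContinuousOn.mul ?_ (Continuous.continuousOn (by fun_prop))
    exact fun x hx => (Complex.continuousAt_ofReal_cpow_const x (τ - 1)
      (Or.inr hx.1.ne')).continuousWithinAt
  · refine (ae_restrict_iff' measurableSet_Ioc).2 (Eventually.of_forall fun x hx => ?_)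
    rw [norm_mul, Complex.norm_cpow_eq_rpow_re_of_pos hx.1, Complex.sub_re, Complex.one_re]
    refine mul_le_mul_of_nonneg_left ?_ (Real.rpow_nonneg hx.1.le _)
    rw [norm_mul, norm_mul, norm_pow, norm_pow, norm_mul, Complex.norm_real,
      Real.norm_of_nonneg hx.1.le]
    have : x * ‖ζ‖ ≤ ‖ζ‖ := mul_le_of_le_one_left (norm_nonneg _) hx.2
    have := mul_nonneg hx.1.le (norm_nonneg ζ)
    gcongr
  · simp_rw [tsum_mul_left]
    exact (integrableOn_rpow_Ioc hτ).mul_const _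
  · refine (ae_restrict_iff' measurableSet_Ioc).2 (Eventually.of_forall fun x hx => ?_)
    refine (hf _ ?_).2.mul_left _
    rw [norm_mul, Complex.norm_real, Real.norm_of_nonneg hx.1.le]
    exact (mul_le_of_le_one_left (norm_nonneg _) hx.2).trans_lt hζ

end HasExpansion

theorem Gamma_add_nat_ne_zero {τ : ℂ} (hτ : 0 < τ.re) (n : ℕ) : Complex.Gamma (τ + n) ≠ 0 := by
  refine Complex.Gamma_ne_zero_of_re_pos ?_
  simp only [Complex.add_re, Complex.natCast_re]; positivity

/-- The Beta integral B(τ+m, j+2), divided by (j+1)! = Γ(j+2). It expresses that the product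
z^(-j-2) z^(-τ-m) corresponds to convolution of Borel transforms. -/
theorem integral_beta {τ : ℂ} (hτ : 0 < τ.re) (m j : ℕ) :
    ∫ x in Ioc (0 : ℝ) 1, (x : ℂ) ^ (τ - 1) * ((1 - x : ℂ) ^ (j + 1) / ((j + 1).factorial : ℂ) *
      (x : ℂ) ^ m) = Complex.Gamma (τ + m) / Complex.Gamma (τ + (j + m + 2 : ℕ)) := by
  have hm : 0 < (τ + m).re := by
    simp only [Complex.add_re, Complex.natCast_re]; positivity
  have hj : 0 < ((j : ℂ) + 1 + 1).re := by
    simp only [Complex.add_re, Complex.natCast_re, Complex.one_re]; positivity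
  have hB := Complex.Gamma_mul_Gamma_eq_betaIntegral hm hj
  have hfac : Complex.Gamma ((j : ℂ) + 1 + 1) = ((j + 1).factorial : ℂ) := by
    have := Complex.Gamma_nat_eq_factorial (j + 1)
    push_cast at this
    exact this
  have hne : ((j + 1).factorial : ℂ) ≠ 0 := Nat.cast_ne_zero.2 (Nat.factorial_ne_zero _)
  have hsum : τ + m + ((j : ℂ) + 1 + 1) = τ + (j + m + 2 : ℕ) := by push_cast; ring
  rw [hfac, hsum] at hB
  have h1 : ∫ x in Ioc (0 : ℝ) 1, (x : ℂ) ^ (τ - 1) *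
      ((1 - x : ℂ) ^ (j + 1) / ((j + 1).factorial : ℂ) * (x : ℂ) ^ m)
      = ((j + 1).factorial : ℂ)⁻¹ * Complex.betaIntegral (τ + m) ((j : ℂ) + 1 + 1) := by
    rw [Complex.betaIntegral, intervalIntegral.integral_of_le zero_le_one, ← integral_const_mul]
    refine setIntegral_congr_fun measurableSet_Ioc fun x hx => ?_
    have hx0 : (x : ℂ) ≠ 0 := Complex.ofReal_ne_zero.2 hx.1.ne'
    have e1 : (x : ℂ) ^ (τ + m - 1) = (x : ℂ) ^ (τ - 1) * (x : ℂ) ^ m := by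
      rw [← Complex.cpow_natCast, ← Complex.cpow_add _ _ hx0]; congr 1; ring
    have e2 : (1 - x : ℂ) ^ ((j : ℂ) + 1 + 1 - 1) = (1 - x : ℂ) ^ (j + 1) := by
      rw [← Complex.cpow_natCast]; congr 1; push_cast; ring
    simp only [e1, e2]
    ring
  rw [h1, eq_div_iff (Gamma_add_nat_ne_zero hτ _), mul_assoc, mul_comm (Complex.betaIntegral _ _),
    ← hB, mul_comm (Complex.Gamma _), ← mul_assoc, inv_mul_cancel₀ hne, one_mul]

/-- The expansion of the convolution term of the Volterra equation. -/
theorem hasSum_convolution_tail {ε τC B : ℝ} {τ : ℂ} {g : ℂ → ℂ} {F G : PowerSeries ℂ} {ρ : ℕ → ℂ}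
    (hτ : 0 < τ.re) (hB : 0 < B) (hρ : ∀ n, ‖ρ n‖ ≤ τC * B ^ n) (hg : HasExpansion ε g G)
    (hF : ∀ n, PowerSeries.coeff n F = Complex.Gamma (τ + n) * PowerSeries.coeff n G)
    {ζ : ℂ} (hζ : ‖ζ‖ < ε) :
    HasSum (fun n : ℕ => PowerSeries.coeff n (PowerSeries.mk ρ * F) /
        Complex.Gamma (τ + (n + 2 : ℕ)) * ζ ^ (n + 1))
      (∫ x in Ioc (0 : ℝ) 1, (x : ℂ) ^ (τ - 1) * (borelTail ρ ((1 - x) * ζ) * g (x * ζ))) := by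
  obtain ⟨s2, -⟩ := hg ζ hζ
  have s1 := summable_norm_borelTail hB hρ ζ
  -- The Cauchy product of the two series at fixed x. Integrating term by term, the Gamma factors of
  -- the Beta integrals recombine the coefficients into those of the product of the series of ρ with
  -- F.
  let u : ℕ → ℝ → ℂ := fun n x => ∑ jm ∈ Finset.HasAntidiagonal.antidiagonal n,
    (ρ jm.1 * (((1 - x) * ζ) ^ (jm.1 + 1) / ((jm.1 + 1).factorial : ℂ))) *
      (PowerSeries.coeff jm.2 G * (x * ζ) ^ jm.2)
  have hint : ∀ j m : ℕ, IntegrableOn (fun x : ℝ => (x : ℂ) ^ (τ - 1) *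
      ((1 - x : ℂ) ^ (j + 1) / ((j + 1).factorial : ℂ) * (x : ℂ) ^ m)) (Ioc 0 1) := by
    intro j m
    refine Integrable.mono' (integrableOn_rpow_Ioc hτ) ?_ ?_
    · refine ContinuousOn.aestronglyMeasurable ?_ measurableSet_Ioc
      refine ContinuousOn.mul ?_ (Continuous.continuousOn (by fun_prop))
      exact fun x hx => (Complex.continuousAt_ofReal_cpow_const x (τ - 1)
        (Or.inr hx.1.ne')).continuousWithinAt
    · refine (ae_restrict_iff' measurableSet_Ioc).2 (Eventually.of_forall fun x hx => ?_)
      rw [norm_mul, Complex.norm_cpow_eq_rpow_re_of_pos hx.1, Complex.sub_re, Complex.one_re]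
      refine mul_le_of_le_one_right (Real.rpow_nonneg hx.1.le _) ?_
      have h1 : ‖(1 - x : ℂ)‖ ≤ 1 := by
        rw [← Complex.ofReal_one, ← Complex.ofReal_sub, Complex.norm_real,
          Real.norm_of_nonneg (sub_nonneg.2 hx.2)]
        linarith [hx.1]
      have h2 : ‖(x : ℂ)‖ ≤ 1 := by
        rw [Complex.norm_real, Real.norm_of_nonneg hx.1.le]; exact hx.2
      have h3 : (1 : ℝ) ≤ ((j + 1).factorial : ℝ) := by
        exact_mod_cast Nat.one_le_iff_ne_zero.2 (Nat.factorial_ne_zero _)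
      rw [norm_mul, norm_div, norm_pow, norm_pow, Complex.norm_natCast]
      refine mul_le_one₀ ?_ (by positivity) (pow_le_one₀ (norm_nonneg _) h2)
      exact div_le_one_of_le₀ ((pow_le_one₀ (norm_nonneg _) h1).trans h3) (by positivity)
  have hterm : ∀ n : ℕ, ∫ x in Ioc (0 : ℝ) 1, (x : ℂ) ^ (τ - 1) * u n x
      = PowerSeries.coeff n (PowerSeries.mk ρ * F) /
        Complex.Gamma (τ + (n + 2 : ℕ)) * ζ ^ (n + 1) := by
    intro n
    have e1 : ∀ x : ℝ, (x : ℂ) ^ (τ - 1) * u n x = ∑ jm ∈ Finset.HasAntidiagonal.antidiagonal n,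
        (ρ jm.1 * PowerSeries.coeff jm.2 G * ζ ^ (n + 1)) * ((x : ℂ) ^ (τ - 1) *
        ((1 - x : ℂ) ^ (jm.1 + 1) / ((jm.1 + 1).factorial : ℂ) * (x : ℂ) ^ jm.2)) := by
      intro x
      rw [Finset.mul_sum]
      refine Finset.sum_congr rfl fun jm hjm => ?_
      rw [← Finset.HasAntidiagonal.mem_antidiagonal.1 hjm, mul_pow, mul_pow]
      ring
    simp_rw [e1]
    rw [integral_finsetSum _ fun jm _ => (hint jm.1 jm.2).const_mul _, PowerSeries.coeff_mul,
      Finset.sum_div, Finset.sum_mul]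
    refine Finset.sum_congr rfl fun jm hjm => ?_
    rw [integral_const_mul, integral_beta hτ, PowerSeries.coeff_mk, hF,
      Finset.HasAntidiagonal.mem_antidiagonal.1 hjm]
    ring
  simp_rw [← hterm]
  have hsum := summable_sum_mul_antidiagonal_of_summable_mul
    (Summable.mul_of_nonneg s1 s2 (fun _ => norm_nonneg _) fun _ => norm_nonneg _)
  have hmono1 : ∀ x ∈ Ioc (0 : ℝ) 1, ‖(1 - x : ℂ) * ζ‖ ≤ ‖ζ‖ := by
    intro x hx
    rw [norm_mul, ← Complex.ofReal_one, ← Complex.ofReal_sub, Complex.norm_real,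
      Real.norm_of_nonneg (sub_nonneg.2 hx.2)]
    exact mul_le_of_le_one_left (norm_nonneg _) (by linarith [hx.1])
  have hmono2 : ∀ x ∈ Ioc (0 : ℝ) 1, ‖(x : ℂ) * ζ‖ ≤ ‖ζ‖ := by
    intro x hx
    rw [norm_mul, Complex.norm_real, Real.norm_of_nonneg hx.1.le]
    exact mul_le_of_le_one_left (norm_nonneg _) hx.2
  refine hasSum_integral_of_dominated_convergence
    (fun n x => x ^ (τ.re - 1) * ∑ jm ∈ Finset.HasAntidiagonal.antidiagonal n,
      ‖ρ jm.1 * (ζ ^ (jm.1 + 1) / ((jm.1 + 1).factorial : ℂ))‖ *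
        ‖PowerSeries.coeff jm.2 G * ζ ^ jm.2‖) (fun n => ?_) (fun n => ?_)
    (Eventually.of_forall fun x => hsum.mul_left _) ?_ ?_
  · refine ContinuousOn.aestronglyMeasurable ?_ measurableSet_Ioc
    refine ContinuousOn.mul ?_ (Continuous.continuousOn (by fun_prop))
    exact fun x hx => (Complex.continuousAt_ofReal_cpow_const x (τ - 1)
      (Or.inr hx.1.ne')).continuousWithinAt
  · refine (ae_restrict_iff' measurableSet_Ioc).2 (Eventually.of_forall fun x hx => ?_)
    rw [norm_mul, Complex.norm_cpow_eq_rpow_re_of_pos hx.1, Complex.sub_re, Complex.one_re]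
    refine mul_le_mul_of_nonneg_left ?_ (Real.rpow_nonneg hx.1.le _)
    refine norm_sum_le_of_le _ fun jm _ => ?_
    have h1 := hmono1 x hx
    have h2 := hmono2 x hx
    rw [norm_mul]
    refine mul_le_mul ?_ ?_ (norm_nonneg _) (norm_nonneg _)
    · rw [norm_mul, norm_mul, norm_div, norm_div, norm_pow, norm_pow]
      gcongr
    · rw [norm_mul, norm_mul, norm_pow, norm_pow]
      gcongr
  · simp_rw [tsum_mul_left]
    exact (integrableOn_rpow_Ioc hτ).mul_const _
  · refine (ae_restrict_iff' measurableSet_Ioc).2 (Eventually.of_forall fun x hx => ?_)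
    refine HasSum.mul_left _ ?_
    obtain ⟨t2, h2⟩ := hg _ ((hmono2 x hx).trans_lt hζ)
    have t1 := summable_norm_borelTail hB hρ ((1 - x) * ζ)
    have h := tsum_mul_tsum_eq_tsum_sum_antidiagonal_of_summable_norm t1 t2
    rw [h2.tsum_eq] at h
    rw [borelTail, h]
    exact (summable_norm_sum_mul_antidiagonal_of_summable_norm t1 t2).of_norm.hasSum

theorem eq_zero_of_hasSum_zero {a : ℕ → ℂ} {ε : ℝ} (hε : 0 < ε)
    (h : ∀ ζ : ℂ, ‖ζ‖ < ε → HasSum (fun n => a n * ζ ^ n) 0) (n : ℕ) : a n = 0 := by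
  have h1 : HasFPowerSeriesAt (fun _ : ℂ => (0 : ℂ)) (FormalMultilinearSeries.ofScalars ℂ a) 0 := by
    rw [hasFPowerSeriesAt_iff]
    filter_upwards [ball_mem_nhds (0 : ℂ) hε] with ζ hζ
    have := h ζ (mem_ball_zero_iff.1 hζ)
    simpa [FormalMultilinearSeries.coeff_ofScalars, mul_comm] using this
  have h2 := h1.eq_zero
  have h3 := congrArg (fun p => FormalMultilinearSeries.coeff p n) h2
  rw [FormalMultilinearSeries.coeff_ofScalars] at h3
  exact h3.trans (by simp [FormalMultilinearSeries.coeff])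

/-- The Borel transform as a linear map. -/
noncomputable def borelLin (τ : ℂ) : PowerSeries ℂ →ₗ[ℂ] PowerSeries ℂ where
  toFun := borelTransform τ
  map_add' F G := by ext n; simp [borelTransform, add_div]
  map_smul' c F := by ext n; simp [borelTransform, mul_div_assoc]

theorem coeff_borelLin (τ : ℂ) (F : PowerSeries ℂ) (n : ℕ) :
    PowerSeries.coeff n (borelLin τ F) = PowerSeries.coeff n F / Complex.Gamma (τ + n) := by
  simp [borelLin, borelTransform]

theorem Gamma_add_nat_succ {τ : ℂ} (hτ : 0 < τ.re) (n : ℕ) :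
    Complex.Gamma (τ + (n + 1 : ℕ)) = (τ + n) * Complex.Gamma (τ + n) := by
  have hne : τ + n ≠ 0 := fun h => by
    have : 0 < (τ + n).re := by simp only [Complex.add_re, Complex.natCast_re]; positivity
    simp [h] at this
  rw [← Complex.Gamma_add_one _ hne]
  congr 1; push_cast; ring

theorem coeff_formalDeriv_zero (α τ : ℂ) (F : PowerSeries ℂ) :
    PowerSeries.coeff 0 (formalDeriv α τ F) = -α * PowerSeries.coeff 0 F := by
  simp [formalDeriv]

/-- The derivative of z^(-τ-n) is -(τ+n) z^(-τ-n-1); the summands τX and X² d/dX contribute the τ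
and the n. -/
theorem coeff_formalDeriv_succ (α τ : ℂ) (F : PowerSeries ℂ) (n : ℕ) :
    PowerSeries.coeff (n + 1) (formalDeriv α τ F)
      = -α * PowerSeries.coeff (n + 1) F - (τ + n) * PowerSeries.coeff n F := by
  have h : PowerSeries.coeff (n + 1) (PowerSeries.X ^ 2 * PowerSeries.derivative ℂ F)
      = n * PowerSeries.coeff n F := by
    rw [pow_two, mul_assoc, PowerSeries.coeff_succ_X_mul]
    cases n with
    | zero => simp
    | succ n =>
      rw [PowerSeries.coeff_succ_X_mul, PowerSeries.coeff_derivative]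
      push_cast; ring
  simp only [formalDeriv, LinearMap.sub_apply, LinearMap.neg_apply, LinearMap.smul_apply,
    LinearMap.id_apply, LinearMap.mulLeft_apply, LinearMap.comp_apply, map_sub, map_neg,
    Derivation.coeFn_coe, h]
  simp only [map_smul, smul_eq_mul, PowerSeries.coeff_succ_X_mul]
  ring

/-- The Borel transform turns differentiation into multiplication. -/
theorem borelLin_formalDeriv {τ : ℂ} (hτ : 0 < τ.re) (α : ℂ) (F : PowerSeries ℂ) :
    borelLin τ (formalDeriv α τ F)
      = Algebra.lmul ℂ (PowerSeries ℂ) (PowerSeries.C (-α) + PowerSeries.C (-1) * PowerSeries.X)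
        (borelLin τ F) := by
  ext n
  have hc : ∀ (a : ℂ) (G : PowerSeries ℂ), PowerSeries.C a * G = a • G := fun a G =>
    (PowerSeries.smul_eq_C_mul G a).symm
  change _ = PowerSeries.coeff n
    ((PowerSeries.C (-α) + PowerSeries.C (-1) * PowerSeries.X) * borelLin τ F)
  rw [add_mul, mul_assoc, hc, hc, map_add, map_smul, map_smul, smul_eq_mul, smul_eq_mul]
  rw [coeff_borelLin, coeff_borelLin]
  cases n with
  | zero => simp [coeff_formalDeriv_zero]; ring
  -- The factor τ + n produced by the formal derivative is cancelled by Γ(τ+n+1) = (τ+n) Γ(τ+n).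
  | succ n =>
    have h1 := Gamma_add_nat_ne_zero hτ n
    have h2 := Gamma_add_nat_ne_zero hτ (n + 1)
    have h3 := Gamma_add_nat_succ hτ n
    rw [coeff_formalDeriv_succ, PowerSeries.coeff_succ_X_mul, coeff_borelLin]
    have h4 : τ + n ≠ 0 := fun h => h2 (by rw [h3, h, zero_mul])
    rw [h3]
    field_simp
    ring

theorem borelLin_aeval {τ : ℂ} (hτ : 0 < τ.re) (α : ℂ) (p : Polynomial ℂ) (F : PowerSeries ℂ) :
    borelLin τ (Polynomial.aeval (formalDeriv α τ) p F)
      = Polynomial.aeval (PowerSeries.C (-α) + PowerSeries.C (-1) * PowerSeries.X) p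
        * borelLin τ F := by
  rw [aeval_intertwine (borelLin_formalDeriv hτ α), Polynomial.aeval_algHom_apply]
  rfl

/-- The expansion at the origin of a solution of the Volterra equation is the Borel transform of a
formal solution of the differential equation. -/
theorem isFormalSolution_of_volterra {P p Q : Polynomial ℂ} {R : ℂ → ℂ} {α τ : ℂ} {g : ℂ → ℂ}
    {F G : PowerSeries ℂ} {ε B C : ℝ} (hP : P = (Polynomial.X + Polynomial.C α) * p)
    (hε : 0 < ε) (hτ : 0 < τ.re) (hB : 0 < B)
    (hρ : ∀ n, ‖PowerSeries.coeff n (taylorSeries R)‖ ≤ C * B ^ n)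
    (hgc : ContinuousOn g (ball 0 ε)) (hg : HasExpansion ε g G)
    (hF : ∀ n, PowerSeries.coeff n F = Complex.Gamma (τ + n) * PowerSeries.coeff n G)
    (hp : ∀ ζ ∈ ball (0 : ℂ) ε, p.eval (-α - ζ) ≠ 0)
    (heq : ∀ ζ ∈ ball (0 : ℂ) ε, g ζ +
      volterra (borelKernel p Q (fun n => PowerSeries.coeff n (taylorSeries R)) α) τ g ζ = 0) :
    IsFormalSolution P Q R α τ F := by
  set ρ : ℕ → ℂ := fun n => PowerSeries.coeff n (taylorSeries R) with hρdef
  have hT : PowerSeries.mk ρ = taylorSeries R := by ext n; simp [hρdef]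
  set s : PowerSeries ℂ := PowerSeries.C (-α) + PowerSeries.C (-1) * PowerSeries.X with hs
  have hBF : borelLin τ F = G := by
    ext n
    rw [coeff_borelLin, hF, mul_div_cancel_left₀ _ (Gamma_add_nat_ne_zero hτ n)]
  have hsexp : HasExpansion ε (fun ζ => -α + -1 * ζ) s :=
    (HasExpansion.const (-α)).add ((HasExpansion.const (-1)).mul HasExpansion.id)
  have hPg := (hsexp.polynomial P).mul hg
  have hQg := (hsexp.polynomial Q).mul hg
  set opF : PowerSeries ℂ := Polynomial.aeval (formalDeriv α τ) P F
    + PowerSeries.X * Polynomial.aeval (formalDeriv α τ) Q F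
    + PowerSeries.X ^ 2 * taylorSeries R * F with hop
  -- The Borel transform of the formal expression sums on the disk to the left side of the Volterra
  -- equation times -ζ p(-α-ζ), hence to zero. Since Γ(τ+n) is finite and nonzero, vanishing of the
  -- transformed coefficients gives a formal solution.
  have key : ∀ n, PowerSeries.coeff n (borelLin τ opF) = 0 := by
    refine eq_zero_of_hasSum_zero hε fun ζ hζ => ?_
    have hζ' : ζ ∈ ball (0 : ℂ) ε := mem_ball_zero_iff.2 hζ
    have h1 := (hPg ζ hζ).2
    have h2 := hQg.average hτ hζ
    have h3 := hasSum_convolution_tail hτ hB hρ hg hF hζ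
    rw [hT] at h3
    have e1 : ∀ n, PowerSeries.coeff n (Polynomial.aeval s P * G) * ζ ^ n =
        PowerSeries.coeff n (borelLin τ (Polynomial.aeval (formalDeriv α τ) P F)) * ζ ^ n := by
      intro n; rw [borelLin_aeval hτ, hBF]
    have h2' : HasSum (fun n => PowerSeries.coeff n
        (borelLin τ (PowerSeries.X * Polynomial.aeval (formalDeriv α τ) Q F)) * ζ ^ n)
        (ζ * ∫ x in Ioc (0 : ℝ) 1, (x : ℂ) ^ (τ - 1) *
          (Q.eval (-α + -1 * (x * ζ)) * g (x * ζ))) := by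
      rw [← hasSum_nat_add_iff' 1]
      have e2 : ∀ n : ℕ, PowerSeries.coeff (n + 1)
          (borelLin τ (PowerSeries.X * Polynomial.aeval (formalDeriv α τ) Q F)) * ζ ^ (n + 1)
          = ζ * (PowerSeries.coeff n (Polynomial.aeval s Q * G) / (τ + n) * ζ ^ n) := by
        intro n
        rw [← hBF, ← borelLin_aeval hτ, coeff_borelLin, coeff_borelLin,
          PowerSeries.coeff_succ_X_mul, Gamma_add_nat_succ hτ, pow_succ]
        field_simp
      simp only [e2]
      have e3 : PowerSeries.coeff 0
          (borelLin τ (PowerSeries.X * Polynomial.aeval (formalDeriv α τ) Q F)) = 0 := by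
        simp [coeff_borelLin]
      simpa [e3] using h2.mul_left ζ
    have h3' : HasSum (fun n => PowerSeries.coeff n
        (borelLin τ (PowerSeries.X ^ 2 * taylorSeries R * F)) * ζ ^ n)
        (ζ * ∫ x in Ioc (0 : ℝ) 1, (x : ℂ) ^ (τ - 1) *
          (borelTail ρ ((1 - x) * ζ) * g (x * ζ))) := by
      rw [← hasSum_nat_add_iff' 2]
      have e2 : ∀ n : ℕ, PowerSeries.coeff (n + 2)
          (borelLin τ (PowerSeries.X ^ 2 * taylorSeries R * F)) * ζ ^ (n + 2)
          = ζ * (PowerSeries.coeff n (taylorSeries R * F) /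
            Complex.Gamma (τ + (n + 2 : ℕ)) * ζ ^ (n + 1)) := by
        intro n
        rw [coeff_borelLin, mul_assoc, pow_two, mul_assoc, PowerSeries.coeff_succ_X_mul,
          PowerSeries.coeff_succ_X_mul]
        ring
      simp only [e2]
      have e3 : ∀ n < 2, PowerSeries.coeff n
          (borelLin τ (PowerSeries.X ^ 2 * taylorSeries R * F)) = 0 := by
        intro n hn
        rw [coeff_borelLin, mul_assoc, PowerSeries.coeff_X_pow_mul', if_neg (by omega), zero_div]
      simpa [Finset.sum_range_succ, e3] using h3.mul_left ζ
    simp only [e1] at h1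
    have hall := (h1.add h2').add h3'
    convert hall using 1
    · ext n; simp only [hop, map_add]; ring
    · have hζx : ∀ x ∈ uIcc (0 : ℝ) 1, (x : ℂ) * ζ ∈ ball (0 : ℂ) ε := by
        intro x hx
        rw [uIcc_of_le zero_le_one] at hx
        rw [mem_ball_zero_iff, norm_mul, Complex.norm_real, Real.norm_of_nonneg hx.1]
        exact (mul_le_of_le_one_left (norm_nonneg _) hx.2).trans_lt hζ
      have hgx : ContinuousOn (fun x : ℝ => g (x * ζ)) (uIcc 0 1) :=
        hgc.comp (Continuous.continuousOn (by fun_prop)) hζx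
      have hpow : IntervalIntegrable (fun x : ℝ => (x : ℂ) ^ (τ - 1)) volume 0 1 :=
        intervalIntegral.intervalIntegrable_cpow' (by
          rw [Complex.sub_re, Complex.one_re]; linarith)
      have hQc := Q.continuous
      have hrc := (differentiable_borelTail hB hρ).continuous
      have k1 := hpow.mul_continuousOn (g := fun x : ℝ =>
        Q.eval (-α + -1 * (x * ζ)) * g (x * ζ))
        ((hQc.comp (by fun_prop)).continuousOn.mul hgx)
      have k2 := hpow.mul_continuousOn (g := fun x : ℝ =>
        borelTail ρ ((1 - x) * ζ) * g (x * ζ))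
        ((hrc.comp (by fun_prop)).continuousOn.mul hgx)
      have hpne := hp ζ hζ'
      have hPe : P.eval (-α + -1 * ζ) = -ζ * p.eval (-α - ζ) := by
        rw [hP, Polynomial.eval_mul, Polynomial.eval_add, Polynomial.eval_X, Polynomial.eval_C]
        ring_nf
      have hsplit : volterra (borelKernel p Q ρ α) τ g ζ = (-p.eval (-α - ζ))⁻¹ *
          ((∫ x in Ioc (0 : ℝ) 1, (x : ℂ) ^ (τ - 1) * (Q.eval (-α + -1 * (x * ζ)) * g (x * ζ)))
          + ∫ x in Ioc (0 : ℝ) 1, (x : ℂ) ^ (τ - 1) *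
            (borelTail ρ ((1 - x) * ζ) * g (x * ζ))) := by
        rw [← integral_add ((intervalIntegrable_iff_integrableOn_Ioc_of_le zero_le_one).1 k1)
          ((intervalIntegrable_iff_integrableOn_Ioc_of_le zero_le_one).1 k2),
          ← integral_const_mul]
        unfold volterra borelKernel
        congr 1
        ext x
        have : -α + -1 * ((x : ℂ) * ζ) = -α - x * ζ := by ring
        rw [this, div_eq_inv_mul]
        ring
      have h5 := heq ζ hζ'
      rw [hsplit] at h5
      have h6 := eq_neg_of_add_eq_zero_left h5
      rw [hPe]
      generalize p.eval (-α - ζ) = pe at *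
      rw [h6]
      field_simp
      ring
  change opF = 0
  ext n
  have := key n
  rw [coeff_borelLin, div_eq_zero_iff] at this
  simpa using this.resolve_right (Gamma_add_nat_ne_zero hτ n)

/-! ### Differential operators and decay on half-planes -/

/-- The holomorphic functions on `U`, extended by zero. -/
def holoOn (U : Set ℂ) : Submodule ℂ (ℂ → ℂ) where
  carrier := {f | DifferentiableOn ℂ f U ∧ ∀ z ∉ U, f z = 0}
  add_mem' := fun {f g} hf hg => ⟨hf.1.add hg.1, fun z hz => by simp [hf.2 z hz, hg.2 z hz]⟩
  zero_mem' := ⟨differentiableOn_const 0, fun _ _ => rfl⟩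
  smul_mem' := fun c f hf => ⟨hf.1.const_smul c, fun z hz => by simp [hf.2 z hz]⟩

/-- Differentiation of holomorphic functions. -/
noncomputable def holoDeriv {U : Set ℂ} (hU : IsOpen U) : Module.End ℂ (holoOn U) where
  toFun f := ⟨U.indicator (deriv f.1),
    ((f.2.1.deriv hU).congr fun z hz => indicator_of_mem hz _),
    fun z hz => indicator_of_notMem hz _⟩
  map_add' f g := by
    ext z
    by_cases hz : z ∈ U
    · have hf := f.2.1.differentiableAt (hU.mem_nhds hz)
      have hg := g.2.1.differentiableAt (hU.mem_nhds hz)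
      simp [hz, deriv_add hf hg]
    · simp [hz]
  map_smul' c f := by
    ext z
    by_cases hz : z ∈ U
    · have hf := f.2.1.differentiableAt (hU.mem_nhds hz)
      simp [hz, deriv_const_smul c hf]
    · simp [hz]

/-- The restriction of a holomorphic function to `U`, extended by zero. -/
noncomputable def holoRestrict {U : Set ℂ} (f : ℂ → ℂ) (hf : DifferentiableOn ℂ f U) : holoOn U :=
  ⟨U.indicator f, hf.congr fun _ hz => indicator_of_mem hz _, fun _ hz => indicator_of_notMem hz _⟩

section Holo

variable {U : Set ℂ} (hU : IsOpen U)

theorem holoDeriv_apply (f : holoOn U) {z : ℂ} (hz : z ∈ U) :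
    (holoDeriv hU f).1 z = deriv f.1 z := indicator_of_mem hz _

theorem hasDerivAt_holoOn (f : holoOn U) {z : ℂ} (hz : z ∈ U) :
    HasDerivAt f.1 ((holoDeriv hU f).1 z) z := by
  rw [holoDeriv_apply hU f hz]
  exact (f.2.1.differentiableAt (hU.mem_nhds hz)).hasDerivAt

theorem holoDeriv_pow_apply (f : ℂ → ℂ) (hf : DifferentiableOn ℂ f U) (k : ℕ) {z : ℂ}
    (hz : z ∈ U) : (((holoDeriv hU) ^ k) (holoRestrict f hf)).1 z = iteratedDeriv k f z := by
  induction k generalizing z with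
  | zero => simp [holoRestrict, hz]
  | succ k ih =>
    rw [pow_succ', Module.End.mul_apply, holoDeriv_apply hU _ hz, iteratedDeriv_succ]
    refine Filter.EventuallyEq.deriv_eq ?_
    filter_upwards [hU.mem_nhds hz] with z' hz' using ih hz'

theorem aeval_holoDeriv_apply (f : ℂ → ℂ) (hf : DifferentiableOn ℂ f U) (p : Polynomial ℂ) {z : ℂ}
    (hz : z ∈ U) : (Polynomial.aeval (holoDeriv hU) p (holoRestrict f hf)).1 z
      = p.sum (fun k c => c * iteratedDeriv k f z) := by
  rw [Polynomial.aeval_def, Polynomial.eval₂_eq_sum, Polynomial.sum_def, Polynomial.sum_def]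
  simp only [LinearMap.sum_apply, Submodule.coe_sum, Finset.sum_apply]
  refine Finset.sum_congr rfl fun k _ => ?_
  rw [Module.End.mul_apply, Module.algebraMap_end_apply, Submodule.coe_smul, Pi.smul_apply,
    holoDeriv_pow_apply hU f hf k hz, smul_eq_mul]

/-- Multiplication by `exp (-α z)`. -/
noncomputable def expMul (α : ℂ) : holoOn U →ₗ[ℂ] holoOn U where
  toFun f := ⟨fun z => Complex.exp (-α * z) * f.1 z,
    DifferentiableOn.mul (Differentiable.differentiableOn (by fun_prop)) f.2.1,
    fun z hz => mul_eq_zero_of_right _ (f.2.2 z hz)⟩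
  map_add' f g := by ext z; simp [mul_add]
  map_smul' c f := by ext z; simp [mul_left_comm]

/-- Conjugation by e^(-αz) replaces d/dz by d/dz - α, so the exponential factor can be removed from
the equation for a difference of solutions. -/
theorem aeval_holoDeriv_expMul (α : ℂ) (p : Polynomial ℂ) (y : holoOn U) :
    Polynomial.aeval (holoDeriv hU) p (expMul α y)
      = expMul α (Polynomial.aeval (holoDeriv hU) (p.comp (Polynomial.X - Polynomial.C α)) y) := by
  rw [Polynomial.aeval_comp]
  refine (aeval_intertwine (fun v => ?_) p y).symm
  ext z
  by_cases hz : z ∈ U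
  · have h1 := hasDerivAt_holoOn hU v hz
    have h2 : HasDerivAt (fun z : ℂ => -α * z) (-α) z := by
      simpa using (hasDerivAt_id z).const_mul (-α)
    have h3 := (h2.cexp.mul h1).deriv
    rw [holoDeriv_apply hU _ hz]
    refine Eq.trans ?_ h3.symm
    simp [expMul]
    ring
  · rw [(holoDeriv hU _).2.2 z hz, (expMul α _).2.2 z hz]

end Holo

/-- A decay estimate along a ray, by integration of the derivative. -/
theorem norm_le_of_deriv_le {G G' : ℝ → ℂ} {φ φ' : ℝ → ℝ}
    (hG : ∀ s, 0 ≤ s → HasDerivAt G (G' s) s) (hφ : ∀ s, 0 ≤ s → HasDerivAt φ (-φ' s) s)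
    (hle : ∀ s, 0 ≤ s → ‖G' s‖ ≤ φ' s) (hφ0 : ∀ s, 0 ≤ s → 0 ≤ φ s)
    (hlim : Tendsto G atTop (𝓝 0)) : ‖G 0‖ ≤ φ 0 := by
  have h1 : ∀ S, 0 ≤ S → ‖G S - G 0‖ ≤ φ 0 := by
    intro S hS
    have := image_norm_le_of_norm_deriv_right_le_deriv_boundary' (a := 0) (b := S)
      (f := fun s => G s - G 0) (f' := G') (B := fun s => φ 0 - φ s) (B' := φ')
      (fun s hs => ((hG s hs.1).continuousAt.continuousWithinAt.sub continuousWithinAt_const))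
      (fun s hs => ((hG s hs.1).sub_const _).hasDerivWithinAt) (by simp)
      (fun s hs => (continuousAt_const.sub (hφ s hs.1).continuousAt).continuousWithinAt)
      (fun s hs => by simpa using ((hφ s hs.1).const_sub (φ 0)).hasDerivWithinAt)
      (fun s hs => hle s hs.1) (right_mem_Icc.2 hS)
    exact this.trans (by linarith [hφ0 S hS])
  have h2 : Tendsto (fun S => ‖G S - G 0‖) atTop (𝓝 ‖G 0‖) := by
    have := (hlim.sub_const (G 0)).norm
    simpa using this
  exact le_of_tendsto h2 ((eventually_ge_atTop 0).mono fun S hS => h1 S hS)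

/-- The half-plane `Re (e z) > M`. -/
def halfPlane (e : ℂ) (M : ℝ) : Set ℂ := {z | M < (e * z).re}

theorem isOpen_halfPlane (e : ℂ) (M : ℝ) : IsOpen (halfPlane e M) :=
  isOpen_lt continuous_const (by fun_prop)

theorem halfPlane_anti {e : ℂ} {M M' : ℝ} (h : M ≤ M') : halfPlane e M' ⊆ halfPlane e M :=
  fun _ hz => lt_of_le_of_lt h hz

/-- The bound `|v z| ≤ B (Re (e z)) ^ (-N)` on the half-plane `Re (e z) > M`. -/
def DecayOn (e : ℂ) (M N B : ℝ) (v : ℂ → ℂ) : Prop :=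
  ∀ z ∈ halfPlane e M, ‖v z‖ ≤ B * (e * z).re ^ (-N)

/-- Decay of order `N` on a sufficiently distant half-plane. -/
def Decay (e : ℂ) (N : ℝ) (v : ℂ → ℂ) : Prop :=
  ∃ M B : ℝ, 1 ≤ M ∧ 0 ≤ B ∧ DecayOn e M N B v

theorem DecayOn.anti {e : ℂ} {M M' N B : ℝ} {v : ℂ → ℂ} (h : DecayOn e M N B v) (hM : M ≤ M') :
    DecayOn e M' N B v := fun z hz => h z (halfPlane_anti hM hz)

namespace Decay

variable {e : ℂ} {N N' : ℝ} {v v' : ℂ → ℂ}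

theorem add (h : Decay e N v) (h' : Decay e N v') : Decay e N (fun z => v z + v' z) := by
  obtain ⟨M, B, hM, hB, hv⟩ := h
  obtain ⟨M', B', hM', hB', hv'⟩ := h'
  refine ⟨max M M', B + B', le_max_of_le_left hM, add_nonneg hB hB', fun z hz => ?_⟩
  rw [add_mul]
  exact (norm_add_le _ _).trans (add_le_add (hv.anti (le_max_left _ _) z hz)
    (hv'.anti (le_max_right _ _) z hz))

theorem bdd_mul {s : ℂ → ℂ} {S M₁ : ℝ} (hs : ∀ z ∈ halfPlane e M₁, ‖s z‖ ≤ S)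
    (h : Decay e N v) : Decay e N (fun z => s z * v z) := by
  obtain ⟨M, B, hM, hB, hv⟩ := h
  refine ⟨max M M₁, |S| * B, le_max_of_le_left hM, by positivity, fun z hz => ?_⟩
  have h1 := hs z (halfPlane_anti (le_max_right _ _) hz)
  have h2 := hv.anti (le_max_left M M₁) z hz
  rw [norm_mul, mul_assoc]
  exact mul_le_mul (h1.trans (le_abs_self S)) h2 (norm_nonneg _) (abs_nonneg S)

theorem const_mul (c : ℂ) (h : Decay e N v) : Decay e N (fun z => c * v z) :=
  bdd_mul (s := fun _ => c) (M₁ := 0) (fun _ _ => le_rfl) h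

theorem of_le (hN : N' ≤ N) (h : Decay e N v) : Decay e N' v := by
  obtain ⟨M, B, hM, hB, hv⟩ := h
  refine ⟨M, B, hM, hB, fun z hz => (hv z hz).trans ?_⟩
  exact mul_le_mul_of_nonneg_left
    (Real.rpow_le_rpow_of_exponent_le (hM.trans (le_of_lt hz)) (neg_le_neg hN)) hB

theorem congr {M₀ : ℝ} (hvv : ∀ z ∈ halfPlane e M₀, v z = v' z) (h : Decay e N v) :
    Decay e N v' := by
  obtain ⟨M, B, hM, hB, hv⟩ := h
  refine ⟨max M M₀, B, le_max_of_le_left hM, hB, fun z hz => ?_⟩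
  rw [← hvv z (halfPlane_anti (le_max_right _ _) hz)]
  exact hv.anti (le_max_left _ _) z hz

end Decay

theorem re_mul_le_norm {e z : ℂ} (he : ‖e‖ = 1) : (e * z).re ≤ ‖z‖ := by
  refine (Complex.re_le_norm _).trans ?_
  rw [norm_mul, he, one_mul]

theorem Decay.inv_mul {e : ℂ} {N : ℝ} {v : ℂ → ℂ} (he : ‖e‖ = 1) (h : Decay e N v) :
    Decay e (N + 1) (fun z => z⁻¹ * v z) := by
  obtain ⟨M, B, hM, hB, hv⟩ := h
  refine ⟨M, B, hM, hB, fun z hz => ?_⟩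
  have hX : 0 < (e * z).re := by linarith [show M < (e * z).re from hz]
  rw [norm_mul, norm_inv, neg_add, Real.rpow_add hX, Real.rpow_neg_one]
  have h1 : ‖z‖⁻¹ ≤ (e * z).re⁻¹ := inv_anti₀ hX (re_mul_le_norm he)
  calc ‖z‖⁻¹ * ‖v z‖ ≤ (e * z).re⁻¹ * (B * (e * z).re ^ (-N)) :=
        mul_le_mul h1 (hv z hz) (norm_nonneg _) (by positivity)
    _ = _ := by ring

section HalfPlane

variable {e : ℂ} {M₀ : ℝ}

/-- Differentiation on the half-plane `Re (e z) > M₀`. -/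
noncomputable abbrev hpDeriv (e : ℂ) (M₀ : ℝ) : Module.End ℂ (holoOn (halfPlane e M₀)) :=
  holoDeriv (isOpen_halfPlane e M₀)

theorem norm_hpDeriv_le (he : ‖e‖ = 1) (v : holoOn (halfPlane e M₀)) {z : ℂ} {r B : ℝ}
    (hr : 0 < r) (hz : M₀ < (e * z).re - r)
    (hB : ∀ w, (e * z).re - r ≤ (e * w).re → ‖v.1 w‖ ≤ B) :
    ‖(hpDeriv e M₀ v).1 z‖ ≤ B / r := by
  have hball : ∀ w ∈ closedBall z r, (e * z).re - r ≤ (e * w).re := by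
    intro w hw
    rw [mem_closedBall, dist_comm, dist_eq_norm] at hw
    have := re_mul_le_norm (z := z - w) he
    rw [mul_sub, Complex.sub_re] at this
    linarith
  rw [holoDeriv_apply _ _ (show z ∈ halfPlane e M₀ by
    change M₀ < (e * z).re; linarith)]
  refine Complex.norm_deriv_le_of_forall_mem_sphere_norm_le hr ?_ ?_
  · exact (v.2.1.mono fun w hw => hz.trans_le (hball w hw)).diffContOnCl_ball subset_rfl
  · exact fun w hw => hB w (hball w (sphere_subset_closedBall hw))

/-- Cauchy's estimate on a disk of radius half of Re(ez): dividing by a radius proportional to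
Re(ez) gains one order. Doubling the abscissa keeps these disks where the decay is known. -/
theorem Decay.hpDeriv (he : ‖e‖ = 1) {N : ℝ} (hN : 0 ≤ N) {v : holoOn (halfPlane e M₀)}
    (h : Decay e N v.1) : Decay e (N + 1) (hpDeriv e M₀ v).1 := by
  obtain ⟨M, B, hM, hB, hv⟩ := h
  refine ⟨2 * max M M₀, B * 2 ^ (N + 1), by linarith [le_max_left M M₀], by positivity,
    fun z hz => ?_⟩
  have hz' : 2 * max M M₀ < (e * z).re := hz
  have h1 := le_max_left M M₀
  have h2 := le_max_right M M₀
  have hX : 0 < (e * z).re / 2 := by linarith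
  have := norm_hpDeriv_le he v (z := z) (r := (e * z).re / 2)
    (B := B * ((e * z).re / 2) ^ (-N)) hX (by linarith) fun w hw => ?_
  · refine this.trans (le_of_eq ?_)
    rw [mul_div_assoc, ← Real.rpow_sub_one hX.ne', Real.div_rpow (by linarith) zero_le_two,
      show -N - 1 = -(N + 1) by ring, Real.rpow_neg zero_le_two, div_inv_eq_mul]
    ring
  · have hw' : (e * z).re / 2 ≤ (e * w).re := by linarith
    refine (hv w (show M < (e * w).re by linarith)).trans ?_
    exact mul_le_mul_of_nonneg_left (Real.rpow_le_rpow_of_nonpos hX hw' (by linarith)) hB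

theorem Decay.aeval (he : ‖e‖ = 1) {N : ℝ} (hN : 0 ≤ N) {v : holoOn (halfPlane e M₀)}
    (h : Decay e N v.1) (p : Polynomial ℂ) :
    Decay e N (Polynomial.aeval (BorelReg.hpDeriv e M₀) p v).1 := by
  induction p using Polynomial.induction_on' with
  | add p q hp hq => simpa using! hp.add hq
  | monomial n a =>
    have hpow : Decay e N ((BorelReg.hpDeriv e M₀ ^ n) v).1 := by
      induction n with
      | zero => simpa using h
      | succ n ih =>
        rw [pow_succ', Module.End.mul_apply]
        exact (ih.hpDeriv he hN).of_le (by linarith)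
    rw [Polynomial.aeval_monomial]
    exact hpow.const_mul a

/-- Everything beyond the constant coefficient carries at least one derivative and so decays one
order faster. This isolates the leading part of the equation. -/
theorem aeval_eq_divX (D : Module.End ℂ (holoOn (halfPlane e M₀))) (p : Polynomial ℂ)
    (v : holoOn (halfPlane e M₀)) :
    Polynomial.aeval D p v = Polynomial.aeval D p.divX (D v) + p.eval 0 • v := by
  conv_lhs => rw [← p.divX_mul_X_add]
  rw [map_add, map_mul, Polynomial.aeval_X, Polynomial.aeval_C, ← Polynomial.coeff_zero_eq_eval_zero]
  rfl

/-- The principal argument is bounded by π, so the imaginary part of τ only affects constants. -/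
theorem norm_cpow_le_mul_exp {w τ : ℂ} (hw : w ≠ 0) :
    ‖w ^ τ‖ ≤ ‖w‖ ^ τ.re * Real.exp (Real.pi * |τ.im|) ∧
      ‖w‖ ^ τ.re ≤ ‖w ^ τ‖ * Real.exp (Real.pi * |τ.im|) := by
  have h1 : |w.arg * τ.im| ≤ Real.pi * |τ.im| := by
    rw [abs_mul]
    exact mul_le_mul_of_nonneg_right (Complex.abs_arg_le_pi w) (abs_nonneg _)
  obtain ⟨h2, h3⟩ := abs_le.1 h1
  have hn : 0 ≤ ‖w‖ ^ τ.re := Real.rpow_nonneg (norm_nonneg _) _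
  rw [Complex.norm_cpow_of_ne_zero hw, div_eq_mul_inv, ← Real.exp_neg]
  constructor
  · exact mul_le_mul_of_nonneg_left (Real.exp_le_exp.2 (by linarith)) hn
  · rw [mul_assoc, ← Real.exp_add]
    exact le_mul_of_one_le_right hn (Real.one_le_exp (by linarith))

/-- Integration of the leading part `y' + τ z⁻¹ y` of the equation. -/
theorem Decay.of_leading (he : ‖e‖ = 1) {τ : ℂ} (hτ : 0 ≤ τ.re) {N : ℝ} (hN : τ.re < N)
    {y : holoOn (halfPlane e M₀)} (hy : Decay e N y.1)
    (hf : Decay e (N + 2) (fun z => (BorelReg.hpDeriv e M₀ y).1 z + τ * (z⁻¹ * y.1 z))) :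
    Decay e (N + 1) y.1 := by
  obtain ⟨M₁, B₁, hM₁, hB₁, hy⟩ := hy
  obtain ⟨M₂, B, hM₂, hB, hf⟩ := hf
  set E := Real.exp (Real.pi * |τ.im|) with hE
  have hE0 : 0 < E := Real.exp_pos _
  set κ := N + 1 - τ.re with hκ
  have hκ0 : 0 < κ := by linarith
  set M := max (max M₁ M₂) M₀ with hM
  have hMM₁ : M₁ ≤ M := (le_max_left _ _).trans (le_max_left _ _)
  have hMM₂ : M₂ ≤ M := (le_max_right _ _).trans (le_max_left _ _)
  have hMM₀ : M₀ ≤ M := le_max_right _ _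
  refine ⟨M, E ^ 2 * B / κ, by linarith, by positivity, fun z hz => ?_⟩
  have hz' : M < (e * z).re := hz
  set X := (e * z).re with hX
  have hX0 : 0 < X := by linarith
  have he0 : e ≠ 0 := fun h => by simp [h] at he
  have hzX : X ≤ ‖z‖ := re_mul_le_norm he
  have hz0 : 0 < ‖z‖ := hX0.trans_le hzX
  -- Moving in direction e⁻¹ increases Re(ez) at unit rate. The equation is integrated along this
  -- path from infinity, with (ez)^τ as integrating factor.
  let zs : ℝ → ℂ := fun s => z + s * e⁻¹
  have hzs : ∀ s, e * zs s = e * z + s := fun s => by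
    simp only [zs]; field_simp
  have hre : ∀ s : ℝ, (e * zs s).re = X + s := fun s => by
    rw [hzs, Complex.add_re, Complex.ofReal_re]
  have hw0 : ∀ s : ℝ, 0 ≤ s → e * z + s ≠ 0 := fun s hs h => by
    have := hre s
    rw [hzs, h, Complex.zero_re] at this
    linarith
  -- Decay is measured in Re(ez), but the integrating factor in |z|. The discrepancy (|z|/X)^(Re τ)
  -- does not depend on s and cancels when dividing by |(ez)^τ| at the starting point.
  have hnorm : ∀ s : ℝ, 0 ≤ s → ‖e * z + s‖ ^ τ.re ≤ (‖z‖ / X) ^ τ.re * (X + s) ^ τ.re := by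
    intro s hs
    rw [← Real.mul_rpow (by positivity) (by positivity)]
    refine Real.rpow_le_rpow (norm_nonneg _) ?_ hτ
    have h1 : ‖e * z + s‖ ≤ ‖z‖ + s := by
      refine (norm_add_le _ _).trans (le_of_eq ?_)
      rw [norm_mul, he, one_mul, Complex.norm_real, Real.norm_of_nonneg hs]
    refine h1.trans ?_
    have h2 : ‖z‖ / X * (X + s) = ‖z‖ + ‖z‖ / X * s := by field_simp
    rw [h2]
    have h3 : 1 ≤ ‖z‖ / X := (one_le_div hX0).2 hzX
    nlinarith
  let K := B * E * (‖z‖ / X) ^ τ.re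
  let G : ℝ → ℂ := fun s => (e * z + s) ^ τ * y.1 (zs s)
  let f : ℂ → ℂ := fun z => (BorelReg.hpDeriv e M₀ y).1 z + τ * (z⁻¹ * y.1 z)
  have hG : ∀ s, 0 ≤ s → HasDerivAt G ((e * z + s) ^ τ * e⁻¹ * f (zs s)) s := by
    intro s hs
    have hmem : zs s ∈ halfPlane e M₀ := by
      change M₀ < (e * zs s).re
      rw [hre]; linarith
    have h1 : HasDerivAt (fun c : ℂ => e * z + c) 1 (s : ℂ) := by
      simpa using (hasDerivAt_id (s : ℂ)).const_add (e * z)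
    have h2 := h1.cpow_const (c := τ) (Or.inl (by
      rw [← hzs, hre]; linarith))
    have h3 : HasDerivAt (fun c : ℂ => z + c * e⁻¹) e⁻¹ (s : ℂ) := by
      simpa using ((hasDerivAt_id (s : ℂ)).mul_const e⁻¹).const_add z
    have h4 := HasDerivAt.comp (s : ℂ) (hasDerivAt_holoOn (isOpen_halfPlane e M₀) y hmem) h3
    refine ((h2.mul h4).comp_ofReal).congr_deriv ?_
    have h5 : zs s ≠ 0 := fun h => hw0 s hs (by rw [← hzs, h, mul_zero])
    have h6 : (e * z + s) ^ (τ - 1) = (e * z + s) ^ τ * (e⁻¹ * (zs s)⁻¹) := by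
      rw [Complex.cpow_sub _ _ (hw0 s hs), Complex.cpow_one, ← hzs, div_eq_mul_inv, mul_inv]
    have h7 : z + (s : ℂ) * e⁻¹ = zs s := rfl
    simp only [h6, f, Function.comp_apply, h7]
    ring
  have key := norm_le_of_deriv_le (G := G) (φ := fun s => K * (X + s) ^ (-κ) / κ)
    (φ' := fun s => K * (X + s) ^ (-κ - 1)) hG ?_ ?_ ?_ ?_
  · have h1 := (norm_cpow_le_mul_exp (τ := τ) (hw0 0 le_rfl)).2
    simp only [Complex.ofReal_zero, add_zero] at h1
    have h2 : G 0 = (e * z) ^ τ * y.1 z := by simp [G, zs]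
    rw [h2, norm_mul] at key
    have h3 : ‖e * z‖ = ‖z‖ := by rw [norm_mul, he, one_mul]
    rw [h3] at h1
    have hzτ : 0 < ‖z‖ ^ τ.re := Real.rpow_pos_of_pos hz0 _
    have h4 : ‖z‖ ^ τ.re * ‖y.1 z‖ ≤ E * (K * X ^ (-κ) / κ) := by
      calc ‖z‖ ^ τ.re * ‖y.1 z‖ ≤ (‖(e * z) ^ τ‖ * E) * ‖y.1 z‖ :=
            mul_le_mul_of_nonneg_right h1 (norm_nonneg _)
        _ = E * (‖(e * z) ^ τ‖ * ‖y.1 z‖) := by ring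
        _ ≤ E * (K * X ^ (-κ) / κ) := by
            refine mul_le_mul_of_nonneg_left ?_ hE0.le
            simpa using key
    have h5 : E * (K * X ^ (-κ) / κ) = ‖z‖ ^ τ.re * (E ^ 2 * B / κ * X ^ (-(N + 1))) := by
      have h6 : X ^ (-(N + 1)) = X ^ (-κ) * (X ^ τ.re)⁻¹ := by
        rw [← Real.rpow_neg hX0.le, ← Real.rpow_add hX0]; congr 1; rw [hκ]; ring
      simp only [K]
      rw [Real.div_rpow hz0.le hX0.le, h6]
      field_simp
    rw [h5] at h4
    exact le_of_mul_le_mul_left h4 hzτ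
  · intro s hs
    have h1 : HasDerivAt (fun s : ℝ => X + s) 1 s := by
      simpa using (hasDerivAt_id s).const_add X
    have h2 := h1.rpow_const (p := -κ) (Or.inl (by positivity))
    refine ((h2.const_mul K).div_const κ).congr_deriv ?_
    field_simp
  · intro s hs
    have hXs : 0 < X + s := by linarith
    have h1 := (norm_cpow_le_mul_exp (τ := τ) (hw0 s hs)).1
    have h2 : ‖f (zs s)‖ ≤ B * (X + s) ^ (-(N + 2)) := by
      rw [← hre]
      refine hf (zs s) ?_
      change M₂ < (e * zs s).re
      rw [hre]; linarith
    rw [norm_mul, norm_mul, norm_inv, he, inv_one, mul_one]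
    calc ‖(e * z + s) ^ τ‖ * ‖f (zs s)‖
        ≤ ((‖z‖ / X) ^ τ.re * (X + s) ^ τ.re * E) * (B * (X + s) ^ (-(N + 2))) :=
          mul_le_mul (h1.trans (mul_le_mul_of_nonneg_right (hnorm s hs) hE0.le)) h2
            (norm_nonneg _) (by positivity)
      _ = K * ((X + s) ^ τ.re * (X + s) ^ (-(N + 2))) := by simp only [K]; ring
      _ = K * (X + s) ^ (-κ - 1) := by
          rw [← Real.rpow_add hXs]; congr 2; rw [hκ]; ring
  · intro s hs
    have : 0 < X + s := by linarith
    positivity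
  -- Here N > Re τ is essential: it makes the boundary term (ez)^τ y vanish at infinity and excludes
  -- multiples of the homogeneous solution z^(-τ).
  · have hlim : Tendsto (fun s : ℝ => (‖z‖ / X) ^ τ.re * E * B₁ * (X + s) ^ (-(N - τ.re))) atTop
        (𝓝 0) := by
      have := ((tendsto_rpow_neg_atTop (sub_pos.2 hN)).comp
        (tendsto_atTop_add_const_left atTop X tendsto_id)).const_mul ((‖z‖ / X) ^ τ.re * E * B₁)
      simpa [Function.comp_def] using this
    refine squeeze_zero_norm' ((eventually_ge_atTop 0).mono fun s hs => ?_) hlim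
    have hXs : 0 < X + s := by linarith
    have h1 := (norm_cpow_le_mul_exp (τ := τ) (hw0 s hs)).1
    have h2 : ‖y.1 (zs s)‖ ≤ B₁ * (X + s) ^ (-N) := by
      rw [← hre]
      refine hy (zs s) ?_
      change M₁ < (e * zs s).re
      rw [hre]; linarith
    calc ‖G s‖ = ‖(e * z + s) ^ τ‖ * ‖y.1 (zs s)‖ := norm_mul _ _
      _ ≤ ((‖z‖ / X) ^ τ.re * (X + s) ^ τ.re * E) * (B₁ * (X + s) ^ (-N)) :=
          mul_le_mul (h1.trans (mul_le_mul_of_nonneg_right (hnorm s hs) hE0.le)) h2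
            (norm_nonneg _) (by positivity)
      _ = (‖z‖ / X) ^ τ.re * E * B₁ * ((X + s) ^ τ.re * (X + s) ^ (-N)) := by ring
      _ = _ := by rw [← Real.rpow_add hXs]; congr 2; ring

end HalfPlane

section HalfPlane

variable {e : ℂ} {M₀ : ℝ}

/-- Bounded solutions of `v' + γ v = f` are controlled by `f`, unless `exp (-γ z)` is bounded. -/
theorem DecayOn.of_factor {γ ω : ℂ} (hω : 0 ≤ (e * ω).re)
    (ha : (γ * ω).re < 0) (hω1 : ‖ω‖ = 1) {v : holoOn (halfPlane e M₀)} {M N B C : ℝ}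
    (hM₀ : M₀ ≤ M) (hM : 0 < M) (hN : 0 ≤ N) (hB : 0 ≤ B) (hb : ∀ z ∈ halfPlane e M, ‖v.1 z‖ ≤ C)
    (hf : DecayOn e M N B (hpDeriv e M₀ v + γ • v).1) :
    DecayOn e M N (B / -(γ * ω).re) v.1 := by
  intro z hz
  set a := -(γ * ω).re with hadef
  have ha0 : 0 < a := by linarith
  set X := (e * z).re with hX
  have hMX : M < X := hz
  have hX0 : 0 < X := hM.trans hMX
  let zs : ℝ → ℂ := fun s => z + s * ω
  have hre : ∀ s : ℝ, 0 ≤ s → X ≤ (e * zs s).re := by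
    intro s hs
    have : e * zs s = e * z + s * (e * ω) := by simp only [zs]; ring
    rw [this, Complex.add_re, Complex.re_ofReal_mul]
    nlinarith
  have hexp : ∀ s : ℝ, ‖Complex.exp (γ * ω * s)‖ = Real.exp (-a * s) := by
    intro s
    rw [Complex.norm_exp, Complex.re_mul_ofReal, hadef, neg_neg]
  -- Along direction ω the path stays in the half-plane and the integrating factor e^(γωs) decays.
  -- Boundedness of v thus suffices to kill the term at infinity.
  let G : ℝ → ℂ := fun s => Complex.exp (γ * ω * s) * v.1 (zs s)
  have hG : ∀ s : ℝ, 0 ≤ s → HasDerivAt G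
      (Complex.exp (γ * ω * s) * (ω * (hpDeriv e M₀ v + γ • v).1 (zs s))) s := by
    intro s hs
    have hmem : zs s ∈ halfPlane e M₀ := hM₀.trans_lt (hMX.trans_le (hre s hs))
    have h1 : HasDerivAt (fun c : ℂ => γ * ω * c) (γ * ω) (s : ℂ) := by
      simpa using (hasDerivAt_id (s : ℂ)).const_mul (γ * ω)
    have h3 : HasDerivAt (fun c : ℂ => z + c * ω) ω (s : ℂ) := by
      simpa using ((hasDerivAt_id (s : ℂ)).mul_const ω).const_add z
    have h4 := HasDerivAt.comp (s : ℂ) (hasDerivAt_holoOn (isOpen_halfPlane e M₀) v hmem) h3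
    refine ((h1.cexp.mul h4).comp_ofReal).congr_deriv ?_
    have h7 : z + (s : ℂ) * ω = zs s := rfl
    simp only [Function.comp_apply, h7, Submodule.coe_add, Submodule.coe_smul, Pi.add_apply,
      Pi.smul_apply, smul_eq_mul]
    ring
  have key := norm_le_of_deriv_le (G := G)
    (φ := fun s => B * X ^ (-N) / a * Real.exp (-a * s))
    (φ' := fun s => B * X ^ (-N) * Real.exp (-a * s)) hG ?_ ?_ ?_ ?_
  · have h1 : G 0 = v.1 z := by simp [G, zs]
    rw [h1] at key
    refine key.trans (le_of_eq ?_)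
    simp only [mul_zero, Real.exp_zero, mul_one]
    ring
  · intro s _
    have h1 : HasDerivAt (fun s : ℝ => -a * s) (-a) s := by
      simpa using (hasDerivAt_id s).const_mul (-a)
    refine (h1.exp.const_mul (B * X ^ (-N) / a)).congr_deriv ?_
    field_simp
  · intro s hs
    have h1 := hf (zs s) (hMX.trans_le (hre s hs))
    have h2 : (e * zs s).re ^ (-N) ≤ X ^ (-N) :=
      Real.rpow_le_rpow_of_nonpos hX0 (hre s hs) (by linarith)
    rw [norm_mul, hexp, norm_mul, hω1, one_mul, mul_comm]
    exact mul_le_mul_of_nonneg_right (h1.trans (mul_le_mul_of_nonneg_left h2 hB))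
      (Real.exp_nonneg _)
  · intro s _
    positivity
  · have hlim : Tendsto (fun s : ℝ => Real.exp (-a * s) * C) atTop (𝓝 0) := by
      have h1 : Tendsto (fun s : ℝ => a * s) atTop atTop := tendsto_id.const_mul_atTop ha0
      have := (Real.tendsto_exp_neg_atTop_nhds_zero.comp h1).mul_const C
      simpa [Function.comp_def] using this
    refine squeeze_zero_norm' ((eventually_ge_atTop 0).mono fun s hs => ?_) hlim
    rw [norm_mul, hexp]
    exact mul_le_mul_of_nonneg_left (hb _ (hMX.trans_le (hre s hs))) (Real.exp_nonneg _)

/-- After division by e, one needs a direction of nonnegative real part in which γ/e acquires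
negative real part: ∓i if γ/e is not real, and 1 if it is negative. Only the ray of nonnegative
multiples of e is obstructed. -/
theorem exists_growth_direction (he : ‖e‖ = 1) {γ : ℂ} (hγ : ∀ t : ℝ, 0 ≤ t → γ ≠ t * e) :
    ∃ ω : ℂ, ‖ω‖ = 1 ∧ 0 ≤ (e * ω).re ∧ (γ * ω).re < 0 := by
  have he0 : e ≠ 0 := fun h => by simp [h] at he
  set g := γ / e with hg
  have hγg : γ = g * e := by rw [hg, div_mul_cancel₀ _ he0]
  have h1 : ∀ w : ℂ, ‖w‖ = 1 → 0 ≤ w.re → (g * w).re < 0 →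
      ∃ ω : ℂ, ‖ω‖ = 1 ∧ 0 ≤ (e * ω).re ∧ (γ * ω).re < 0 := by
    intro w hw hw1 hw2
    refine ⟨e⁻¹ * w, by rw [norm_mul, norm_inv, he, hw, inv_one, one_mul], ?_, ?_⟩
    · rwa [mul_inv_cancel_left₀ he0]
    · rwa [hγg, mul_assoc, mul_inv_cancel_left₀ he0]
  rcases lt_trichotomy g.im 0 with him | him | him
  · exact h1 (-Complex.I) (by simp) (by simp) (by simpa using him)
  · refine h1 1 (by simp) (by simp) ?_
    rw [mul_one]
    by_contra! hre
    refine hγ g.re hre ?_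
    rw [hγg]
    congr 1
    exact Complex.ext (by simp) (by simp [him])
  · exact h1 Complex.I (by simp) (by simp) (by simpa using him)

/-- The operator is inverted one linear factor at a time; the top derivative is recovered from the
first-order equation itself. The constant c does not depend on the order N, since each factor is
integrated against an exponential, and this uniformity drives the contraction argument for
uniqueness. -/
theorem exists_const_of_prod (he : ‖e‖ = 1) (M₀ : ℝ) (s : Multiset ℂ)
    (hs : ∀ γ ∈ s, ∀ t : ℝ, 0 ≤ t → γ ≠ t * e) :
    ∃ c : ℝ, 0 ≤ c ∧ ∀ (v : holoOn (halfPlane e M₀)) (M N B : ℝ), M₀ ≤ M → 0 < M → 0 ≤ N →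
      0 ≤ B → (∀ k : ℕ, ∃ C, ∀ z ∈ halfPlane e M, ‖((hpDeriv e M₀ ^ k) v).1 z‖ ≤ C) →
      DecayOn e M N B (Polynomial.aeval (hpDeriv e M₀)
        (s.map fun γ => Polynomial.X + Polynomial.C γ).prod v).1 →
      ∀ k ≤ s.card, DecayOn e M N (c * B) ((hpDeriv e M₀ ^ k) v).1 := by
  induction s using Multiset.induction_on with
  | empty =>
    refine ⟨1, zero_le_one, fun v M N B _ _ _ _ _ h k hk => ?_⟩
    obtain rfl : k = 0 := by simpa using hk
    simpa using h
  | cons γ s ih =>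
    obtain ⟨c, hc, h⟩ := ih fun γ' h' => hs γ' (Multiset.mem_cons_of_mem h')
    obtain ⟨ω, hω1, hω, ha⟩ := exists_growth_direction he (hs γ (Multiset.mem_cons_self γ s))
    set a := -(γ * ω).re with hadef
    have ha0 : 0 < a := by linarith
    refine ⟨c / a + c + ‖γ‖ * (c / a), by positivity, fun v M N B hM₀ hM hN hB hb hdec => ?_⟩
    set w := hpDeriv e M₀ v + γ • v with hw
    have hDw : ∀ k, (hpDeriv e M₀ ^ k) w
        = (hpDeriv e M₀ ^ (k + 1)) v + γ • (hpDeriv e M₀ ^ k) v := by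
      intro k
      rw [hw, map_add, map_smul, pow_succ, Module.End.mul_apply]
    have hbw : ∀ k : ℕ, ∃ C, ∀ z ∈ halfPlane e M, ‖((hpDeriv e M₀ ^ k) w).1 z‖ ≤ C := by
      intro k
      obtain ⟨C₁, h₁⟩ := hb (k + 1)
      obtain ⟨C₂, h₂⟩ := hb k
      refine ⟨C₁ + ‖γ‖ * C₂, fun z hz => ?_⟩
      rw [hDw]
      refine (norm_add_le _ _).trans (add_le_add (h₁ z hz) ?_)
      rw [Submodule.coe_smul, Pi.smul_apply, norm_smul]
      exact mul_le_mul_of_nonneg_left (h₂ z hz) (norm_nonneg _)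
    have hdec' : DecayOn e M N B (Polynomial.aeval (hpDeriv e M₀)
        (s.map fun γ => Polynomial.X + Polynomial.C γ).prod w).1 := by
      rw [Multiset.map_cons, Multiset.prod_cons, mul_comm, map_mul, Module.End.mul_apply, map_add,
        Polynomial.aeval_X, Polynomial.aeval_C] at hdec
      exact hdec
    have hwk := h w M N B hM₀ hM hN hB hbw hdec'
    have hvk : ∀ k ≤ s.card, DecayOn e M N (c * B / a) ((hpDeriv e M₀ ^ k) v).1 := by
      intro k hk
      obtain ⟨C, hC⟩ := hb k
      refine DecayOn.of_factor hω ha hω1 hM₀ hM hN (by positivity) hC ?_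
      have := hwk k hk
      rwa [hDw, pow_succ', Module.End.mul_apply] at this
    have hmono : ∀ {B₁ B₂ : ℝ} {f : ℂ → ℂ}, B₁ ≤ B₂ → DecayOn e M N B₁ f →
        DecayOn e M N B₂ f := fun hle hf z hz =>
      (hf z hz).trans (mul_le_mul_of_nonneg_right hle
        (Real.rpow_nonneg (hM.trans hz).le _))
    intro k hk
    rw [Multiset.card_cons] at hk
    rcases Nat.lt_or_ge s.card k with hlt | hle
    · obtain rfl : k = s.card + 1 := by omega
      have h1 : (hpDeriv e M₀ ^ (s.card + 1)) v
          = (hpDeriv e M₀ ^ s.card) w - γ • (hpDeriv e M₀ ^ s.card) v := by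
        rw [hDw, add_sub_cancel_right]
      intro z hz
      have h2 := hwk _ le_rfl z hz
      have h3 := hvk _ le_rfl z hz
      have hX := Real.rpow_nonneg (hM.trans hz).le (-N)
      rw [h1]
      have h4 : ‖γ * ((hpDeriv e M₀ ^ s.card) v).1 z‖ ≤ ‖γ‖ * (c * B / a * (e * z).re ^ (-N)) := by
        rw [norm_mul]; exact mul_le_mul_of_nonneg_left h3 (norm_nonneg _)
      refine (norm_sub_le _ _).trans ((add_le_add h2 h4).trans ?_)
      have h5 : 0 ≤ c / a * B * (e * z).re ^ (-N) := by positivity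
      have h6 : (c / a + c + ‖γ‖ * (c / a)) * B * (e * z).re ^ (-N)
          = c / a * B * (e * z).re ^ (-N) + (c * B * (e * z).re ^ (-N)
            + ‖γ‖ * (c * B / a * (e * z).re ^ (-N))) := by ring
      linarith
    · refine hmono ?_ (hvk k hle)
      have h5 : 0 ≤ (c + ‖γ‖ * (c / a)) * B := by positivity
      have h6 : (c / a + c + ‖γ‖ * (c / a)) * B = c * B / a + (c + ‖γ‖ * (c / a)) * B := by ring
      linarith

/-- Integration of a decaying derivative. -/
theorem DecayOn.of_hpDeriv (he : ‖e‖ = 1) {v : holoOn (halfPlane e M₀)} {M N N' B B' : ℝ}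
    (hM₀ : M₀ ≤ M) (hM : 0 < M) (hN : 0 < N) (hN' : 0 < N') (hB : 0 ≤ B)
    (hv : DecayOn e M N' B' v.1) (hf : DecayOn e M (N + 1) B (hpDeriv e M₀ v).1) :
    DecayOn e M N (B / N) v.1 := by
  intro z hz
  set X := (e * z).re with hX
  have hMX : M < X := hz
  have hX0 : 0 < X := hM.trans hMX
  have he0 : e ≠ 0 := fun h => by simp [h] at he
  let zs : ℝ → ℂ := fun s => z + s * e⁻¹
  have hre : ∀ s : ℝ, (e * zs s).re = X + s := fun s => by
    have : e * zs s = e * z + s := by simp only [zs]; field_simp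
    rw [this, Complex.add_re, Complex.ofReal_re]
  have hmem : ∀ s, 0 ≤ s → zs s ∈ halfPlane e M := fun s hs => by
    change M < (e * zs s).re
    rw [hre]; linarith
  have key := norm_le_of_deriv_le (G := fun s => v.1 (zs s))
    (G' := fun s => e⁻¹ * (hpDeriv e M₀ v).1 (zs s)) (φ := fun s => B * (X + s) ^ (-N) / N)
    (φ' := fun s => B * (X + s) ^ (-N - 1)) ?_ ?_ ?_ ?_ ?_
  · simp only [zs, Complex.ofReal_zero, zero_mul, add_zero] at key
    refine key.trans (le_of_eq ?_)
    ring
  · intro s hs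
    have h3 : HasDerivAt (fun c : ℂ => z + c * e⁻¹) e⁻¹ (s : ℂ) := by
      simpa using ((hasDerivAt_id (s : ℂ)).mul_const e⁻¹).const_add z
    have h4 := HasDerivAt.comp (s : ℂ)
      (hasDerivAt_holoOn (isOpen_halfPlane e M₀) v (halfPlane_anti hM₀ (hmem s hs))) h3
    refine h4.comp_ofReal.congr_deriv ?_
    exact mul_comm _ _
  · intro s hs
    have h1 : HasDerivAt (fun s : ℝ => X + s) 1 s := by
      simpa using (hasDerivAt_id s).const_add X
    have h2 := h1.rpow_const (p := -N) (Or.inl (by positivity))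
    refine ((h2.const_mul B).div_const N).congr_deriv ?_
    field_simp
  · intro s hs
    have := hf (zs s) (hmem s hs)
    rw [hre, neg_add'] at this
    rwa [norm_mul, norm_inv, he, inv_one, one_mul]
  · intro s hs
    have : 0 < X + s := by linarith
    positivity
  · have hlim : Tendsto (fun s : ℝ => B' * (X + s) ^ (-N')) atTop (𝓝 0) := by
      have := ((tendsto_rpow_neg_atTop hN').comp
        (tendsto_atTop_add_const_left atTop X tendsto_id)).const_mul B'
      simpa [Function.comp_def] using this
    refine squeeze_zero_norm' ((eventually_ge_atTop 0).mono fun s hs => ?_) hlim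
    have := hv (zs s) (hmem s hs)
    rwa [hre] at this

/-- Repeated Cauchy estimates supply the a priori boundedness of derivatives needed to invert the
factors; the shift t is shared out among the steps. -/
theorem exists_bound_hpDeriv_pow (he : ‖e‖ = 1) {v : holoOn (halfPlane e M₀)} {M C : ℝ}
    (hM₀ : M₀ ≤ M) (hv : ∀ z ∈ halfPlane e M, ‖v.1 z‖ ≤ C) (k : ℕ) {t : ℝ} (ht : 0 < t) :
    ∃ C', ∀ z ∈ halfPlane e (M + t), ‖((hpDeriv e M₀ ^ k) v).1 z‖ ≤ C' := by
  induction k generalizing t with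
  | zero => exact ⟨C, fun z hz => hv z (halfPlane_anti (by linarith) hz)⟩
  | succ k ih =>
    obtain ⟨C', hC'⟩ := ih (t := t / 4) (by positivity)
    refine ⟨C' / (t / 2), fun z hz => ?_⟩
    have hz' : M + t < (e * z).re := hz
    rw [pow_succ', Module.End.mul_apply]
    refine norm_hpDeriv_le he _ (by positivity) (by linarith) fun w hw => hC' w ?_
    change M + t / 4 < (e * w).re
    linarith

/-- A solution of the equation on a half-plane that decays slightly faster than the expected
order `τ` vanishes on a distant half-plane. -/
theorem exists_eq_zero_of_decay (he : ‖e‖ = 1) {p q : Polynomial ℂ} {τ : ℂ} {s : ℂ → ℂ}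
    {S M₁ N₀ : ℝ} {y : holoOn (halfPlane e M₀)} (hp : p.Monic)
    (hroots : ∀ γ, p.IsRoot (-γ) → ∀ t : ℝ, 0 ≤ t → γ ≠ t * e) (hdeg : q.natDegree = p.natDegree)
    (hτ : q.eval 0 = τ * p.eval 0) (hτ0 : 0 ≤ τ.re) (hN₀ : τ.re < N₀)
    (hs : ∀ z ∈ halfPlane e M₁, ‖s z‖ ≤ S) (hy : Decay e N₀ y.1)
    (heq : ∀ z ∈ halfPlane e M₀, (Polynomial.aeval (hpDeriv e M₀) p (hpDeriv e M₀ y)).1 z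
      + z⁻¹ * (Polynomial.aeval (hpDeriv e M₀) q y).1 z + z⁻¹ ^ 2 * s z * y.1 z = 0) :
    ∃ M, ∀ z ∈ halfPlane e M, y.1 z = 0 := by
  set D := hpDeriv e M₀ with hD
  have hp0 : p.eval 0 ≠ 0 := by
    intro h
    exact hroots 0 (by simpa [Polynomial.IsRoot] using h) 0 le_rfl (by simp)
  have hpos : 0 < N₀ := hτ0.trans_lt hN₀
  -- By q(0) = τ p(0), the constant coefficients of p and q combine to p(0)(y' + τ y/z). All
  -- remaining terms carry an extra derivative or an extra z⁻¹ and decay with order N + 2.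
  have hstep : ∀ N, τ.re < N → Decay e N y.1 → Decay e (N + 1) y.1 := by
    intro N hN hyN
    have hN0 : 0 ≤ N := hτ0.trans hN.le
    refine Decay.of_leading he hτ0 hN hyN ?_
    have d1 := hyN.hpDeriv he hN0
    have d2 := (d1.hpDeriv he (by linarith)).aeval he (by linarith) p.divX
    have d3 := ((d1.aeval he (by linarith) q.divX)).inv_mul he
    have d4 := ((hyN.bdd_mul hs).inv_mul he).inv_mul he
    have e2 : N + 1 + 1 = N + 2 := by ring
    rw [e2] at d2 d3 d4
    refine (((d2.add d3).add d4).const_mul (-(p.eval 0)⁻¹)).congr (M₀ := M₀) fun z hz => ?_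
    have h1 := heq z hz
    rw [aeval_eq_divX D p, aeval_eq_divX D q, hτ] at h1
    simp only [Submodule.coe_add, Submodule.coe_smul, Pi.add_apply, Pi.smul_apply,
      smul_eq_mul] at h1
    rw [← hD]
    generalize p.eval 0 = p0 at *
    field_simp
    linear_combination -h1
  have hall : ∀ n : ℕ, Decay e (N₀ + n) y.1 := by
    intro n
    induction n with
    | zero => simpa using hy
    | succ n ih =>
      have := hstep (N₀ + n) (by linarith [(n.cast_nonneg : (0 : ℝ) ≤ n)]) ih
      rw [add_assoc] at this
      exact_mod_cast this
  have hsplit : p.Splits := IsAlgClosed.splits p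
  have hprod : ((p.roots.map fun r => -r).map fun γ => Polynomial.X + Polynomial.C γ).prod = p := by
    rw [Multiset.map_map]
    conv_rhs => rw [hsplit.eq_prod_roots_of_monic hp]
    simp [sub_eq_add_neg]
  obtain ⟨c, hc, hconst⟩ := exists_const_of_prod he M₀ (p.roots.map fun r => -r) (by
    intro γ hγ
    obtain ⟨r, hr, rfl⟩ := Multiset.mem_map.1 hγ
    exact hroots _ (by simpa using Polynomial.isRoot_of_mem_roots hr))
  rw [hprod, Multiset.card_map, ← hsplit.natDegree_eq_card_roots] at hconst
  set L := ∑ k ∈ Finset.range (p.natDegree + 1), ‖q.divX.coeff k‖ with hL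
  have hL0 : 0 ≤ L := Finset.sum_nonneg fun _ _ => norm_nonneg _
  -- A large order N makes the terms in y small, because integrating D y divides by N. The bound 4Lc
  -- on the abscissa, chosen below, makes the terms in derivatives of y small. Each contributes at
  -- most 1/4.
  obtain ⟨n, hn⟩ := exists_nat_ge (4 * (‖q.eval 0‖ * c + |S| * c))
  set N := N₀ + n with hN
  have hN0 : 0 < N := by positivity
  obtain ⟨Ma, Ba, hMa, hBa, hya⟩ := hall n
  obtain ⟨Mb, Bb, hMb, hBb, hpb⟩ := ((hall n).hpDeriv he hN0.le).aeval he (by linarith) p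
  set Mc := max Ma M₀ with hMc
  set M := max (max (Mc + 1) Mb) (max M₁ (4 * (L * c))) with hM
  have i1 : Mc + 1 ≤ M := (le_max_left _ _).trans (le_max_left _ _)
  have i2 : Mb ≤ M := (le_max_right _ _).trans (le_max_left _ _)
  have i3 : M₁ ≤ M := (le_max_left _ _).trans (le_max_right _ _)
  have i4 : 4 * (L * c) ≤ M := (le_max_right _ _).trans (le_max_right _ _)
  have i5 : Ma ≤ Mc := le_max_left _ _
  have i6 : M₀ ≤ Mc := le_max_right _ _
  have hM1 : 1 ≤ M := hMb.trans i2
  have hbd : ∀ k : ℕ, ∃ C, ∀ z ∈ halfPlane e M, ‖((D ^ k) (D y)).1 z‖ ≤ C := by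
    intro k
    obtain ⟨C, hC⟩ := exists_bound_hpDeriv_pow he (v := y) (M := Mc) (C := Ba) i6 (fun z hz => by
      refine (hya z (halfPlane_anti i5 hz)).trans ?_
      have hz1 : Mc < (e * z).re := hz
      exact mul_le_of_le_one_right hBa
        (Real.rpow_le_one_of_one_le_of_nonpos (by linarith) (by linarith))) (k + 1) one_pos
    refine ⟨C, fun z hz => ?_⟩
    have := hC z (halfPlane_anti i1 hz)
    rwa [pow_succ, Module.End.mul_apply] at this
  -- A bound B on p(D) D y controls D y with its derivatives, and y; the equation then returns the
  -- bound B/2 for p(D) D y. Iterating sends the bound to zero.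
  have hhalf : ∀ B, 0 ≤ B → DecayOn e M (N + 1) B (Polynomial.aeval D p (D y)).1 →
      DecayOn e M N (c * B / N) y.1 ∧
        DecayOn e M (N + 1) (B / 2) (Polynomial.aeval D p (D y)).1 := by
    intro B hB hdec
    have hk := hconst (D y) M (N + 1) B (by linarith) (by linarith) (by linarith) hB hbd hdec
    have hyN : DecayOn e M N (c * B / N) y.1 :=
      DecayOn.of_hpDeriv he (by linarith) (by linarith) hN0 hN0 (by positivity)
        (hya.anti (by linarith)) (by simpa using hk 0 (Nat.zero_le _))
    refine ⟨hyN, fun z hz => ?_⟩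
    have hX : M < (e * z).re := hz
    set X := (e * z).re with hXdef
    have hX0 : 0 < X := by linarith
    have h1 := heq z (halfPlane_anti (by linarith) hz)
    rw [aeval_eq_divX D q] at h1
    simp only [Submodule.coe_add, Submodule.coe_smul, Pi.add_apply, Pi.smul_apply,
      smul_eq_mul] at h1
    have h2 : (Polynomial.aeval D p (D y)).1 z = -(z⁻¹ * ((Polynomial.aeval D q.divX (D y)).1 z
        + q.eval 0 * y.1 z)) - z⁻¹ ^ 2 * s z * y.1 z := by linear_combination h1
    have hq : ‖(Polynomial.aeval D q.divX (D y)).1 z‖ ≤ L * (c * B * X ^ (-(N + 1))) := by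
      have hd : q.divX.natDegree < p.natDegree + 1 := by
        rw [Polynomial.natDegree_divX_eq_natDegree_tsub_one, hdeg]; omega
      rw [Polynomial.aeval_eq_sum_range' hd, hL, Finset.sum_mul]
      simp only [LinearMap.sum_apply, Submodule.coe_sum, Finset.sum_apply, LinearMap.smul_apply,
        Submodule.coe_smul, Pi.smul_apply]
      refine norm_sum_le_of_le _ fun k hk' => ?_
      rw [norm_smul]
      exact mul_le_mul_of_nonneg_left
        (hk k (Nat.lt_succ_iff.1 (Finset.mem_range.1 hk')) z hz) (norm_nonneg _)
    have hyz := hyN z hz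
    rw [← hXdef] at hyz
    have hzinv : ‖z⁻¹‖ ≤ X⁻¹ := by
      rw [norm_inv]; exact inv_anti₀ hX0 (re_mul_le_norm he)
    have hsz : ‖s z‖ ≤ |S| := (hs z (halfPlane_anti i3 hz)).trans (le_abs_self S)
    have hXN : X ^ (-(N + 1)) = X⁻¹ * X ^ (-N) := by
      rw [neg_add, Real.rpow_add hX0, Real.rpow_neg_one]; ring
    have hXinv : X⁻¹ ≤ 1 := inv_le_one_of_one_le₀ (by linarith)
    have hXinv0 : 0 < X⁻¹ := inv_pos.2 hX0
    have t1 : ‖z⁻¹ * ((Polynomial.aeval D q.divX (D y)).1 z + q.eval 0 * y.1 z)‖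
        ≤ X⁻¹ * (L * (c * B * X ^ (-(N + 1))) + ‖q.eval 0‖ * (c * B / N * X ^ (-N))) := by
      rw [norm_mul]
      refine mul_le_mul hzinv ((norm_add_le _ _).trans (add_le_add hq ?_)) (norm_nonneg _)
        hXinv0.le
      rw [norm_mul]
      exact mul_le_mul_of_nonneg_left hyz (norm_nonneg _)
    have t2 : ‖z⁻¹ ^ 2 * s z * y.1 z‖ ≤ X⁻¹ * |S| * (c * B / N * X ^ (-N)) := by
      rw [norm_mul, norm_mul, norm_pow]
      have : ‖z⁻¹‖ ^ 2 ≤ X⁻¹ := by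
        have h3 := norm_nonneg z⁻¹
        nlinarith
      exact mul_le_mul (mul_le_mul this hsz (norm_nonneg _) hXinv0.le) hyz (norm_nonneg _)
        (by positivity)
    rw [h2]
    refine (norm_sub_le _ _).trans ?_
    rw [norm_neg]
    refine (add_le_add t1 t2).trans ?_
    have hLX : L * c * X⁻¹ ≤ 1 / 4 := by
      rw [← div_eq_mul_inv, div_le_iff₀ hX0]; linarith
    have hSN : (‖q.eval 0‖ * c + |S| * c) / N ≤ 1 / 4 := by
      rw [div_le_iff₀ hN0]; linarith
    have hT : 0 ≤ B * X ^ (-(N + 1)) := mul_nonneg hB (Real.rpow_nonneg hX0.le _)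
    have e1 : X⁻¹ * (L * (c * B * X ^ (-(N + 1))) + ‖q.eval 0‖ * (c * B / N * X ^ (-N)))
        + X⁻¹ * |S| * (c * B / N * X ^ (-N))
        = (L * c * X⁻¹ + (‖q.eval 0‖ * c + |S| * c) / N) * (B * X ^ (-(N + 1))) := by
      rw [hXN]; ring
    rw [e1]
    have e2 : B / 2 * X ^ (-(N + 1)) = (1 / 4 + 1 / 4) * (B * X ^ (-(N + 1))) := by ring
    rw [e2]
    exact mul_le_mul_of_nonneg_right (add_le_add hLX hSN) hT
  have hiter : ∀ n : ℕ, DecayOn e M (N + 1) (Bb * (1 / 2) ^ n) (Polynomial.aeval D p (D y)).1 := by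
    intro n
    induction n with
    | zero => simpa using hpb.anti i2
    | succ n ih =>
      have := (hhalf _ (by positivity) ih).2
      rw [pow_succ, ← mul_assoc, mul_one_div]
      exact this
  refine ⟨M, fun z hz => ?_⟩
  have hX0 : 0 < (e * z).re := by linarith [show M < (e * z).re from hz]
  have hlim : Tendsto (fun n : ℕ => c * (Bb * (1 / 2 : ℝ) ^ n) / N * (e * z).re ^ (-N)) atTop
      (𝓝 0) := by
    have := ((((tendsto_pow_atTop_nhds_zero_of_lt_one (r := (1 / 2 : ℝ)) (by norm_num)
      (by norm_num)).const_mul Bb).const_mul c).div_const N).mul_const ((e * z).re ^ (-N))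
    simpa using this
  have hle : ‖y.1 z‖ ≤ 0 := ge_of_tendsto' hlim fun n =>
    (hhalf _ (by positivity) (hiter n)).1 z hz
  exact norm_le_zero_iff.1 hle

end HalfPlane

/-! ### The solution on the dual domain and its asymptotic expansion -/

/-- The function whose Laplace transform along the ray in direction `θ` is that of
`ζ ^ (σ - 1) * h ζ`. -/
noncomputable def rayDensity (σ : ℂ) (h : ℂ → ℂ) (θ t : ℝ) : ℂ :=
  Complex.exp (θ * Complex.I * σ) * (t : ℂ) ^ (σ - 1) * h (t * Complex.exp (θ * Complex.I))

/-- The iterated difference quotients at the origin. -/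
noncomputable def iterQuot (g : ℂ → ℂ) (n : ℕ) : ℂ → ℂ :=
  (Function.swap dslope (0 : ℂ))^[n] g

theorem iterQuot_succ (g : ℂ → ℂ) (n : ℕ) : iterQuot g (n + 1) = dslope (iterQuot g n) 0 :=
  Function.iterate_succ_apply' _ _ _

theorem ray_mem_sector {μ δ θ : ℝ} (hθ : |θ - μ| < δ) {t : ℝ} (ht : 0 < t) :
    t * Complex.exp (θ * Complex.I) ∈ sector 0 μ δ :=
  ⟨θ, t, hθ, ht, by simp [rayPoint]⟩

section Ray

variable {D : Set ℂ} {Λ : ℝ} {σ : ℂ} {g h : ℂ → ℂ} {μ δ θ : ℝ}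

theorem hasAbscissa_rayDensity (hσ : 0 < σ.re) (hh : ExpBdd D Λ h)
    (hw : ∀ t : ℝ, 0 < t → t * Complex.exp (θ * Complex.I) ∈ D) :
    HasAbscissa Λ (rayDensity σ h θ) := by
  obtain ⟨C, hC⟩ := hh.bound
  refine hasAbscissa_of_bound (C := Real.exp (θ * Complex.I * σ).re * C) hσ ?_ fun t ht => ?_
  · refine (rayIntegrand_aestronglyMeasurable (σ := σ) (z := 0) hh.holo.continuousOn hw).congr
      (Eventually.of_forall fun t => ?_)
    simp only [rayIntegrand, rayDensity, zero_mul, neg_zero, Complex.exp_zero, one_mul]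
    ring
  · have h1 := hC _ (hw t ht)
    rw [norm_mul, Complex.norm_exp_ofReal_mul_I, mul_one, Complex.norm_real, Real.norm_eq_abs,
      abs_of_pos ht] at h1
    rw [rayDensity, norm_mul, norm_mul, Complex.norm_exp,
      Complex.norm_cpow_eq_rpow_re_of_pos ht, Complex.sub_re, Complex.one_re]
    have h2 : 0 ≤ Real.exp (θ * Complex.I * σ).re * t ^ (σ.re - 1) := by positivity
    calc _ ≤ Real.exp (θ * Complex.I * σ).re * t ^ (σ.re - 1) * (C * Real.exp (Λ * t)) :=
          mul_le_mul_of_nonneg_left h1 h2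
      _ = _ := by ring

theorem exp_mul_rayLaplace (α σ : ℂ) (h : ℂ → ℂ) (z : ℂ) (θ : ℝ) :
    Complex.exp (-α * z) * rayLaplace σ h z (θ * Complex.I)
      = expLaplace α (Complex.exp (θ * Complex.I)) (rayDensity σ h θ) z := by
  rw [rayLaplace, expLaplace, ← integral_const_mul]
  refine integral_congr_ae (Eventually.of_forall fun t => ?_)
  simp only [rayIntegrand, rayDensity]
  rw [mul_add, neg_add, Complex.exp_add, show -α * z = -(z * α) by ring]
  ring

theorem differentiableAt_rayLaplace_left (hσ : 0 < σ.re) (hh : ExpBdd D Λ h)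
    (hw : ∀ t : ℝ, 0 < t → t * Complex.exp (θ * Complex.I) ∈ D) {z : ℂ}
    (hz : Λ < (z * Complex.exp (θ * Complex.I)).re) :
    DifferentiableAt ℂ (fun z => rayLaplace σ h z (θ * Complex.I)) z := by
  have h1 : (fun z => rayLaplace σ h z (θ * Complex.I))
      = expLaplace 0 (Complex.exp (θ * Complex.I)) (rayDensity σ h θ) := by
    funext z
    rw [← exp_mul_rayLaplace]
    simp
  rw [h1]
  exact (hasDerivAt_expLaplace (hasAbscissa_rayDensity hσ hh hw)
    (Complex.norm_exp_ofReal_mul_I θ) hz).differentiableAt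

theorem iterQuot_expBdd (hD : IsOpen D) (h0 : (0 : ℂ) ∈ D) (hΛ : 0 ≤ Λ) (hg : ExpBdd D Λ g)
    (n : ℕ) : ExpBdd D Λ (iterQuot g n) := by
  induction n with
  | zero => exact hg
  | succ n ih => rw [iterQuot_succ]; exact ih.exists_eq_mul hD h0 hΛ

theorem rayLaplace_eq_add (hD : IsOpen D) (h0 : (0 : ℂ) ∈ D) (hΛ : 0 ≤ Λ) (hσ : 0 < σ.re)
    (hg : ExpBdd D Λ g) (hw : ∀ t : ℝ, 0 < t → t * Complex.exp (θ * Complex.I) ∈ D) {r φ : ℝ}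
    (hr : 0 < r) (hφ : |φ - θ| < Real.pi / 2)
    (hz : Λ < (r * Complex.exp (-(φ * Complex.I)) * Complex.exp (θ * Complex.I)).re) :
    rayLaplace σ g (r * Complex.exp (-(φ * Complex.I))) (θ * Complex.I)
      = g 0 * (Complex.Gamma σ * Complex.exp (-σ * (Real.log r - φ * Complex.I)))
        + rayLaplace (σ + 1) (dslope g 0) (r * Complex.exp (-(φ * Complex.I)))
          (θ * Complex.I) := by
  rw [← rayLaplace_one hσ hr hφ]
  have hre : Λ * Real.exp (θ * Complex.I).re
      < (r * Complex.exp (-(φ * Complex.I)) * Complex.exp (θ * Complex.I)).re := by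
    simpa using hz
  have i1 := rayIntegrand_integrable hσ (ExpBdd.const (D := D) hΛ 1) hw hre
  have hσ1 : 0 < (σ + 1).re := by rw [Complex.add_re, Complex.one_re]; linarith
  have i2 := rayIntegrand_integrable hσ1 (hg.exists_eq_mul hD h0 hΛ) hw hre
  rw [rayLaplace, rayLaplace, rayLaplace, ← integral_const_mul,
    ← integral_add (i1.const_mul (g 0)) i2]
  refine setIntegral_congr_fun measurableSet_Ioi fun t ht => ?_
  have ht0 : (t : ℂ) ≠ 0 := by exact_mod_cast (mem_Ioi.1 ht).ne'
  simp only [rayIntegrand]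
  have e1 : (t : ℂ) ^ (σ + 1 - 1) = t ^ (σ - 1) * t := by
    rw [add_sub_right_comm, Complex.cpow_add _ _ ht0, Complex.cpow_one]
  rw [e1, mul_add (θ * Complex.I) σ 1, Complex.exp_add, mul_one,
    eq_add_mul_dslope g (t * Complex.exp (θ * Complex.I))]
  ring_nf

/-- Iterating g = g(0) + ζ g₁ moves one power of ζ at a time into the exponent. Each split-off
constant has an exact Laplace transform, and the remainder is again a Laplace integral, with
exponent σ + n. -/
theorem rayLaplace_eq_sum (hD : IsOpen D) (h0 : (0 : ℂ) ∈ D) (hΛ : 0 ≤ Λ) (hσ : 0 < σ.re)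
    (hg : ExpBdd D Λ g) (hw : ∀ t : ℝ, 0 < t → t * Complex.exp (θ * Complex.I) ∈ D) {r φ : ℝ}
    (hr : 0 < r) (hφ : |φ - θ| < Real.pi / 2)
    (hz : Λ < (r * Complex.exp (-(φ * Complex.I)) * Complex.exp (θ * Complex.I)).re) (n : ℕ) :
    rayLaplace σ g (r * Complex.exp (-(φ * Complex.I))) (θ * Complex.I)
      = Complex.exp (-σ * (Real.log r - φ * Complex.I)) * (∑ k ∈ Finset.range n,
          Complex.Gamma (σ + k) * iterQuot g k 0 * (r * Complex.exp (-(φ * Complex.I)))⁻¹ ^ k)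
        + rayLaplace (σ + n) (iterQuot g n) (r * Complex.exp (-(φ * Complex.I)))
          (θ * Complex.I) := by
  induction n with
  | zero => simp [iterQuot]
  | succ n ih =>
    have hσn : 0 < (σ + n).re := by
      rw [Complex.add_re, Complex.natCast_re]; positivity
    rw [ih, rayLaplace_eq_add hD h0 hΛ hσn (iterQuot_expBdd hD h0 hΛ hg n) hw hr hφ hz,
      Finset.sum_range_succ, ← iterQuot_succ]
    have e1 : Complex.exp (-(σ + n) * (Real.log r - φ * Complex.I))
        = Complex.exp (-σ * (Real.log r - φ * Complex.I)) *
          (r * Complex.exp (-(φ * Complex.I)))⁻¹ ^ n := by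
      have h2 : (r * Complex.exp (-(φ * Complex.I)) : ℂ)
          = Complex.exp (Real.log r - φ * Complex.I) := by
        rw [sub_eq_add_neg, Complex.exp_add, ← Complex.ofReal_exp, Real.exp_log hr]
      rw [h2, ← Complex.exp_neg, ← Complex.exp_nat_mul, ← Complex.exp_add]
      congr 1
      ring
    rw [e1]
    push_cast
    rw [add_assoc σ (n : ℂ) 1]
    ring

/-- The Laplace transform of `ζ ^ (σ - 1) * h ζ` along any ray of the sector on whose half-plane
the point lies. -/
noncomputable def sectorLaplace (μ δ Λ : ℝ) (σ : ℂ) (h : ℂ → ℂ) (z : ℂ) : ℂ :=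
  open scoped Classical in
  if H : z ∈ dualDomain μ δ Λ then rayLaplace σ h z (H.choose * Complex.I) else 0

theorem sectorLaplace_eq (hΛ : 0 ≤ Λ) (hδπ : δ ≤ Real.pi / 2) (hσ : 0 < σ.re)
    (hD : sector 0 μ δ ⊆ D) (hh : ExpBdd D Λ h) (hθ : |θ - μ| < δ) {z : ℂ}
    (hz : Λ < (Complex.exp (θ * Complex.I) * z).re) :
    sectorLaplace μ δ Λ σ h z = rayLaplace σ h z (θ * Complex.I) := by
  have H : z ∈ dualDomain μ δ Λ := ⟨θ, hθ, hz⟩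
  rw [sectorLaplace, dif_pos H]
  have h1 := H.choose_spec
  refine rayLaplace_eq hΛ hδπ hσ hD hh h1.1 hθ ?_ ?_
  · rw [mul_comm]; exact h1.2
  · rwa [mul_comm]

theorem eventually_sectorLaplace_eq (hΛ : 0 ≤ Λ) (hδπ : δ ≤ Real.pi / 2) (hσ : 0 < σ.re)
    (hD : sector 0 μ δ ⊆ D) (hh : ExpBdd D Λ h) (hθ : |θ - μ| < δ) {z : ℂ}
    (hz : Λ < (Complex.exp (θ * Complex.I) * z).re) :
    sectorLaplace μ δ Λ σ h =ᶠ[𝓝 z] fun z => rayLaplace σ h z (θ * Complex.I) := by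
  filter_upwards [(isOpen_halfPlane (Complex.exp (θ * Complex.I)) Λ).mem_nhds hz] with w hw
  exact sectorLaplace_eq hΛ hδπ hσ hD hh hθ hw

/-- Watson's estimate is applied in a direction, depending on z, whose half-plane realises the
boundary distance up to the factor two. The constant is uniform because the directions stay bounded.
-/
theorem memDualSpace_sectorLaplace (hΛ : 0 ≤ Λ) (hδ : 0 < δ) (hδπ : δ ≤ Real.pi / 2)
    (hσ : 0 < σ.re) (hD : sector 0 μ δ ⊆ D) (hh : ExpBdd D Λ h) :
    MemDualSpace μ δ Λ (-σ.re) (sectorLaplace μ δ Λ σ h) := by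
  constructor
  · rintro z ⟨θ, hθ, hz⟩
    refine DifferentiableAt.differentiableWithinAt ?_
    refine (eventually_sectorLaplace_eq hΛ hδπ hσ hD hh hθ hz).differentiableAt_iff.2 ?_
    exact differentiableAt_rayLaplace_left hσ hh (fun t ht => hD (ray_mem_sector hθ ht))
      (by rwa [mul_comm])
  · obtain ⟨C, hC⟩ := hh.bound
    refine ⟨Real.exp ((|μ| + δ) * |σ.im|) * |C| * Real.Gamma σ.re * (1 / 2) ^ (-σ.re),
      fun z hz => ?_⟩
    obtain ⟨θ, hθ, hzθ, hle⟩ := exists_infDist_frontier_le hΛ hδ hδπ hz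
    have hpos := infDist_frontier_pos hΛ hz
    set Δ := infDist z (frontier (dualDomain μ δ Λ))
    rw [sectorLaplace_eq hΛ hδπ hσ hD hh hθ hzθ]
    have hre : (θ * Complex.I : ℂ).re = 0 := by simp
    have h1 := norm_rayLaplace_le (σ := σ) (z := z) (w := θ * Complex.I) hσ (C := |C|)
      (fun ζ hζ => (hC ζ hζ).trans
        (mul_le_mul_of_nonneg_right (le_abs_self C) (Real.exp_nonneg _)))
      (fun t ht => hD (ray_mem_sector hθ ht)) (by
        rw [hre, Real.exp_zero, mul_one, mul_comm z]; exact hzθ)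
    rw [hre, Real.exp_zero, mul_one, mul_comm z] at h1
    refine h1.trans ?_
    have h2 : ((Complex.exp (θ * Complex.I) * z).re - Λ) ^ (-σ.re)
        ≤ (1 / 2) ^ (-σ.re) * Δ ^ (-σ.re) := by
      rw [← Real.mul_rpow (by norm_num) hpos.le]
      exact Real.rpow_le_rpow_of_nonpos (by linarith) (by linarith) (by linarith)
    have h3 : Real.exp (θ * Complex.I * σ).re ≤ Real.exp ((|μ| + δ) * |σ.im|) := by
      refine Real.exp_le_exp.2 ?_
      have : (θ * Complex.I * σ).re = -(θ * σ.im) := by simp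
      rw [this]
      refine (neg_le_abs _).trans ?_
      rw [abs_mul]
      refine mul_le_mul_of_nonneg_right ?_ (abs_nonneg _)
      have := abs_sub_abs_le_abs_sub θ μ
      linarith
    have hG := (Real.Gamma_pos_of_pos hσ).le
    calc _ ≤ Real.exp ((|μ| + δ) * |σ.im|) * |C| * Real.Gamma σ.re *
          ((1 / 2) ^ (-σ.re) * Δ ^ (-σ.re)) := by gcongr
      _ = _ := by ring

theorem branchPow_rayPoint {r : ℝ} (hr : 0 < r) (φ : ℝ) (s : ℂ) :
    branchPow φ (rayPoint 0 φ r) s = Complex.exp (s * (Real.log r + φ * Complex.I)) := by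
  rw [branchPow, rayPoint, zero_add, mul_assoc, ← Complex.exp_add, add_neg_cancel,
    Complex.exp_zero, mul_one, Complex.ofReal_log hr.le]

theorem branchPow_polar {r φ ν : ℝ} (hr : 0 < r) (hφ : |φ - ν| < Real.pi) (s : ℂ) :
    branchPow (-ν) (r * Complex.exp (-(φ * Complex.I))) s
      = Complex.exp (s * (Real.log r - φ * Complex.I)) := by
  have h1 : (r * Complex.exp (-(φ * Complex.I)) * Complex.exp (-(((-ν : ℝ) : ℂ) * Complex.I)) : ℂ)
      = Complex.exp (Real.log r + (((ν - φ : ℝ) : ℂ)) * Complex.I) := by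
    rw [mul_assoc, ← Complex.exp_add, Complex.exp_add (Real.log r : ℂ), ← Complex.ofReal_exp, Real.exp_log hr]
    congr 2
    push_cast
    ring
  rw [abs_lt] at hφ
  rw [branchPow, h1, Complex.log_exp]
  · congr 2
    push_cast
    ring
  · simp; linarith
  · simp; linarith

/-- The remainder has exponent σ + 1, which gives exactly the order -Re τ - 1 demanded of a
distinguished solution. The branches of the powers agree because arguments in the dual domain differ
from -μ by less than δ + π/2 ≤ π. -/
theorem sectorLaplace_eq_add (hΛ : 0 ≤ Λ) (hδπ : δ ≤ Real.pi / 2) (hσ : 0 < σ.re)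
    (hD : sector 0 μ δ ⊆ D) (hDo : IsOpen D) (h0 : (0 : ℂ) ∈ D) (hg : ExpBdd D Λ g) {z : ℂ}
    (hz : z ∈ dualDomain μ δ Λ) :
    sectorLaplace μ δ Λ σ g z = g 0 * Complex.Gamma σ * branchPow (-μ) z (-σ)
      + sectorLaplace μ δ Λ (σ + 1) (dslope g 0) z := by
  obtain ⟨θ, hθ, hzθ⟩ := hz
  obtain ⟨r, φ, hr, hφ, rfl⟩ := exists_polar (hΛ.trans_lt hzθ)
  have hσ1 : 0 < (σ + 1).re := by rw [Complex.add_re, Complex.one_re]; linarith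
  rw [sectorLaplace_eq hΛ hδπ hσ hD hg hθ hzθ,
    sectorLaplace_eq hΛ hδπ hσ1 hD (hg.exists_eq_mul hDo h0 hΛ) hθ hzθ,
    rayLaplace_eq_add hDo h0 hΛ hσ hg (fun t ht => hD (ray_mem_sector hθ ht)) hr hφ
      (by rwa [mul_comm]), branchPow_polar hr ?_, mul_assoc]
  calc |φ - μ| ≤ |φ - θ| + |θ - μ| := abs_sub_le _ _ _
    _ < Real.pi := by linarith

/-- The deviation φ + μ is divided in proportion δ : π/2 between the opening of the sector and the
half-plane of a single ray. -/
theorem exists_angle {φ : ℝ} (hδ : 0 < δ) (hφ : |φ + μ| < δ + Real.pi / 2) :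
    ∃ θ, |θ - μ| < δ ∧ |φ + θ| < Real.pi / 2 := by
  have hπ := Real.pi_pos
  set c := δ / (δ + Real.pi / 2) with hc
  have hs : 0 < δ + Real.pi / 2 := by positivity
  refine ⟨μ - c * (φ + μ), ?_, ?_⟩
  · rw [sub_sub_cancel_left, abs_neg, abs_mul, abs_of_pos (by positivity), hc, div_mul_eq_mul_div,
      div_lt_iff₀ hs]
    exact mul_lt_mul_of_pos_left hφ hδ
  · have h1 : φ + (μ - c * (φ + μ)) = (Real.pi / 2) / (δ + Real.pi / 2) * (φ + μ) := by
      rw [hc]; field_simp; ring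
    rw [h1, abs_mul, abs_of_pos (by positivity), div_mul_eq_mul_div, div_lt_iff₀ hs]
    exact mul_lt_mul_of_pos_left hφ (by positivity)

theorem isAsymptoticAlong_sectorLaplace (hΛ : 0 ≤ Λ) (hδ : 0 < δ) (hδπ : δ ≤ Real.pi / 2)
    (hσ : 0 < σ.re) (hD : sector 0 μ δ ⊆ D) (hDo : IsOpen D) (h0 : (0 : ℂ) ∈ D)
    (hg : ExpBdd D Λ g) {F : PowerSeries ℂ} {Ψ : ℂ → ℂ} {α : ℂ}
    (hF : ∀ n, PowerSeries.coeff n F = Complex.Gamma (σ + n) * iterQuot g n 0)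
    (hΨ : ∀ z ∈ dualDomain μ δ Λ, Ψ z = Complex.exp (-α * z) * sectorLaplace μ δ Λ σ g z) {φ : ℝ}
    (hφ : |φ + μ| < δ + Real.pi / 2) : IsAsymptoticAlong α σ F Ψ φ := by
  intro n
  obtain ⟨θ, hθ, hφθ⟩ := exists_angle hδ hφ
  have hray : ∀ t : ℝ, 0 < t → t * Complex.exp (θ * Complex.I) ∈ D := fun t ht =>
    hD (ray_mem_sector hθ ht)
  obtain ⟨C, hC⟩ := (iterQuot_expBdd hDo h0 hΛ hg (n + 1)).bound
  set c := Real.cos (φ + θ) with hc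
  have hc0 : 0 < c := Real.cos_pos_of_mem_Ioo (abs_lt.1 hφθ)
  set s := (σ + (n + 1 : ℕ)).re with hs
  have hs' : s = σ.re + n + 1 := by simp [hs, add_assoc]
  have hs0 : 0 < s := by rw [hs']; positivity
  have hC' : ∀ ζ ∈ D, ‖iterQuot g (n + 1) ζ‖ ≤ |C| * Real.exp (Λ * ‖ζ‖) := fun ζ hζ =>
    (hC ζ hζ).trans (mul_le_mul_of_nonneg_right (le_abs_self C) (Real.exp_nonneg _))
  have hpt : ∀ r : ℝ, rayPoint 0 φ r = r * Complex.exp (-(((-φ : ℝ) : ℂ) * Complex.I)) := by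
    intro r; simp [rayPoint]
  set K := Real.exp (θ * Complex.I * (σ + (n + 1 : ℕ))).re * |C| * Real.Gamma s *
    (c / 2) ^ (-s) with hK
  have hK0 : 0 ≤ K := by
    have := (Real.Gamma_pos_of_pos hs0).le
    positivity
  -- After n + 1 terms the remainder has exponent σ + n + 1, so it is O(r⁻¹) relative to the n-th
  -- term. For r > 2Λ/c the depth rc - Λ exceeds rc/2, whence the factor (c/2)^(-s) in K.
  have hmain : ∀ r : ℝ, 0 < r → 2 * Λ / c < r →
      ‖Ψ (rayPoint 0 φ r) - Complex.exp (-α * rayPoint 0 φ r) * branchPow φ (rayPoint 0 φ r) (-σ)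
          * ∑ k ∈ Finset.range (n + 1), PowerSeries.coeff k F * (rayPoint 0 φ r)⁻¹ ^ k‖
      ≤ K * Real.exp (-(φ * σ.im)) * r⁻¹ *
        ‖Complex.exp (-α * rayPoint 0 φ r) * branchPow φ (rayPoint 0 φ r) (-σ)
        * (rayPoint 0 φ r)⁻¹ ^ n‖ := by
    intro r hr hr'
    rw [div_lt_iff₀ hc0] at hr'
    have hre : (Complex.exp (θ * Complex.I) * rayPoint 0 φ r).re = r * c := by
      rw [hpt, re_exp_mul_polar, hc, ← Real.cos_neg (φ + θ)]
      congr 2; ring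
    have hz : Λ < (Complex.exp (θ * Complex.I) * rayPoint 0 φ r).re := by
      rw [hre]; linarith
    have hlap := rayLaplace_eq_sum (r := r) (φ := -φ) hDo h0 hΛ hσ hg hray hr
      (by rw [show -φ - θ = -(φ + θ) by ring, abs_neg]; exact hφθ)
      (by rwa [← hpt, mul_comm]) (n + 1)
    rw [← hpt] at hlap
    have hbr : branchPow φ (rayPoint 0 φ r) (-σ)
        = Complex.exp (-σ * (Real.log r - ((-φ : ℝ) : ℂ) * Complex.I)) := by
      rw [branchPow_rayPoint hr]; push_cast; ring_nf
    rw [hΨ _ ⟨θ, hθ, hz⟩, sectorLaplace_eq hΛ hδπ hσ hD hg hθ hz, hlap, ← hbr]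
    simp only [hF]
    have hcancel : ∀ a b c d : ℂ, a * (b * c + d) - a * b * c = a * d := fun a b c d => by ring
    rw [hcancel, norm_mul (Complex.exp _) (rayLaplace _ _ _ _),
      mul_assoc (Complex.exp _) (branchPow _ _ _) _, norm_mul (Complex.exp _) (branchPow _ _ _ * _),
      mul_left_comm]
    refine mul_le_mul_of_nonneg_left ?_ (norm_nonneg _)
    have hre0 : (θ * Complex.I : ℂ).re = 0 := by simp
    have h1 := norm_rayLaplace_le (z := rayPoint 0 φ r) (w := θ * Complex.I) hs0 hC' hray (by
      rw [hre0, Real.exp_zero, mul_one, mul_comm]; exact hz)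
    rw [hre0, Real.exp_zero, mul_one, mul_comm (rayPoint 0 φ r), hre] at h1
    refine h1.trans ?_
    have h2 : (r * c - Λ) ^ (-s) ≤ (c / 2) ^ (-s) * r ^ (-s) := by
      rw [← Real.mul_rpow (by positivity) hr.le]
      exact Real.rpow_le_rpow_of_nonpos (by positivity) (by linarith) (by linarith)
    have h3 : ‖branchPow φ (rayPoint 0 φ r) (-σ) * (rayPoint 0 φ r)⁻¹ ^ n‖
        = r ^ (-σ.re) * Real.exp (φ * σ.im) * (r⁻¹) ^ n := by
      rw [norm_mul, norm_pow, norm_inv]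
      congr 1
      · rw [branchPow_rayPoint hr, Complex.norm_exp, Real.rpow_def_of_pos hr, ← Real.exp_add]
        congr 1
        simp
        ring
      · rw [rayPoint, zero_add, norm_mul, Complex.norm_exp_ofReal_mul_I, mul_one,
          Complex.norm_real, Real.norm_eq_abs, abs_of_pos hr]
    have h4 : r ^ (-s) = r ^ (-σ.re) * r⁻¹ ^ n * r⁻¹ := by
      rw [hs', neg_add, neg_add, Real.rpow_add hr, Real.rpow_add hr, Real.rpow_neg_one,
        Real.rpow_neg hr.le (n : ℝ), Real.rpow_natCast, inv_pow]
    rw [h3]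
    have h5 : Real.exp (-(φ * σ.im)) * Real.exp (φ * σ.im) = 1 := by
      rw [← Real.exp_add, neg_add_cancel, Real.exp_zero]
    have hG := (Real.Gamma_pos_of_pos hs0).le
    calc _ ≤ Real.exp (θ * Complex.I * (σ + (n + 1 : ℕ))).re * |C| * Real.Gamma s *
          ((c / 2) ^ (-s) * r ^ (-s)) := by gcongr
      _ = K * r ^ (-s) * (Real.exp (-(φ * σ.im)) * Real.exp (φ * σ.im)) := by
        rw [h5, hK]; ring
      _ = _ := by rw [h4]; ring
  rw [Asymptotics.isLittleO_iff]
  intro ε hε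
  have hlim : Tendsto (fun r : ℝ => K * Real.exp (-(φ * σ.im)) * r⁻¹) atTop (𝓝 0) := by
    simpa using tendsto_inv_atTop_zero.const_mul (K * Real.exp (-(φ * σ.im)))
  filter_upwards [hlim.eventually (ge_mem_nhds hε), eventually_gt_atTop 0,
    eventually_gt_atTop (2 * Λ / c)] with r h1 h2 h3
  exact (hmain r h2 h3).trans (mul_le_mul_of_nonneg_right h1 (norm_nonneg _))

end Ray

/-! ### Borel summability -/

theorem hasExpansion_iterQuot {g : ℂ → ℂ} {ε r : ℝ} (hr : 0 < r) (hrε : r < ε)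
    (hg : DifferentiableOn ℂ g (ball 0 ε)) :
    HasExpansion r g (PowerSeries.mk fun n => iterQuot g n 0) := by
  lift r to NNReal using hr.le
  have hp := (hg.mono (closedBall_subset_ball hrε)).hasFPowerSeriesOnBall (by exact_mod_cast hr)
  set p := cauchyPowerSeries g 0 r
  have hcoeff : ∀ n, iterQuot g n 0 = p.coeff n := by
    intro n
    have h1 := hp.hasFPowerSeriesAt.has_fpower_series_iterate_dslope_fslope n
    have h2 := h1.coeff_zero 1
    rw [iterQuot, ← h2]
    have h3 := FormalMultilinearSeries.coeff_iterate_fslope (p := p) n 0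
    rw [zero_add] at h3
    rw [← h3]
    rfl
  intro ζ hζ
  have hmem : ζ ∈ eball (0 : ℂ) (r : ENNReal) := by
    rw [mem_eball, edist_zero_right]
    exact_mod_cast hζ
  have hterm : ∀ n, (p n fun _ => ζ)
      = PowerSeries.coeff n (PowerSeries.mk fun n => iterQuot g n 0) * ζ ^ n := by
    intro n
    rw [FormalMultilinearSeries.apply_eq_pow_smul_coeff, PowerSeries.coeff_mk, hcoeff,
      smul_eq_mul, mul_comm]
  simp only [← hterm]
  refine ⟨p.summable_norm_apply (eball_subset_eball hp.r_le hmem), ?_⟩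
  simpa using hp.hasSum hmem

theorem levelOneOp_congr {P Q : Polynomial ℂ} {R Φ Ψ : ℂ → ℂ} {z : ℂ} (h : Φ =ᶠ[𝓝 z] Ψ) :
    levelOneOp P Q R Φ z = levelOneOp P Q R Ψ z := by
  simp only [levelOneOp, fun k : ℕ => h.iteratedDeriv_eq k, h.eq_of_nhds]

theorem rpow_le_const_mul_exp (a : ℝ) {c : ℝ} (hc : 0 < c) :
    ∃ C, 0 ≤ C ∧ ∀ t : ℝ, 1 ≤ t → t ^ a ≤ C * Real.exp (c * t) := by
  refine ⟨(⌈a⌉₊.factorial : ℝ) / c ^ ⌈a⌉₊, by positivity, fun t ht => ?_⟩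
  have h1 : t ^ a ≤ t ^ ⌈a⌉₊ := by
    rw [← Real.rpow_natCast]
    exact Real.rpow_le_rpow_of_exponent_le ht (Nat.le_ceil a)
  have h2 := Real.pow_div_factorial_le_exp (c * t) (by positivity) ⌈a⌉₊
  refine h1.trans ?_
  rw [div_le_iff₀ (by positivity), mul_pow] at h2
  rw [div_mul_eq_mul_div, le_div_iff₀ (by positivity)]
  linarith

theorem branchPow_mul_exp {t : ℝ} (ht : 0 < t) (θ : ℝ) (τ : ℂ) :
    branchPow θ (rayPoint 0 θ t) (τ - 1) * Complex.exp (θ * Complex.I)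
      = Complex.exp (θ * Complex.I * τ) * (t : ℂ) ^ (τ - 1) := by
  have ht0 : (t : ℂ) ≠ 0 := by exact_mod_cast ht.ne'
  rw [branchPow_rayPoint ht, Complex.cpow_def_of_ne_zero ht0, ← Complex.ofReal_log ht.le,
    ← Complex.exp_add, ← Complex.exp_add]
  congr 1
  ring

/-- The Gamma factors cancel, so the Borel transform of the expansion is the Taylor series of g,
already continued along the ray. The strict inequality Λ₀ < Λ absorbs the growth of t^(Re τ-1) for t
≥ 1. -/
theorem isBorelSum_of_expBdd {D : Set ℂ} {Λ₀ Λ ε θ : ℝ} {α τ : ℂ} {g Φ : ℂ → ℂ}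
    {F : PowerSeries ℂ} (hDo : IsOpen D) (hε : 0 < ε) (hεD : ball 0 ε ⊆ D) (hΛ : Λ₀ < Λ)
    (hτ : 0 < τ.re) (hg : ExpBdd D Λ₀ g)
    (hw : ∀ t : ℝ, 0 < t → t * Complex.exp (θ * Complex.I) ∈ D)
    (hF : ∀ n, PowerSeries.coeff n F = Complex.Gamma (τ + n) * iterQuot g n 0)
    (hΦ : ∀ z, Λ < (Complex.exp (θ * Complex.I) * z).re →
      Φ z = Complex.exp (-α * z) * rayLaplace τ g z (θ * Complex.I)) :
    IsBorelSum α τ F θ Λ Φ := by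
  have hexp := hasExpansion_iterQuot (half_pos hε) (half_lt_self hε) (hg.holo.mono hεD)
  have hB : ∀ n, PowerSeries.coeff n (borelTransform τ F)
      = PowerSeries.coeff n (PowerSeries.mk fun n => iterQuot g n 0) := by
    intro n
    rw [borelTransform, PowerSeries.coeff_mk, PowerSeries.coeff_mk, hF,
      mul_div_cancel_left₀ _ (Gamma_add_nat_ne_zero hτ n)]
  have hsub : ∀ t : ℝ, rayPoint α θ t - α = rayPoint 0 θ t := fun t => by simp [rayPoint]
  have hpt : ∀ t : ℝ, rayPoint 0 θ t = t * Complex.exp (θ * Complex.I) := fun t => by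
    simp [rayPoint]
  have hrot : ∀ t : ℝ, rayPoint 0 θ t * Complex.exp (-(θ * Complex.I)) = t := fun t => by
    rw [hpt, mul_assoc, ← Complex.exp_add, add_neg_cancel, Complex.exp_zero, mul_one]
  have hdens : ∀ t : ℝ, 0 < t → branchPow θ (rayPoint α θ t - α) (τ - 1) *
      g (rayPoint α θ t - α) * Complex.exp (θ * Complex.I) = rayDensity τ g θ t := by
    intro t ht
    rw [hsub, mul_right_comm, branchPow_mul_exp ht, hpt, rayDensity]
  -- The domain is cut along the ray opposite to θ, where the branch of (ζ-α)^(τ-1) jumps. The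
  -- radius is halved because the expansion is available on strictly smaller disks.
  refine ⟨ε / 2, {x | x - α ∈ D ∧ (x - α) * Complex.exp (-(θ * Complex.I)) ∈ Complex.slitPlane},
    fun x => branchPow θ (x - α) (τ - 1) * g (x - α), half_pos hε, ?_, ?_, ?_, ?_, ?_, ⟨?_, ?_⟩,
    ?_⟩
  · intro w hw
    simp only [hB]
    exact (hexp w hw).2.summable
  · exact (hDo.preimage (by fun_prop)).inter (Complex.isOpen_slitPlane.preimage (by fun_prop))
  · intro t ht
    refine ⟨?_, ?_⟩
    · rw [hsub, hpt]
      exact hw t ht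
    · rw [hsub, hrot]
      exact Complex.ofReal_mem_slitPlane.2 ht
  · intro x hx
    refine DifferentiableAt.differentiableWithinAt (DifferentiableAt.mul ?_ ?_)
    · have h1 : DifferentiableAt ℂ
          (fun x => Complex.log ((x - α) * Complex.exp (-(θ * Complex.I)))) x :=
        DifferentiableAt.clog (by fun_prop) hx.2
      exact DifferentiableAt.cexp ((h1.add_const _).const_mul _)
    · exact DifferentiableAt.comp x ((hg.holo _ hx.1).differentiableAt (hDo.mem_nhds hx.1))
        (by fun_prop)
  · intro t ht htε
    have hn : ‖rayPoint 0 θ t‖ < ε / 2 := by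
      rwa [hpt, norm_mul, Complex.norm_exp_ofReal_mul_I, mul_one, Complex.norm_real,
        Real.norm_eq_abs, abs_of_pos ht]
    simp only [hB, hsub]
    rw [(hexp _ hn).2.tsum_eq]
  · intro T
    have h1 := ((hasAbscissa_rayDensity hτ hg hw).integrableOn_Ioc T).mul_const
      (Complex.exp (θ * Complex.I))⁻¹
    refine IntegrableOn.congr_fun h1 (fun t ht => ?_) measurableSet_Ioc
    rw [← hdens t ht.1, mul_inv_cancel_right₀ (Complex.exp_ne_zero _)]
  · obtain ⟨C, hC⟩ := hg.bound
    obtain ⟨C', hC'0, hC'⟩ := rpow_le_const_mul_exp (τ.re - 1) (sub_pos.2 hΛ)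
    refine ⟨Real.exp (θ * Complex.I * τ).re * C' * |C|, fun t ht => ?_⟩
    have ht0 : 0 < t := one_pos.trans_le ht
    have h1 : ‖branchPow θ (rayPoint α θ t - α) (τ - 1) * g (rayPoint α θ t - α)‖
        = ‖rayDensity τ g θ t‖ := by
      rw [← hdens t ht0, norm_mul (_ * _) (Complex.exp _), Complex.norm_exp_ofReal_mul_I, mul_one]
    have h2 := hC _ (hw t ht0)
    rw [norm_mul, Complex.norm_exp_ofReal_mul_I, mul_one, Complex.norm_real, Real.norm_eq_abs,
      abs_of_pos ht0] at h2
    rw [h1, rayDensity, norm_mul, norm_mul, Complex.norm_exp,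
      Complex.norm_cpow_eq_rpow_re_of_pos ht0, Complex.sub_re, Complex.one_re]
    have h3 : ‖g (t * Complex.exp (θ * Complex.I))‖ ≤ |C| * Real.exp (Λ₀ * t) :=
      h2.trans (mul_le_mul_of_nonneg_right (le_abs_self C) (Real.exp_nonneg _))
    calc _ ≤ Real.exp (θ * Complex.I * τ).re * (C' * Real.exp ((Λ - Λ₀) * t)) *
          (|C| * Real.exp (Λ₀ * t)) := by
          gcongr
          exact hC' t ht
      _ = Real.exp (θ * Complex.I * τ).re * C' * |C| *
          (Real.exp ((Λ - Λ₀) * t) * Real.exp (Λ₀ * t)) := by ring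
      _ = _ := by rw [← Real.exp_add]; congr 2; ring
  · intro z hz
    rw [hΦ z hz, exp_mul_rayLaplace, expLaplace, laplace]
    refine setIntegral_congr_fun measurableSet_Ioi fun t ht => ?_
    rw [← hdens t ht, rayPoint, neg_mul, mul_assoc (Complex.exp _)]

/-! ### Uniqueness of the distinguished solution -/

/-- Membership in the dual space gives decay along each half-plane of the dual domain. -/
theorem MemDualSpace.decay {μ δ Λ N θ : ℝ} {h : ℂ → ℂ} (hN : 0 ≤ N) (hΛ : 0 ≤ Λ)
    (hθ : |θ - μ| < δ) (hh : MemDualSpace μ δ Λ (-N) h) :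
    Decay (Complex.exp (θ * Complex.I)) N h := by
  obtain ⟨C, hC⟩ := hh.bound
  refine ⟨2 * Λ + 1, |C| * (1 / 2) ^ (-N), by linarith, by positivity, fun z hz => ?_⟩
  have hx : 2 * Λ + 1 < (Complex.exp (θ * Complex.I) * z).re := hz
  set x := (Complex.exp (θ * Complex.I) * z).re with hxdef
  have hzΛ : Λ < x := by linarith
  have h1 := le_infDist_frontier hΛ hθ hzΛ
  rw [← hxdef] at h1
  have hx0 : 0 < x := by linarith
  refine (hC z ⟨θ, hθ, hzΛ⟩).trans ?_
  rw [mul_assoc, ← Real.mul_rpow (by norm_num) hx0.le]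
  refine mul_le_mul (le_abs_self C) ?_ (Real.rpow_nonneg infDist_nonneg _) (abs_nonneg C)
  exact Real.rpow_le_rpow_of_nonpos (by linarith) (by linarith) (by linarith)

/-- Vanishing on a distant half-plane propagates by the identity theorem, half-planes being convex.
-/
theorem eqOn_halfPlane_zero {e : ℂ} (he : ‖e‖ = 1) {M₀ M : ℝ} {f : ℂ → ℂ}
    (hf : DifferentiableOn ℂ f (halfPlane e M₀)) (h0 : ∀ z ∈ halfPlane e M, f z = 0) :
    EqOn f 0 (halfPlane e M₀) := by
  have he0 : e ≠ 0 := fun h => by simp [h] at he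
  have hconv : Convex ℝ (halfPlane e M₀) := by
    refine convex_halfSpace_gt ⟨fun x y => ?_, fun c x => ?_⟩ M₀
    · rw [mul_add, Complex.add_re]
    · rw [mul_smul_comm, Complex.smul_re]
  have hmem : e * (((max M₀ M + 1 : ℝ) : ℂ) * e⁻¹) = ((max M₀ M + 1 : ℝ) : ℂ) := by
    field_simp
  refine (hf.analyticOnNhd (isOpen_halfPlane e M₀)).eqOn_zero_of_preconnected_of_eventuallyEq_zero
    hconv.isPreconnected (z₀ := ((max M₀ M + 1 : ℝ) : ℂ) * e⁻¹) ?_ ?_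
  · change M₀ < _
    rw [hmem, Complex.ofReal_re]
    linarith [le_max_left M₀ M]
  · filter_upwards [(isOpen_halfPlane e M).mem_nhds (show _ ∈ halfPlane e M by
      change M < _
      rw [hmem, Complex.ofReal_re]
      linarith [le_max_right M₀ M])] with z hz
    exact h0 z hz

theorem differentiableOn_branchPow_dualDomain {μ δ Λ : ℝ} (hΛ : 0 ≤ Λ) (hδπ : δ ≤ Real.pi / 2)
    (s : ℂ) : DifferentiableOn ℂ (fun z => branchPow (-μ) z s) (dualDomain μ δ Λ) := by
  rintro z ⟨θ, hθ, hz⟩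
  refine DifferentiableAt.differentiableWithinAt ?_
  have hslit : z * Complex.exp (-(((-μ : ℝ) : ℂ) * Complex.I)) ∈ Complex.slitPlane := by
    obtain ⟨r, φ, hr, hφ, rfl⟩ := exists_polar (hΛ.trans_lt hz)
    have h1 : |μ - φ| < Real.pi := by
      rw [abs_sub_comm]
      calc |φ - μ| ≤ |φ - θ| + |θ - μ| := abs_sub_le _ _ _
        _ < Real.pi := by linarith
    rw [abs_lt] at h1
    have h2 : (r * Complex.exp (-(φ * Complex.I)) *
        Complex.exp (-(((-μ : ℝ) : ℂ) * Complex.I)) : ℂ)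
        = r * Complex.exp (((μ - φ : ℝ) : ℂ) * Complex.I) := by
      rw [mul_assoc, ← Complex.exp_add]
      congr 2
      push_cast
      ring
    rw [h2, Complex.mem_slitPlane_iff, Complex.re_ofReal_mul, Complex.im_ofReal_mul,
      Complex.exp_ofReal_mul_I_re, Complex.exp_ofReal_mul_I_im]
    by_cases h3 : μ - φ = 0
    · left
      rw [h3, Real.cos_zero, mul_one]
      exact hr
    · right
      exact mul_ne_zero hr.ne' fun h4 => h3 ((Real.sin_eq_zero_iff_of_lt_of_lt h1.1 h1.2).1 h4)
  have h1 : DifferentiableAt ℂ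
      (fun z => Complex.log (z * Complex.exp (-(((-μ : ℝ) : ℂ) * Complex.I)))) z :=
    DifferentiableAt.clog (by fun_prop) hslit
  exact DifferentiableAt.cexp ((h1.add_const _).const_mul _)

theorem IsDistinguishedSolution.differentiableOn {P Q : Polynomial ℂ} {R : ℂ → ℂ} {α : ℂ}
    {μ δ Λ : ℝ} {Ψ : ℂ → ℂ} (hΛ : 0 ≤ Λ) (hδπ : δ ≤ Real.pi / 2)
    (hΨ : IsDistinguishedSolution P Q R α μ δ Λ Ψ) :
    DifferentiableOn ℂ Ψ (dualDomain μ δ Λ) := by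
  obtain ⟨h, hh, hΨ'⟩ := hΨ.affine
  refine DifferentiableOn.congr (DifferentiableOn.mul (Differentiable.differentiableOn
    (by fun_prop)) ((differentiableOn_branchPow_dualDomain hΛ hδπ _).add hh.holo)) hΨ'

theorem exists_bound_comp_inv {R : ℂ → ℂ} {r : ℝ} (hr : 0 < r)
    (hR : DifferentiableOn ℂ R (ball 0 r)) {e : ℂ} (he : ‖e‖ = 1) :
    ∃ S M, ∀ z ∈ halfPlane e M, ‖R z⁻¹‖ ≤ S := by
  have hc : ContinuousAt R 0 := (hR.differentiableAt (ball_mem_nhds 0 hr)).continuousAt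
  obtain ⟨ε, hε, h⟩ := Metric.continuousAt_iff.1 hc 1 one_pos
  refine ⟨‖R 0‖ + 1, ε⁻¹, fun z hz => ?_⟩
  have h1 : ε⁻¹ < ‖z‖ := (show ε⁻¹ < (e * z).re from hz).trans_le (re_mul_le_norm he)
  have h2 : dist z⁻¹ 0 < ε := by
    rw [dist_zero_right, norm_inv]
    exact inv_lt_of_inv_lt₀ hε h1
  have h3 := (h h2).le
  rw [dist_eq_norm] at h3
  linarith [norm_le_insert' (R z⁻¹) (R 0)]

/-- Distinguished solutions are unique. -/
theorem eqOn_of_isDistinguishedSolution {P p Q : Polynomial ℂ} {R : ℂ → ℂ} {A : ℝ} {α : ℂ}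
    {μ δ Λ₁ Λ₂ : ℝ} {Φ Ψ : ℂ → ℂ} (hδπ : δ ≤ Real.pi / 2)
    (hP : P = (Polynomial.X + Polynomial.C α) * p) (hp : p.Monic)
    (hroots : ∀ γ, p.IsRoot (-α - γ) → γ ≠ 0 ∧ γ ∉ closure (sector 0 μ δ))
    (hdeg : Q.natDegree = p.natDegree) (hA : 0 < A) (hR : DifferentiableOn ℂ R (ball 0 A⁻¹))
    (hpα : Q.eval (-α) = exponent P Q α * p.eval (-α)) (hτ : 0 < (exponent P Q α).re)
    (hΛ₁ : 0 ≤ Λ₁) (hΛ₂ : 0 ≤ Λ₂) (hΦ : IsDistinguishedSolution P Q R α μ δ Λ₁ Φ)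
    (hΨ : IsDistinguishedSolution P Q R α μ δ Λ₂ Ψ) :
    EqOn Φ Ψ (dualDomain μ δ (max Λ₁ Λ₂)) := by
  rintro z₁ ⟨θ, hθ, hz₁⟩
  set e := Complex.exp (θ * Complex.I) with he_def
  have he : ‖e‖ = 1 := Complex.norm_exp_ofReal_mul_I θ
  set τ := exponent P Q α with hτdef
  set M₀ := max Λ₁ Λ₂ with hM₀
  set U := halfPlane e M₀ with hU
  have hUo : IsOpen U := isOpen_halfPlane e M₀
  have hU₁ : U ⊆ dualDomain μ δ Λ₁ := fun z hz => ⟨θ, hθ, (le_max_left _ _).trans_lt hz⟩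
  have hU₂ : U ⊆ dualDomain μ δ Λ₂ := fun z hz => ⟨θ, hθ, (le_max_right _ _).trans_lt hz⟩
  obtain ⟨h₁, hh₁, hΦ'⟩ := hΦ.affine
  obtain ⟨h₂, hh₂, hΨ'⟩ := hΨ.affine
  have hN : -τ.re - 1 = -(τ.re + 1) := by ring
  rw [← hτdef, hN] at hh₁ hh₂
  have hfU : DifferentiableOn ℂ (fun z => h₁ z + -1 * h₂ z) U :=
    (hh₁.holo.mono hU₁).add ((hh₂.holo.mono hU₂).const_mul _)
  set y : holoOn U := holoRestrict _ hfU with hy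
  have hyz : ∀ z ∈ U, y.1 z = h₁ z + -1 * h₂ z := fun z hz =>
    indicator_of_mem hz (fun z => h₁ z + -1 * h₂ z)
  have hydec : Decay e (τ.re + 1) y.1 := by
    refine ((hh₁.decay (by linarith) hΛ₁ hθ).add
      ((hh₂.decay (by linarith) hΛ₂ hθ).const_mul (-1))).congr (M₀ := M₀) fun z hz => ?_
    exact (hyz z hz).symm
  have hΦU := (hΦ.differentiableOn hΛ₁ hδπ).mono hU₁
  have hΨU := (hΨ.differentiableOn hΛ₂ hδπ).mono hU₂
  have hdiff : holoRestrict Φ hΦU - holoRestrict Ψ hΨU = expMul α y := by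
    -- The normalised powers z^(-τ) of the two solutions cancel; what is left decays with order Re τ
    -- + 1, strictly beyond Re τ.
    refine Subtype.ext (funext fun z => ?_)
    by_cases hz : z ∈ U
    · change U.indicator Φ z - U.indicator Ψ z = Complex.exp (-α * z) * y.1 z
      rw [indicator_of_mem hz, indicator_of_mem hz, hyz z hz, hΦ' z (hU₁ hz), hΨ' z (hU₂ hz)]
      ring
    · rw [(expMul α y).2.2 z hz]
      exact (holoRestrict Φ hΦU - holoRestrict Ψ hΨU).2.2 z hz
  set D := hpDeriv e M₀ with hD
  set p₁ := p.comp (Polynomial.X - Polynomial.C α) with hp₁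
  set q₁ := Q.comp (Polynomial.X - Polynomial.C α) with hq₁
  have hPcomp : P.comp (Polynomial.X - Polynomial.C α) = p₁ * Polynomial.X := by
    rw [hP, Polynomial.mul_comp, Polynomial.add_comp, Polynomial.X_comp, Polynomial.C_comp,
      sub_add_cancel, mul_comm]
  have hop : ∀ (q : Polynomial ℂ) (z : ℂ), z ∈ U →
      q.sum (fun k c => c * iteratedDeriv k Φ z) - q.sum (fun k c => c * iteratedDeriv k Ψ z)
        = Complex.exp (-α * z) *
          (Polynomial.aeval D (q.comp (Polynomial.X - Polynomial.C α)) y).1 z := by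
    intro q z hz
    rw [← aeval_holoDeriv_apply hUo Φ hΦU q hz, ← aeval_holoDeriv_apply hUo Ψ hΨU q hz]
    have h3 := congrArg (fun w => (Polynomial.aeval (holoDeriv hUo) q w).1 z) hdiff
    simp only [map_sub] at h3
    rw [aeval_holoDeriv_expMul] at h3
    exact h3
  have heq : ∀ z ∈ U, (Polynomial.aeval D p₁ (D y)).1 z + z⁻¹ * (Polynomial.aeval D q₁ y).1 z
      + z⁻¹ ^ 2 * R z⁻¹ * y.1 z = 0 := by
    intro z hz
    have h1 := hΦ.solves z (hU₁ hz)
    have h2 := hΨ.solves z (hU₂ hz)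
    have h3 := hop P z hz
    have h4 := hop Q z hz
    have h5 : Φ z - Ψ z = Complex.exp (-α * z) * y.1 z := by
      rw [hyz z hz, hΦ' z (hU₁ hz), hΨ' z (hU₂ hz)]
      ring
    rw [hPcomp, map_mul, Polynomial.aeval_X, Module.End.mul_apply] at h3
    rw [levelOneOp] at h1 h2
    refine (mul_eq_zero_iff_left (Complex.exp_ne_zero (-α * z))).1 ?_
    linear_combination h1 - h2 - h3 - z⁻¹ * h4 - z⁻¹ ^ 2 * R z⁻¹ * h5
  have hp₁m : p₁.Monic := hp.comp_X_sub_C α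
  have hdeg₁ : q₁.natDegree = p₁.natDegree := by
    rw [hp₁, hq₁, Polynomial.natDegree_comp, Polynomial.natDegree_comp, hdeg]
  -- The obstructed ray for inverting p₁(D) is the ray of the sector in direction θ, together with
  -- its tip. It contains no root by the assumption on the sector and the simplicity of -α.
  have hroots₁ : ∀ γ, p₁.IsRoot (-γ) → ∀ t : ℝ, 0 ≤ t → γ ≠ t * e := by
    intro γ hγ t ht hγt
    have h1 : p.IsRoot (-α - γ) := by
      rw [Polynomial.IsRoot, hp₁, Polynomial.eval_comp] at hγ
      rw [Polynomial.IsRoot, ← hγ]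
      congr 1
      simp
      ring
    obtain ⟨h2, h3⟩ := hroots γ h1
    have ht0 : 0 < t := lt_of_le_of_ne ht fun h => h2 (by rw [hγt, ← h]; simp)
    exact h3 (subset_closure (hγt ▸ ray_mem_sector hθ ht0))
  have hτ₁ : q₁.eval 0 = τ * p₁.eval 0 := by
    rw [hp₁, hq₁, Polynomial.eval_comp, Polynomial.eval_comp]
    simpa using hpα
  obtain ⟨S, M₁, hS⟩ := exists_bound_comp_inv (inv_pos.2 hA) hR he
  obtain ⟨M, hM⟩ := exists_eq_zero_of_decay he hp₁m hroots₁ hdeg₁ hτ₁ hτ.le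
    (show τ.re < τ.re + 1 by linarith) hS hydec heq
  have hzero : y.1 z₁ = 0 := eqOn_halfPlane_zero he y.2.1 hM hz₁
  rw [hyz z₁ hz₁] at hzero
  rw [hΦ' z₁ (hU₁ hz₁), hΨ' z₁ (hU₂ hz₁)]
  have h1 : h₁ z₁ = h₂ z₁ := by linear_combination hzero
  rw [h1]

/-! ### Assembly of the theorem -/

theorem isAsymptoticExpansionAt_of_dualDomain {α τ : ℂ} {F : PowerSeries ℂ} {Φ : ℂ → ℂ}
    {μ δ Λ θ : ℝ} (hΛ : 0 ≤ Λ) (hθ : |θ - μ| < δ)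
    (hΦ : DifferentiableOn ℂ Φ (dualDomain μ δ Λ))
    (h : ∀ φ : ℝ, |φ + μ| < δ + Real.pi / 2 → IsAsymptoticAlong α τ F Φ φ) :
    IsAsymptoticExpansionAt α τ F Φ (-θ) := by
  have hπ := Real.pi_pos
  have hc : 0 < Real.cos (Real.pi / 4) :=
    Real.cos_pos_of_mem_Ioo ⟨by linarith, by linarith⟩
  refine ⟨Real.pi / 4, Λ / Real.cos (Real.pi / 4), by positivity, by positivity,
    hΦ.mono ?_, fun φ hφ => h φ ?_⟩
  · rintro z ⟨φ, r, hφ, hr, rfl⟩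
    rw [sub_neg_eq_add] at hφ
    have h0 : 0 < r := (div_nonneg hΛ hc.le).trans_lt hr
    rw [div_lt_iff₀ hc] at hr
    refine ⟨θ, hθ, ?_⟩
    have h1 : rayPoint 0 φ r = r * Complex.exp (-(((-φ : ℝ) : ℂ) * Complex.I)) := by
      simp [rayPoint]
    rw [h1, re_exp_mul_polar, show -φ - θ = -(φ + θ) by ring, Real.cos_neg,
      ← Real.cos_abs (φ + θ)]
    refine hr.trans_le (mul_le_mul_of_nonneg_left ?_ h0.le)
    exact Real.cos_le_cos_of_nonneg_of_le_pi (abs_nonneg _) (by linarith) hφ.le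
  · rw [sub_neg_eq_add] at hφ
    calc |φ + μ| = |(φ + θ) - (θ - μ)| := by congr 1; ring
      _ ≤ |φ + θ| + |θ - μ| := abs_sub _ _
      _ < δ + Real.pi / 2 := by linarith

theorem exists_eq_mul_of_isRoot {P : Polynomial ℂ} {α : ℂ} (hP : P.Monic)
    (hα : P.IsRoot (-α)) : ∃ p : Polynomial ℂ, P = (Polynomial.X + Polynomial.C α) * p ∧
      p.Monic ∧ P.natDegree = p.natDegree + 1 ∧ P.derivative.eval (-α) = p.eval (-α) := by
  obtain ⟨p, hp⟩ := Polynomial.dvd_iff_isRoot.2 hα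
  rw [map_neg, sub_neg_eq_add] at hp
  have hm : p.Monic := (Polynomial.monic_X_add_C α).of_mul_monic_left (hp ▸ hP)
  refine ⟨p, hp, hm, ?_, ?_⟩
  · rw [hp, (Polynomial.monic_X_add_C α).natDegree_mul hm, Polynomial.natDegree_X_add_C, add_comm]
  · rw [hp, Polynomial.derivative_mul]
    simp

/-- The solution of the equation in the position domain: `ζ ^ (τ - 1) * g ζ` is the Borel
transform, shifted to the origin, of the distinguished solution. -/
theorem exists_position_solution {p Q : Polynomial ℂ} {ρ : ℕ → ℂ} {B C : ℝ} {α τ : ℂ} {μ δ : ℝ}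
    (hp : p.Monic) (hroots : ∀ γ, p.IsRoot (-α - γ) → γ ≠ 0 ∧ γ ∉ closure (sector 0 μ δ))
    (hdeg : Q.natDegree = p.natDegree) (hB : 0 < B) (hρ : ∀ n, ‖ρ n‖ ≤ C * B ^ n)
    (hpα : Q.eval (-α) = τ * p.eval (-α)) (hpα0 : p.eval (-α) ≠ 0) (hτ : 0 < τ.re) :
    ∃ (ε : ℝ) (g : ℂ → ℂ), 0 < ε ∧ ExpBdd (ball 0 ε ∪ sector 0 μ δ) (B + 1) g ∧
      g 0 * Complex.Gamma τ = 1 ∧ (∀ ζ ∈ ball 0 ε ∪ sector 0 μ δ, p.eval (-α - ζ) ≠ 0) ∧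
      ∀ ζ ∈ ball 0 ε ∪ sector 0 μ δ, g ζ + volterra (borelKernel p Q ρ α) τ g ζ = 0 := by
  obtain ⟨ε, hε, hne, C', hK⟩ := exists_isKernel_borelKernel hp α hroots hdeg hB hρ
  have hDo : IsOpen (ball 0 ε ∪ sector 0 μ δ) := isOpen_ball.union (isOpen_sector_zero μ δ)
  have h0 : (0 : ℂ) ∈ ball 0 ε ∪ sector 0 μ δ := Or.inl (mem_ball_self hε)
  have hK0 : ∀ x, borelKernel p Q ρ α 0 x = -τ := by
    intro x
    rw [borelKernel, mul_zero, mul_zero, borelTail_zero, add_zero, sub_zero, hpα, div_neg,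
      mul_div_cancel_right₀ _ hpα0]
  obtain ⟨g, hg, hg0, heq⟩ := exists_regularSingular_solution hDo h0
    (isStar_ball_union_sector hε) hB.le hK hτ hK0 (lt_add_one B)
  -- The Laplace transform of ζ^(τ-1) is Γ(τ) z^(-τ); dividing by Γ(τ) gives the leading coefficient
  -- 1.
  refine ⟨ε, fun ζ => (Complex.Gamma τ)⁻¹ * g ζ, hε, hg.const_mul _, ?_, hne, fun ζ hζ => ?_⟩
  · change (Complex.Gamma τ)⁻¹ * g 0 * Complex.Gamma τ = 1
    rw [hg0, mul_one, inv_mul_cancel₀]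
    simpa using Gamma_add_nat_ne_zero hτ 0
  · rw [volterra_const_mul, ← mul_add, heq ζ hζ, mul_zero]

end BorelReg

theorem corollary1p7
    (P Q : Polynomial ℂ) (R : ℂ → ℂ) (A : ℝ) (α : ℂ) (μ δ : ℝ)
    -- `P` is monic with simple roots
    (hP : P.Monic) (hPsimple : ∀ x : ℂ, P.IsRoot x → P.derivative.eval x ≠ 0)
    -- `Q` has degree one less than `P` and does not vanish at the roots of `P`
    (hQdeg : Q.natDegree + 1 = P.natDegree) (hQ : ∀ x : ℂ, P.IsRoot x → Q.eval x ≠ 0)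
    -- `R (z⁻¹)` is holomorphic on the disk `|z| > A` around infinity
    (hA : 0 < A) (hR : DifferentiableOn ℂ R (Metric.ball 0 A⁻¹))
    -- `-α` is a root of `P`, with an exponent for which Laplace integrals at `α` converge
    (hα : P.IsRoot (-α)) (hτ : 0 < (BorelReg.exponent P Q α).re)
    -- the sector has opening angle `2 * δ` at most `π` and touches no other root of `P (-ζ)`
    (hδ : 0 < δ) (hδπ : δ ≤ Real.pi / 2)
    (hsector : ∀ β : ℂ, P.IsRoot (-β) → β ≠ α → β ∉ closure (BorelReg.sector α μ δ)) :
    ∃ (Λ : ℝ) (Ψ : ℂ → ℂ), A ≤ Λ ∧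
      -- `Ψ` is the distinguished solution
      BorelReg.IsDistinguishedSolution P Q R α μ δ Λ Ψ ∧
      (∀ (M : ℝ) (Φ : ℂ → ℂ), A ≤ M → BorelReg.IsDistinguishedSolution P Q R α μ δ M Φ →
        Set.EqOn Φ Ψ (BorelReg.dualDomain μ δ (max Λ M))) ∧
      -- it is asymptotic to a formal solution, whose Borel sum in every direction is `Ψ`
      (∃ F : PowerSeries ℂ,
        BorelReg.IsFormalSolution P Q R α (BorelReg.exponent P Q α) F ∧
        (∀ φ : ℝ, |φ + μ| < δ + Real.pi / 2 →
          BorelReg.IsAsymptoticAlong α (BorelReg.exponent P Q α) F Ψ φ) ∧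
        (∀ θ : ℝ, |θ - μ| < δ →
          BorelReg.IsBorelSum α (BorelReg.exponent P Q α) F θ Λ Ψ)) ∧
      -- it is Borel regular
      (∀ θ : ℝ, |θ - μ| < δ →
        BorelReg.IsBorelRegular α (BorelReg.exponent P Q α) θ Ψ) := by
  open BorelReg in
  obtain ⟨p, hPp, hp, hdegP, hderiv⟩ := exists_eq_mul_of_isRoot hP hα
  have hpα0 : p.eval (-α) ≠ 0 := hderiv ▸ hPsimple _ hα
  have hdeg : Q.natDegree = p.natDegree := by omega
  set τ := exponent P Q α with hτdef
  have hpα : Q.eval (-α) = τ * p.eval (-α) := by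
    rw [hτdef, exponent, hderiv, div_mul_cancel₀ _ hpα0]
  have hroots : ∀ γ, p.IsRoot (-α - γ) → γ ≠ 0 ∧ γ ∉ closure (sector 0 μ δ) := by
    intro γ hγ
    have hγ0 : γ ≠ 0 := by
      rintro rfl
      rw [sub_zero] at hγ
      exact hpα0 hγ
    refine ⟨hγ0, ?_⟩
    have hroot : P.IsRoot (-(α + γ)) := by
      rw [hPp, neg_add']
      exact Polynomial.root_mul_left_of_isRoot _ hγ
    have h1 := sub_notMem_closure_sector (hsector _ hroot (by simpa using hγ0))
    rwa [add_sub_cancel_left] at h1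
  have hB : 0 < A + 1 := by linarith
  obtain ⟨C, hρ⟩ := exists_taylor_bound hA (lt_add_one A) hR
  obtain ⟨ε, g, hε, hg, hg0, hne, heq⟩ :=
    exists_position_solution hp hroots hdeg hB hρ hpα hpα0 hτ
  set D := Metric.ball 0 ε ∪ sector 0 μ δ with hD
  have hDo : IsOpen D := Metric.isOpen_ball.union (isOpen_sector_zero μ δ)
  have hεD : Metric.ball 0 ε ⊆ D := Set.subset_union_left
  have hSD : sector 0 μ δ ⊆ D := Set.subset_union_right
  have h0 : (0 : ℂ) ∈ D := hεD (Metric.mem_ball_self hε)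
  -- The Taylor coefficients of R grow with ratio A + 1, and g has type A + 2. One more unit leaves
  -- room for the power factor in the Borel sum.
  set Λ := A + 3 with hΛ
  have hΛ0 : 0 ≤ Λ := by linarith
  have hgΛ : ExpBdd D Λ g := hg.mono_type (by linarith)
  have hτ1 : 0 < (τ + 1).re := by rw [Complex.add_re, Complex.one_re]; linarith
  set Ψ : ℂ → ℂ := fun z => Complex.exp (-α * z) * sectorLaplace μ δ Λ τ g z with hΨ
  set F : PowerSeries ℂ :=
    PowerSeries.mk fun n => Complex.Gamma (τ + n) * iterQuot g n 0 with hF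
  have hFn : ∀ n, PowerSeries.coeff n F = Complex.Gamma (τ + n) * iterQuot g n 0 := fun n =>
    PowerSeries.coeff_mk _ _
  have hray : ∀ θ : ℝ, |θ - μ| < δ → ∀ t : ℝ, 0 < t → t * Complex.exp (θ * Complex.I) ∈ D :=
    fun θ hθ t ht => hSD (ray_mem_sector hθ ht)
  have hdist : IsDistinguishedSolution P Q R α μ δ Λ Ψ := by
    refine ⟨?_, sectorLaplace μ δ Λ (τ + 1) (dslope g 0), ?_, fun z hz => ?_⟩
    · rintro z ⟨θ, hθ, hz⟩
      -- Near z one fixed direction represents the solution, and the differential operator only sees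
      -- the germ.
      have hgerm : Ψ =ᶠ[nhds z]
          expLaplace α (Complex.exp (θ * Complex.I)) (rayDensity τ g θ) := by
        filter_upwards [eventually_sectorLaplace_eq hΛ0 hδπ hτ hSD hgΛ hθ hz] with w hw
        rw [← exp_mul_rayLaplace, ← hw]
      rw [levelOneOp_congr hgerm]
      refine levelOneOp_expLaplace hA hR (lt_add_one A) hρ (by linarith)
        (hasAbscissa_rayDensity hτ hgΛ (hray θ hθ)) (fun t ht => ?_) (by rwa [mul_comm])
      exact ray_equation hPp ht (hne _ (hray θ hθ t ht)) (heq _ (hray θ hθ t ht))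
    · have h1 := memDualSpace_sectorLaplace hΛ0 hδ hδπ hτ1 hSD (hgΛ.exists_eq_mul hDo h0 hΛ0)
      rwa [Complex.add_re, Complex.one_re, neg_add'] at h1
    · simp only [hΨ]
      rw [sectorLaplace_eq_add hΛ0 hδπ hτ hSD hDo h0 hgΛ hz, hg0, one_mul]
  have hasymp : ∀ φ : ℝ, |φ + μ| < δ + Real.pi / 2 → IsAsymptoticAlong α τ F Ψ φ := fun φ hφ =>
    isAsymptoticAlong_sectorLaplace hΛ0 hδ hδπ hτ hSD hDo h0 hgΛ hFn (fun _ _ => rfl) hφ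
  have hborel : ∀ θ : ℝ, |θ - μ| < δ → IsBorelSum α τ F θ Λ Ψ := by
    intro θ hθ
    refine isBorelSum_of_expBdd hDo hε hεD (by linarith) hτ hg (hray θ hθ) hFn fun z hz => ?_
    simp only [hΨ]
    rw [sectorLaplace_eq hΛ0 hδπ hτ hSD hgΛ hθ hz]
  refine ⟨Λ, Ψ, by linarith, hdist, fun M Φ hM hΦ => ?_, ⟨F, ?_, hasymp, hborel⟩, fun θ hθ =>
    ⟨F, isAsymptoticExpansionAt_of_dualDomain hΛ0 hθ (hdist.differentiableOn hΛ0 hδπ) hasymp,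
      Λ, hborel θ hθ⟩⟩
  · rw [max_comm]
    exact eqOn_of_isDistinguishedSolution hδπ hPp hp hroots hdeg hA hR hpα hτ (hA.le.trans hM)
      hΛ0 hΦ hdist
  · have hsub : Metric.ball (0 : ℂ) (ε / 2) ⊆ D :=
      (Metric.ball_subset_ball (half_le_self hε.le)).trans hεD
    exact isFormalSolution_of_volterra hPp (half_pos hε) hτ hB hρ
      (hg.holo.continuousOn.mono hsub)
      (hasExpansion_iterQuot (half_pos hε) (half_lt_self hε) (hg.holo.mono hεD))
      (fun n => by rw [hFn, PowerSeries.coeff_mk]) (fun ζ hζ => hne ζ (hsub hζ))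
      (fun ζ hζ => heq ζ (hsub hζ))
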